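/- Let $\mathbb K$ be an algebraically closed field of characteristic $0$ and fix $i\in\mathbb K$ with $i^2=-1$. **Actions.** An additive action on a hyperquadric is represented by a triple $(R,W,F)$: $R$ is a finite-dimensional commutative local $\mathbb K$-algebra with maximal ideal $\mathfrak m$, $W\subset\mathfrak m$ is a hyperplane generating $R$ as a unital algebra, and $F$ is a symmetric bilinear form on $R$ with $F(1,1)=0$, $F|_{\mathfrak m\times\mathfrak m}\neq0$ and $F(ab,c)+F(b,ac)=0$ for $a\in W$, $b,c\in R$. The vector group $W\cong\mathbb G_a^n$ acts on $\mathbb P(R)=\mathbb P^{n+1}$ by $w\cdot[r]=[\exp(w)r]$; the quadric is $Q=\{F(r,r)=0\}$, of dimension $n=\dim W$, with open orbit $O=W\cdot[1]$; its corank is $\dim\operatorname{Ker}F$. Let $l$ be the maximal dimension of the orbits in $Q\setminus O$. Two triples are equivalent if there is a $\mathbb K$-algebra isomorphism $\Gamma:R\to R'$ with $\Gamma(W)=W'$. **Sequence and type.** Put $V^{(0)}=W$, $V_{(0)}=\operatorname{Ker}F$, $V^{(k+1)}=\{\alpha\in V^{(k)}:\alpha V_{(k)}=0\}$, $V_{(k+1)}=\operatorname{Ker}(F|_{V^{(k+1)}})$.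 Let $s$ be the least $k$ such that $V^{(k)}V_{(k)}=0$ (then the letter is $A$), or else $V_{(k)}\not\subseteq V_{(k+1)}$ (letter $B$), or else $V_{(k)}=V_{(k+1)}$ (letter $C$). Put $N=s$ for the letters $A,B$ and $N=s+1$ for $C$. The normalized type is the letter $x$ with an index: $x_0$ if $x\in\{B,C\}$ and $s=0$; otherwise $x_1$ if $V_{(N)}=V^{(N)}$, and $x_2$ if $V_{(N)}\ne V^{(N)}$. **Normalized structure.** A canonical matrix is a block diagonal matrix with blocks $B_m(\lambda)$, $m\ge1$, $\lambda\in\mathbb K$, where $B_m(\lambda)$ is the symmetric $m\times m$ matrix with entries $$\lambda\,[x=y]+\tfrac12[\,|x-y|=1\,]+\tfrac i2\big([x+y=m]-[x+y=m+2]\big),\qquad 1\le x,y\le m.$$ Let $\delta=1$ if $\dim\mathfrak m^2=3$ and $\delta=0$ otherwise. A normalized structure with canonical matrix $\Lambda$ consists of $b_0\in\mathfrak m^2\setminus W$ with $F(1,b_0)=-1$, $b_0\mathfrak m=0$, and a basis of $W$ consisting of $\mu_1$, $g_0=\mu_2$, $g_1,\dots,g_s$, $f_1,\dots,f_N$ and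 elements $e_k$ indexed by the rows of $\Lambda$, such that $\operatorname{Ker}F=\langle\mu_1,\mu_2\rangle$, $\mu_1\mathfrak m=0$, $f_i\in V^{(i-1)}\setminus V^{(i)}$, $g_j\in V_{(j)}\setminus V_{(j-1)}$ ($j\ge1$), $V^{(N)}=V_{(N)}\oplus\langle e_k\rangle_k$, and $$e_ke_l=\delta_{kl}b_0+\Lambda_{kl}\mu_1,\quad e_kf_i=e_kg_j=0,\quad f_ig_i=b_0,\quad f_ig_{i-1}=\mu_1,\quad f_ig_j=0\ (i-j\notin\{0,1\}),$$ $f_if_j=0$ for $i\neq j$; $g_ig_j=0$ for all $i,j$, except that $g_s^2=\mu_1$ when the letter is $B$; and $f_i^2=[i=1]\,\delta\mu_2+[i=s+1]\,b_0$ (the last term occurs only for the letter $C$). For the types $A_1,B_1,C_1$ there are no $e_k$ and $\Lambda$ is empty. Two canonical matrices differ by an elementary transformation if, for some $a\in\mathbb K^\times$, $h\in\mathbb K$, the blocks of the second are, up to a permutation, the blocks $B_m(a\lambda+h)$, where $B_m(\lambda)$ runs through the blocks of the first. **Theorem.** Let $(R,W,F)$ and $(R',W',F')$ represent additive actions on hyperquadrics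 $Q$, $Q'$ of corank two and dimension at least $5$ whose singular loci are not fixed pointwise by the actions. Then each of them has a normalized structure, and: (i) If the two actions are equivalent, then - (a) they have the same normalized type, the same $s$ and the same $l$; - (b) if the type is $A_1$, $B_1$ or $C_1$, their normalized structures coincide: matching the elements of any two normalized structures $(\mu_1,\mu_2,b_0,g_j,f_i)$ and $(\mu_1',\mu_2',b_0',g_j',f_i')$ defines an algebra isomorphism $R\to R'$ carrying $F$ to $F'$; - (c) otherwise any canonical matrices $\Lambda$, $\Lambda'$ of the two actions differ by an elementary transformation. (ii) Conversely, if the two actions have the same normalized type, the same $s$ and the same $l$, and, when the type is not $A_1,B_1,C_1$, some canonical matrices of theirs differ by an elementary transformation, then the two actions are equivalent. -/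

import Mathlib

open Module

namespace AdditiveQuadric

noncomputable section

variable {K R R' : Type*} [Field K]
variable [CommRing R] [IsLocalRing R] [Algebra K R]
variable [CommRing R'] [IsLocalRing R'] [Algebra K R']

/-- The maximal ideal `𝔪` of a local `K`-algebra, as a `K`-subspace. -/
def maxSubspace (K R : Type*) [Field K] [CommRing R] [IsLocalRing R] [Algebra K R] :
    Submodule K R :=
  (IsLocalRing.maximalIdeal R).restrictScalars K

/-- The `K`-subspace `𝔪²`. -/
def maxSq (K R : Type*) [Field K] [CommRing R] [IsLocalRing R] [Algebra K R] :
    Submodule K R :=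
  (IsLocalRing.maximalIdeal R ^ 2).restrictScalars K

/-- A triple `(R, W, F)`: `W` is a hyperplane of the maximal ideal of the local algebra `R`
which generates `R` as a unital algebra, and `F` is an invariant bilinear form for `W`.
Such triples represent the additive actions on hyperquadrics: the projective space is `ℙ(R)`,
the quadric is `F(r, r) = 0`, the vector group is `W` and `w` acts as multiplication by `exp w`. -/
structure Triple (K R : Type*) [Field K] [CommRing R] [IsLocalRing R] [Algebra K R] where
  W : Submodule K R
  F : LinearMap.BilinForm K R
  W_le : W ≤ maxSubspace K R
  W_hyperplane : finrank K W + 1 = finrank K (maxSubspace K R)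
  W_generates : Algebra.adjoin K (W : Set R) = ⊤
  F_symm : ∀ a b, F a b = F b a
  F_one_one : F 1 1 = 0
  F_ne_zero : ∃ a ∈ maxSubspace K R, ∃ b ∈ maxSubspace K R, F a b ≠ 0
  F_invariant : ∀ a ∈ W, ∀ b c, F (a * b) c + F b (a * c) = 0

/-! ### The exponential and the action on projective space -/

/-- The exponential series. For `w` in the maximal ideal of a finite-dimensional local algebra
all the omitted terms vanish, since `w ^ (dim R) = 0`. -/
def expNil (K : Type*) {R : Type*} [Field K] [CommRing R] [Algebra K R] (w : R) : R :=
  ∑ k ∈ Finset.range (finrank K R + 1), ((k.factorial : K)⁻¹) • w ^ k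

/-- The quotient `(exp w - 1) / w`. -/
def expQuot (K : Type*) {R : Type*} [Field K] [CommRing R] [Algebra K R] (w : R) : R :=
  ∑ k ∈ Finset.range (finrank K R), (((k + 1).factorial : K)⁻¹) • w ^ k

theorem expNil_eq (w : R) : expNil K w = 1 + w * expQuot K w := by
  unfold expNil expQuot
  rw [Finset.sum_range_succ', Finset.mul_sum, add_comm]
  congr 1
  · simp
  · refine Finset.sum_congr rfl fun k _ => ?_
    rw [mul_smul_comm, pow_succ']

theorem isUnit_one_add {x : R} (hx : x ∈ IsLocalRing.maximalIdeal R) : IsUnit (1 + x) := by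
  by_contra h
  have h1 : (1 + x) ∈ IsLocalRing.maximalIdeal R := (IsLocalRing.mem_maximalIdeal _).2 h
  have h2 : (1 : R) ∈ IsLocalRing.maximalIdeal R := by
    have := Ideal.sub_mem _ h1 hx
    simpa using this
  exact (Ideal.ne_top_iff_one _).1 (IsLocalRing.maximalIdeal.isMaximal R).ne_top h2

theorem isUnit_expNil {w : R} (hw : w ∈ maxSubspace K R) : IsUnit (expNil K w) := by
  rw [expNil_eq]
  exact isUnit_one_add (Ideal.mul_mem_right _ _ hw)

theorem isUnit_expQuot [FiniteDimensional K R] {w : R} (hw : w ∈ maxSubspace K R) :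
    IsUnit (expQuot K w) := by
  unfold expQuot
  obtain ⟨n, hn⟩ : ∃ n, finrank K R = n + 1 :=
    ⟨finrank K R - 1, by have := finrank_pos (R := K) (M := R); omega⟩
  rw [hn, Finset.sum_range_succ', add_comm]
  have : (((0 + 1).factorial : K)⁻¹) • w ^ 0 = (1 : R) := by simp
  rw [this]
  refine isUnit_one_add (Ideal.sum_mem _ fun k _ => ?_)
  rw [Algebra.smul_def, pow_succ]
  exact Ideal.mul_mem_left _ _ (Ideal.mul_mem_left _ _ hw)

namespace Triple

variable (T : Triple K R) (T' : Triple K R')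

/-- The action of the vector group `W` on `ℙ(R)`: `w · [r] = [exp(w) r]`. -/
def act (w : T.W) : Projectivization K R → Projectivization K R :=
  Projectivization.map (LinearMap.mulLeft K (expNil K (w : R)))
    (fun _ _ h => (isUnit_expNil (T.W_le w.2)).mul_left_cancel h)

theorem act_eq_iff [FiniteDimensional K R] (w : T.W) (p : Projectivization K R) :
    T.act w p = p ↔ (w : R) * p.rep = 0 := by
  have hw : (w : R) ∈ maxSubspace K R := T.W_le w.2
  have hE : expNil K (w : R) * p.rep ≠ 0 := fun h =>
    p.rep_nonzero ((isUnit_expNil hw).mul_right_eq_zero.1 h)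
  have hact : T.act w p = Projectivization.mk K (expNil K (w : R) * p.rep) hE := by
    conv_lhs => rw [← p.mk_rep]
    rfl
  have key : T.act w p = p ↔ ∃ c : K, c • p.rep = expNil K (w : R) * p.rep := by
    rw [hact]
    conv_lhs => rhs; rw [← p.mk_rep]
    exact Projectivization.mk_eq_mk_iff' K _ _ hE p.rep_nonzero
  rw [key, expNil_eq]
  constructor
  · rintro ⟨c, hc⟩
    have h1 : (algebraMap K R (c - 1) - w * expQuot K (w : R)) * p.rep = 0 := by
      rw [Algebra.smul_def] at hc
      rw [map_sub, map_one]
      linear_combination hc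
    by_cases h : c - 1 = 0
    · rw [h, map_zero, zero_sub] at h1
      have h2 : expQuot K (w : R) * ((w : R) * p.rep) = 0 := by linear_combination -h1
      exact (isUnit_expQuot hw).mul_right_eq_zero.1 h2
    · exfalso
      have hu : IsUnit (algebraMap K R (c - 1) - w * expQuot K (w : R)) := by
        have hc1 : IsUnit (algebraMap K R (c - 1)) := (IsUnit.mk0 _ h).map _
        by_contra hn
        have h3 := (IsLocalRing.mem_maximalIdeal _).2 hn
        have h4 := Ideal.add_mem _ h3
          (Ideal.mul_mem_right (expQuot K (w : R)) (IsLocalRing.maximalIdeal R) hw)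
        rw [sub_add_cancel] at h4
        exact (IsLocalRing.mem_maximalIdeal _).1 h4 hc1
      exact p.rep_nonzero (hu.mul_right_eq_zero.1 h1)
  · intro h
    exact ⟨1, by rw [one_smul]; linear_combination (-expQuot K (w : R)) * h⟩

/-- The stabilizer of a point; it is a linear subspace of the vector group `W`. -/
def stabilizer [FiniteDimensional K R] (p : Projectivization K R) : Submodule K T.W where
  carrier := {w | T.act w p = p}
  zero_mem' := by simp [act_eq_iff]
  add_mem' := by
    intro a b ha hb
    simp only [Set.mem_ofPred_eq, act_eq_iff] at ha hb ⊢
    rw [Submodule.coe_add, add_mul, ha, hb, add_zero]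
  smul_mem' := by
    intro c a ha
    simp only [Set.mem_ofPred_eq, act_eq_iff] at ha ⊢
    rw [Submodule.coe_smul, smul_mul_assoc, ha, smul_zero]

/-- The dimension of the orbit of `p`: `dim G - dim G_p`. -/
def orbitDim [FiniteDimensional K R] (p : Projectivization K R) : ℕ :=
  finrank K (T.W ⧸ T.stabilizer p)

/-- The quadric `Q = {F(r, r) = 0}` in `ℙ(R)`. -/
def quadric : Set (Projectivization K R) := {p | T.F p.rep p.rep = 0}

/-- The singular locus of `Q`: the points of `Q` at which the differential
`r' ↦ 2 F(r, r')` of the equation vanishes. -/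
def sing : Set (Projectivization K R) := {p | p ∈ T.quadric ∧ ∀ r, 2 * T.F p.rep r = 0}

/-- The fixed points of the action on `Q`. -/
def fix : Set (Projectivization K R) := {p | p ∈ T.quadric ∧ ∀ w, T.act w p = p}

/-- The orbit of `[1]`, which is the open orbit of `Q`. -/
def openOrbit : Set (Projectivization K R) :=
  Set.range fun w : T.W => T.act w (Projectivization.mk K (1 : R) one_ne_zero)

/-- `l`: the maximal dimension of the orbits in the boundary `Q \ O`. -/
def maxBoundaryDim [FiniteDimensional K R] : ℕ :=
  sSup (T.orbitDim '' (T.quadric \ T.openOrbit))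

/-- The corank of the quadric, i.e. of the quadratic form defining it. -/
def corank : ℕ := finrank K (LinearMap.ker T.F)

/-- The dimension `n` of the quadric in `ℙ(R) = ℙⁿ⁺¹`, which is also that of the group. -/
def dim : ℕ := finrank K T.W

/-- Two triples are equivalent if some algebra isomorphism `R ≃ R'` carries `W` onto `W'`. -/
def Equivalent : Prop := ∃ Γ : R ≃ₐ[K] R', T.W.map Γ.toLinearMap = T'.W

/-! ### The algebraic structure sequence and its flow chart -/

/-- `{α ∈ V : α · L = 0}`. -/
def annIn (V L : Submodule K R) : Submodule K R where
  carrier := {α | α ∈ V ∧ ∀ β ∈ L, α * β = 0}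
  zero_mem' := ⟨V.zero_mem, fun _ _ => zero_mul _⟩
  add_mem' := fun {a b} ha hb => ⟨V.add_mem ha.1 hb.1, fun β hβ => by
    rw [add_mul, ha.2 β hβ, hb.2 β hβ, add_zero]⟩
  smul_mem' := fun c a ha => ⟨V.smul_mem c ha.1, fun β hβ => by
    rw [smul_mul_assoc, ha.2 β hβ, smul_zero]⟩

/-- The kernel of the restriction of `F` to `V`. -/
def kerOn (F : LinearMap.BilinForm K R) (V : Submodule K R) : Submodule K R where
  carrier := {α | α ∈ V ∧ ∀ β ∈ V, F α β = 0}
  zero_mem' := ⟨V.zero_mem, fun _ _ => by simp⟩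
  add_mem' := fun {a b} ha hb => ⟨V.add_mem ha.1 hb.1, fun β hβ => by
    rw [map_add, LinearMap.add_apply, ha.2 β hβ, hb.2 β hβ, add_zero]⟩
  smul_mem' := fun c a ha => ⟨V.smul_mem c ha.1, fun β hβ => by
    rw [map_smul, LinearMap.smul_apply, ha.2 β hβ, smul_zero]⟩

/-- The pairs `(V^(k), V_(k))`, starting with `(W, Ker F)`. -/
def chain (T : Triple K R) : ℕ → Submodule K R × Submodule K R
  | 0 => (T.W, LinearMap.ker T.F)
  | k + 1 =>
    (annIn (chain T k).1 (chain T k).2, kerOn T.F (annIn (chain T k).1 (chain T k).2))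

/-- `V^(k)`. -/
def upper (k : ℕ) : Submodule K R := (T.chain k).1

/-- `V_(k)`. -/
def lower (k : ℕ) : Submodule K R := (T.chain k).2

/-- `V^(k) · V_(k) = 0`. -/
def ProdZero (k : ℕ) : Prop := ∀ α ∈ T.upper k, ∀ β ∈ T.lower k, α * β = 0

/-- The flow chart stops while treating the pair `(V^(k), V_(k))`. -/
def Stops (k : ℕ) : Prop :=
  T.ProdZero k ∨ ¬ T.lower k ≤ T.lower (k + 1) ∨ T.lower k = T.lower (k + 1)

theorem exists_stops [FiniteDimensional K R] : ∃ k, T.Stops k := by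
  by_contra! h
  have hlt : ∀ k, T.upper (k + 1) < T.upper k := by
    intro k
    refine lt_of_le_of_ne (fun x hx => hx.1) fun heq => h k (Or.inl fun α hα β hβ => ?_)
    have hα' : α ∈ T.upper (k + 1) := heq ▸ hα
    exact hα'.2 β hβ
  have hb : ∀ k, finrank K (T.upper k) + k ≤ finrank K (T.upper 0) := by
    intro k
    induction k with
    | zero => simp
    | succ k ih =>
      have := Submodule.finrank_lt_finrank_of_lt (hlt k)
      omega
  have := hb (finrank K (T.upper 0) + 1)
  omega

/-- The three ways in which the flow chart stops. -/
inductive Letter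
  | A | B | C

open Classical in
/-- The index `s` of the final pair: the first `k` at which the flow chart stops. -/
def level [FiniteDimensional K R] : ℕ := Nat.find T.exists_stops

open Classical in
/-- The letter put out by the flow chart. -/
def letter [FiniteDimensional K R] : Letter :=
  if T.ProdZero T.level then Letter.A
  else if ¬ T.lower T.level ≤ T.lower (T.level + 1) then Letter.B
  else Letter.C

/-- The eight normalized types. -/
inductive NormalType
  | A1 | A2 | B0 | B1 | B2 | C0 | C1 | C2

/-- The types `A₁, B₁, C₁`. -/
def NormalType.IsOne (τ : NormalType) : Prop :=
  τ = NormalType.A1 ∨ τ = NormalType.B1 ∨ τ = NormalType.C1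

open Classical in
/-- The normalized type of a triple. -/
def normalType [FiniteDimensional K R] : NormalType :=
  match T.letter with
  | Letter.A =>
    if T.lower T.level = T.upper T.level then NormalType.A1 else NormalType.A2
  | Letter.B =>
    if T.level = 0 then NormalType.B0
    else if T.lower T.level = T.upper T.level then NormalType.B1 else NormalType.B2
  | Letter.C =>
    if T.level = 0 then NormalType.C0
    else if T.lower (T.level + 1) = T.upper (T.level + 1) then NormalType.C1
    else NormalType.C2

/-- The number of the elements `f_i`: it is `s` for the letters `A`, `B` and `s + 1` for `C`. -/
def numF [FiniteDimensional K R] : ℕ :=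
  match T.letter with
  | Letter.A => T.level
  | Letter.B => T.level
  | Letter.C => T.level + 1

open Classical in
/-- `δ = 1` if `dim 𝔪² = 3`, and `δ = 0` otherwise (i.e. if `dim 𝔪² = 2`). -/
def delta (_T : Triple K R) : K := if finrank K (maxSq K R) = 3 then 1 else 0

end Triple

/-! ### Canonical matrices -/

/-- The canonical symmetric `m × m` block with eigenvalue `a`, where `I` is a square root
of `-1`:  `a • 1 + (1/2) • (ones next to the diagonal)
+ (I/2) • (ones just above the antidiagonal, minus ones just below it)`. -/
def canonicalBlock (I a : K) (m : ℕ) : Matrix (Fin m) (Fin m) K := Matrix.of fun x y =>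
  (if x = y then a else 0)
    + (1 / 2) * (if x.val + 1 = y.val ∨ y.val + 1 = x.val then 1 else 0)
    + (I / 2) * ((if x.val + y.val + 2 = m then 1 else 0) - (if x.val + y.val = m then 1 else 0))

/-- The parameters of a canonical matrix: eigenvalues and (positive) sizes of its blocks. -/
structure BlockData (K : Type*) where
  num : ℕ
  eig : Fin num → K
  size : Fin num → ℕ
  size_pos : ∀ k, 0 < size k

/-- The rows and columns of a canonical matrix. -/
abbrev BlockData.Index (d : BlockData K) : Type := Σ k : Fin d.num, Fin (d.size k)

/-- The canonical (symmetric, block diagonal) matrix with given parameters. -/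
def BlockData.matrix (I : K) (d : BlockData K) : Matrix d.Index d.Index K :=
  Matrix.blockDiagonal' fun k => canonicalBlock I (d.eig k) (d.size k)

/-- Canonical matrices differ by an elementary transformation, that is by a permutation of blocks,
a multiplication by a scalar `a ≠ 0` and the addition of a scalar matrix `h`. Here the canonical
form of `a • Λ + h • 1` has the blocks of `Λ` with each eigenvalue `x` replaced by `a * x + h`. -/
def BlockData.Elementary (d d' : BlockData K) : Prop :=
  ∃ a h : K, a ≠ 0 ∧ ∃ σ : Fin d.num ≃ Fin d'.num,
    ∀ k, d'.size (σ k) = d.size k ∧ d'.eig (σ k) = a * d.eig k + h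

/-! ### Normalized structures -/

open Classical in
/-- A set of normalized elements of a triple, together with its canonical matrix.
The elements are `μ₁, μ₂`, `g_j` (`1 ≤ j ≤ s`, with `g_0 = μ₂`), `f_i` (`1 ≤ i ≤ T.numF`) and
`e_k` (none of them for the types `A₁, B₁, C₁`); the values of `f` and `g` at other indices
are irrelevant. For the type `C₀` the element usually called `e_{p+1}` is `f 1`. -/
structure NormalizedSet [FiniteDimensional K R] (I : K) (T : Triple K R) where
  μ₁ : R
  μ₂ : R
  b₀ : R
  f : ℕ → R
  g : ℕ → R
  blocks : BlockData K
  e : blocks.Index → R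
  b₀_mem : b₀ ∈ maxSq K R
  b₀_notMem : b₀ ∉ T.W
  F_one_b₀ : T.F 1 b₀ = -1
  b₀_mul : ∀ w ∈ maxSubspace K R, b₀ * w = 0
  μ₁_mul : ∀ w ∈ maxSubspace K R, μ₁ * w = 0
  g_zero : g 0 = μ₂
  ker_eq : LinearMap.ker T.F = Submodule.span K {μ₁, μ₂}
  f_mem : ∀ i, 1 ≤ i → i ≤ T.numF → f i ∈ T.upper (i - 1) ∧ f i ∉ T.upper i
  g_mem : ∀ j, 1 ≤ j → j ≤ T.level → g j ∈ T.lower j ∧ g j ∉ T.lower (j - 1)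
  upper_eq : T.upper T.numF = T.lower T.numF ⊔ Submodule.span K (Set.range e)
  upper_disjoint : Disjoint (T.lower T.numF) (Submodule.span K (Set.range e))
  /-- The normalized elements form a basis of `W`. -/
  linearIndependent : LinearIndependent K
    (Sum.elim (fun _ : Unit => μ₁) (Sum.elim (fun j : Fin (T.level + 1) => g j)
      (Sum.elim e (fun i : Fin T.numF => f (i + 1)))))
  span_eq : Submodule.span K (Set.range
    (Sum.elim (fun _ : Unit => μ₁) (Sum.elim (fun j : Fin (T.level + 1) => g j)
      (Sum.elim e (fun i : Fin T.numF => f (i + 1)))))) = T.W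
  e_mul_e : ∀ k l, e k * e l = (if k = l then b₀ else 0) + blocks.matrix I k l • μ₁
  e_mul_f : ∀ k i, 1 ≤ i → i ≤ T.numF → e k * f i = 0
  e_mul_g : ∀ k j, j ≤ T.level → e k * g j = 0
  /-- `g_i g_j = 0`, except for `g_s² = μ₁` when the letter is `B`. -/
  g_mul_g : ∀ i j, i ≤ T.level → j ≤ T.level →
    g i * g j = if T.letter = Triple.Letter.B ∧ i = T.level ∧ j = T.level then μ₁ else 0
  /-- `f_i g_i = b₀`, `f_i g_{i-1} = μ₁`, and the other products `f_i g_j` vanish. -/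
  f_mul_g : ∀ i j, 1 ≤ i → i ≤ T.numF → j ≤ T.level →
    f i * g j = if i = j then b₀ else if i = j + 1 then μ₁ else 0
  f_mul_f : ∀ i j, 1 ≤ i → i < j → j ≤ T.numF → f i * f j = 0
  /-- `f_1² = δ μ₂` and `f_i² = 0` for `i ≥ 2`, with an additional summand `b₀` in `f_{s+1}²`
  when the letter is `C`. -/
  f_sq : ∀ i, 1 ≤ i → i ≤ T.numF →
    f i * f i = (if i = 1 then T.delta • μ₂ else 0) + (if i = T.level + 1 then b₀ else 0)

/-- The normalized structures given by two normalized sets (without elements `e_k`) coincide: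
matching the normalized elements identifies the multiplications and the bilinear forms. -/
def NormalizedSet.SameStructure [FiniteDimensional K R] [FiniteDimensional K R'] {I : K}
    {T : Triple K R} {T' : Triple K R'} (N : NormalizedSet I T) (N' : NormalizedSet I T') : Prop :=
  IsEmpty N.blocks.Index ∧ IsEmpty N'.blocks.Index ∧
    T.level = T'.level ∧ T.numF = T'.numF ∧
    ∃ Γ : R ≃ₐ[K] R', Γ N.μ₁ = N'.μ₁ ∧ Γ N.μ₂ = N'.μ₂ ∧ Γ N.b₀ = N'.b₀ ∧
      (∀ j, 1 ≤ j → j ≤ T.level → Γ (N.g j) = N'.g j) ∧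
      (∀ i, 1 ≤ i → i ≤ T.numF → Γ (N.f i) = N'.f i) ∧
      ∀ a b, T'.F (Γ a) (Γ b) = T.F a b

end

end AdditiveQuadric

/-! In corank two the maximal ideal sends `μ₂` into the line of `μ₁` and kills `μ₁`, and there is a
socle element `b₀` outside `W` with `a b - F(a,b) b₀ ∈ Ker F` for all `a, b ∈ W`
(`Triple.exists_frame`). By associativity (`Triple.Frame.exists_coordinate`) the product on `W`
becomes `a b = F(a,b) b₀ + G(a,b) μ₁ + h ℓ(a) ℓ(b) μ₂`, where `G` is a second symmetric form, `a μ₂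
= ℓ(a) μ₁`, and `h` is a scalar. So the problem is the classification of pairs `(F, G)` of symmetric
forms, with one scalar added.

In these terms `V_(k)` is the `F`-radical of `V^(k)`, and `V^(k+1)` is the part of `V^(k)` that is
`G`-orthogonal to it; the flow chart is pure linear algebra. Until it stops, each step passes to a
hyperplane and enlarges the radical by one dimension. A vector `f` outside the hyperplane can be
chosen `G`-dual to the old radical vector, `F`-dual to the new one and orthogonal to all the rest.
Restoring these vectors one at a time gives the chains `f_i`, `g_j` and a complement on which `F` is
the identity (`exists_pencilBasis`). There `G` is a symmetric matrix up to orthogonal change, and it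
splits into the blocks `B_m(λ)`, which are symmetric conjugates of Jordan blocks
(`exists_canonical_basis`).

Invariance. The form is governed by the functional `F 1`, which kills `1` and `W`, so an algebra
isomorphism carrying `W` to `W'` multiplies the form by a scalar (`Triple.similar_of_map`). It
therefore preserves the chain, the type and the orbit dimensions. Comparing the products of the
images of the `e_k` shows that `Λ'` is similar to some `a Λ + h` (`Table.exists_comparison`), and
the nullities of the powers of `Λ - c` determine the blocks (`exists_perm_of_similar`).

Converse. Replacing `b₀` by `b₀ + c μ₁` replaces `G` by `G - c F`, and rescaling the elements
multiplies `Λ` by a scalar; so every affine change of `Λ` occurs for one and the same triple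
(`Table.exists_affine`). The scalar `h` can be normalized to 0 or 1, and as soon as some `f_i`
exists it is nonzero exactly when `dim 𝔪² = 3`, and exactly when `l ≥ 3`
(`Triple.delta_eq_of_maxBoundaryDim`). Tables with equal parameters define isomorphic algebras
(`Table.exists_algEquiv`). -/

set_option linter.unusedSectionVars false

namespace AdditiveQuadric

/-! ### Simultaneous canonical form of two symmetric forms, one of them nondegenerate -/

section CanonicalForm

variable {K : Type*} [Field K] [IsAlgClosed K] [CharZero K]

theorem selfAdjoint_pow {V : Type*} [AddCommGroup V] [Module K V]
    (F : LinearMap.BilinForm K V) (N : End K V) (hN : ∀ x y, F (N x) y = F x (N y)) :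
    ∀ (k : ℕ) (x y : V), F ((N ^ k) x) y = F x ((N ^ k) y) := by
  intro k
  induction k with
  | zero => simp
  | succ k ih =>
    intro x y
    have h1 : (N ^ (k + 1)) x = (N ^ k) (N x) := by rw [pow_succ, Module.End.mul_apply]
    have h2 : (N ^ (k + 1)) y = N ((N ^ k) y) := by rw [pow_succ', Module.End.mul_apply]
    rw [h1, h2, ih, hN]

/-- A self-adjoint operator has an eigenvalue `a` and a vector generating a cyclic summand. -/
theorem exists_cyclic {V : Type*} [AddCommGroup V] [Module K V] [FiniteDimensional K V]
    [Nontrivial V] (F : LinearMap.BilinForm K V) (hs : ∀ x y, F x y = F y x)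
    (hn : ∀ x, (∀ y, F x y = 0) → x = 0) (A : End K V) (hA : ∀ x y, F (A x) y = F x (A y)) :
    ∃ (a : K) (m : ℕ) (v : V), ((A - algebraMap K (End K V) a) ^ (m + 1)) v = 0 ∧
      F (((A - algebraMap K (End K V) a) ^ m) v) v ≠ 0 := by
  classical
  obtain ⟨a, ha⟩ := Module.End.exists_eigenvalue A
  obtain ⟨x₀, hx₀⟩ := ha.exists_hasEigenvector
  set N := A - algebraMap K (End K V) a with hN
  have hNx₀ : N x₀ = 0 := by
    have := hx₀.apply_eq_smul
    simp [hN, this, Module.algebraMap_end_apply]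
  have hNs : ∀ x y, F (N x) y = F x (N y) := by
    intro x y
    simp [hN, Module.algebraMap_end_apply, hA]
  have hNk := selfAdjoint_pow F N hNs
  -- Fitting decomposition: `ker (N ^ n)` is the generalized eigenspace, and it is `F`-orthogonal to
  -- the complementary range.
  obtain ⟨n, hnc, hn1⟩ := (N.eventually_isCompl_ker_pow_range_pow.and
    (Filter.eventually_ge_atTop 1)).exists
  have hx₀D : (N ^ n) x₀ = 0 := by
    obtain ⟨k, rfl⟩ : ∃ k, n = k + 1 := ⟨n - 1, by omega⟩
    rw [pow_succ, Module.End.mul_apply, hNx₀, map_zero]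
  have hex : ∃ k, ∀ x, (N ^ n) x = 0 → (N ^ k) x = 0 := ⟨n, fun _ h => h⟩
  -- `m + 1` is the nilpotency index of `N` on the generalized eigenspace, positive because of the
  -- eigenvector `x₀`.
  obtain ⟨m, hm⟩ : ∃ m, Nat.find hex = m + 1 := by
    refine ⟨Nat.find hex - 1, ?_⟩
    have : Nat.find hex ≠ 0 := by
      intro h0
      have := Nat.find_spec hex x₀ hx₀D
      rw [h0] at this
      exact hx₀.2 (by simpa using this)
    omega
  have hm1 : ∀ x, (N ^ n) x = 0 → (N ^ (m + 1)) x = 0 := hm ▸ Nat.find_spec hex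
  have hm2 : ¬ ∀ x, (N ^ n) x = 0 → (N ^ m) x = 0 := Nat.find_min hex (by omega)
  push Not at hm2
  obtain ⟨x, hx, hxm⟩ := hm2
  have : ∃ y, F ((N ^ m) x) y ≠ 0 := by
    by_contra! h
    exact hxm (hn _ h)
  obtain ⟨y, hy⟩ := this
  obtain ⟨y₁, hy₁, y₂, hy₂, rfl⟩ : ∃ y₁ ∈ LinearMap.ker (N ^ n), ∃ y₂ ∈ LinearMap.range (N ^ n),
      y₁ + y₂ = y := Submodule.mem_sup.1 (hnc.sup_eq_top ▸ Submodule.mem_top)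
  obtain ⟨y₃, rfl⟩ := hy₂
  rw [LinearMap.mem_ker] at hy₁
  have h0 : F ((N ^ m) x) ((N ^ n) y₃) = 0 := by
    rw [← hNk, ← Module.End.mul_apply, ← pow_add, add_comm, pow_add, Module.End.mul_apply, hx]
    simp
  rw [map_add, h0, add_zero] at hy
  -- The symmetric form `F ((N ^ m) x) y` is nonzero on the generalized eigenspace; by polarization
  -- its quadratic form is nonzero too.
  by_contra! hcon
  have key : ∀ u, (N ^ n) u = 0 → F ((N ^ m) u) u = 0 := fun u hu => hcon a m u (hm1 u hu)
  have h1 := key x hx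
  have h2 := key y₁ hy₁
  have h3 := key (x + y₁) (by rw [map_add, hx, hy₁, add_zero])
  simp only [map_add, LinearMap.add_apply] at h3
  have h4 : F ((N ^ m) y₁) x = F ((N ^ m) x) y₁ := by rw [hNk, hs]
  rw [h1, h2, h4] at h3
  apply hy
  have : (2 : K) * F ((N ^ m) x) y₁ = 0 := by linear_combination h3
  simpa using this

/-- The generator is corrected by a polynomial in `N`: a scalar makes the top value 1, and then
adding `t • (N ^ (k + 1)) w` changes `F ((N ^ (m - 1 - k)) w) w` by `2 t` without touching the
values at higher powers. The outcome is `F (N^i w) (N^j w) = [i + j = m]`. -/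
theorem exists_cyclic_normalized {V : Type*} [AddCommGroup V] [Module K V]
    (F : LinearMap.BilinForm K V)
    (N : End K V) (hN : ∀ x y, F (N x) y = F x (N y)) (m : ℕ) (v : V)
    (hv : (N ^ (m + 1)) v = 0) (hv' : F ((N ^ m) v) v ≠ 0) :
    ∃ w, (N ^ (m + 1)) w = 0 ∧ ∀ j ≤ m, F ((N ^ j) w) w = if j = m then 1 else 0 := by
  have hNk := selfAdjoint_pow F N hN
  -- Since `j < k ≤ m`, the prescribed value is always 0.
  have step : ∀ k ≤ m, ∃ w, (N ^ (m + 1)) w = 0 ∧ F ((N ^ m) w) w = 1 ∧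
      ∀ j < k, F ((N ^ (m - 1 - j)) w) w = if m = 0 then 1 else 0 := by
    intro k
    induction k with
    | zero =>
      intro _
      obtain ⟨c, hc⟩ := IsAlgClosed.exists_pow_nat_eq (F ((N ^ m) v) v)⁻¹ zero_lt_two
      refine ⟨c • v, by simp [hv], ?_, by simp⟩
      simp only [map_smul, LinearMap.smul_apply, smul_eq_mul]
      rw [← mul_assoc, ← pow_two, hc, inv_mul_cancel₀ hv']
    | succ k ih =>
      intro hk
      obtain ⟨w, h1, h2, h3⟩ := ih (by omega)
      have hz : ∀ i, m + 1 ≤ i → (N ^ i) w = 0 := by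
        intro i hi
        obtain ⟨j, rfl⟩ := Nat.exists_eq_add_of_le' hi
        rw [pow_add, Module.End.mul_apply, h1, map_zero]
      set t : K := -(F ((N ^ (m - 1 - k)) w) w) / 2 with ht
      have hw : ∀ i, F ((N ^ i) (w + t • (N ^ (k + 1)) w)) (w + t • (N ^ (k + 1)) w) =
          F ((N ^ i) w) w + 2 * t * F ((N ^ (i + k + 1)) w) w
            + t ^ 2 * F ((N ^ (i + k + 1 + k + 1)) w) w := by
        intro i
        have e1 : F ((N ^ i) w) ((N ^ (k + 1)) w) = F ((N ^ (i + k + 1)) w) w := by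
          rw [← hNk, ← Module.End.mul_apply, ← pow_add]; congr 4; omega
        have e2 : (N ^ i) ((N ^ (k + 1)) w) = (N ^ (i + k + 1)) w := by
          rw [← Module.End.mul_apply, ← pow_add]; congr 2
        have e3 : F ((N ^ (i + k + 1)) w) ((N ^ (k + 1)) w)
            = F ((N ^ (i + k + 1 + k + 1)) w) w := by
          rw [← hNk, ← Module.End.mul_apply, ← pow_add]; congr 4; omega
        simp only [map_add, map_smul, LinearMap.add_apply, LinearMap.smul_apply, smul_eq_mul, e1,
          e2, e3]
        ring
      refine ⟨w + t • (N ^ (k + 1)) w, ?_, ?_, ?_⟩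
      · rw [map_add, map_smul, h1, ← Module.End.mul_apply, ← pow_add, hz _ (by omega)]; simp
      · rw [hw, hz (m + k + 1) (by omega), hz (m + k + 1 + k + 1) (by omega), h2]; simp
      · intro j hj
        rw [hw]
        rcases Nat.lt_succ_iff_lt_or_eq.1 hj with hj | rfl
        · rw [hz (m - 1 - j + k + 1) (by omega), hz (m - 1 - j + k + 1 + k + 1) (by omega),
            h3 j hj]
          simp
        · have : m - 1 - j + j + 1 = m := by omega
          rw [this, hz (m + j + 1) (by omega), h2, ht, if_neg (by omega)]
          simp only [map_zero, LinearMap.zero_apply]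
          ring
  obtain ⟨w, h1, h2, h3⟩ := step m le_rfl
  refine ⟨w, h1, fun j hj => ?_⟩
  split_ifs with h
  · rw [h, h2]
  · have := h3 (m - 1 - j) (by omega)
    rw [if_neg (by omega)] at this
    rwa [show m - 1 - (m - 1 - j) = j by omega] at this

/-- An orthonormal basis of a cyclic summand in which the second form is a canonical block. -/
theorem exists_block {V : Type*} [AddCommGroup V] [Module K V] [FiniteDimensional K V]
    [Nontrivial V] (I : K) (hI : I ^ 2 = -1) (F G : LinearMap.BilinForm K V)
    (hs : ∀ x y, F x y = F y x) (hG : ∀ x y, G x y = G y x)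
    (hn : ∀ x, (∀ y, F x y = 0) → x = 0) :
    ∃ (a : K) (m : ℕ) (e : Fin (m + 1) → V), (∀ x y, F (e x) (e y) = if x = y then 1 else 0) ∧
      (∀ x y, G (e x) (e y) = canonicalBlock I a (m + 1) x y) ∧
      ∀ v, (∀ x, F (e x) v = 0) → ∀ x, G (e x) v = 0 := by
  have hnd : F.Nondegenerate :=
    ⟨fun x hx => hn x hx, fun x hx => hn x fun y => by rw [hs]; exact hx y⟩
  -- The operator `F⁻¹ G`, self-adjoint for `F`.
  let A : End K V := (F.toDual hnd).symm.toLinearMap ∘ₗ G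
  have hAG : ∀ x y, F (A x) y = G x y := fun x y =>
    LinearMap.BilinForm.apply_toDual_symm_apply (hB := hnd) (G x) y
  have hA : ∀ x y, F (A x) y = F x (A y) := fun x y => by rw [hAG, hs x, hAG, hG]
  obtain ⟨a, m, v, hv, hv'⟩ := exists_cyclic F hs hn A hA
  set N := A - algebraMap K (End K V) a with hN
  have hNs : ∀ x y, F (N x) y = F x (N y) := by
    intro x y
    simp [hN, Module.algebraMap_end_apply, hA]
  obtain ⟨w, hw, hw'⟩ := exists_cyclic_normalized F N hNs m v hv hv'
  have hNk := selfAdjoint_pow F N hNs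
  have hz : ∀ i, m + 1 ≤ i → (N ^ i) w = 0 := by
    intro i hi
    obtain ⟨j, rfl⟩ := Nat.exists_eq_add_of_le' hi
    rw [pow_add, Module.End.mul_apply, hw, map_zero]
  have hF : ∀ i j, F ((N ^ i) w) ((N ^ j) w) = if i + j = m then 1 else 0 := by
    intro i j
    rw [← hNk, ← Module.End.mul_apply, ← pow_add, add_comm]
    by_cases h : i + j ≤ m
    · exact hw' _ h
    · rw [hz _ (by omega), if_neg (by omega)]; simp
  have hI0 : I ≠ 0 := by rintro rfl; norm_num at hI
  have h2I : (2 * I) ≠ 0 := mul_ne_zero two_ne_zero hI0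
  -- With `c² = 1 / (2 I)` the vectors `c (N^(m-x) w + I N^x w)` are orthonormal: the two
  -- antidiagonal terms cancel because `1 + I² = 0`, and the two diagonal ones add up to `2 I c² =
  -- 1`.
  obtain ⟨c, hc⟩ := IsAlgClosed.exists_pow_nat_eq (2 * I)⁻¹ zero_lt_two
  have hc' : c * c = -I / 2 := by
    rw [← pow_two, hc]; field_simp; linear_combination hI
  have hA' : ∀ x, A x = N x + a • x := by
    intro x; simp [hN, Module.algebraMap_end_apply]
  let e : Fin (m + 1) → V := fun x => c • ((N ^ (m - x.val)) w + I • (N ^ x.val) w)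
  have hee : ∀ x y, F (e x) (e y) = if x = y then 1 else 0 := by
    intro x y
    have hx := x.2
    have hy := y.2
    have e1 : (m - x.val + (m - y.val) = m) ↔ (x.val + y.val = m) := by omega
    have e2 : (m - x.val + y.val = m) ↔ x = y := by rw [Fin.ext_iff]; omega
    have e3 : (x.val + (m - y.val) = m) ↔ x = y := by rw [Fin.ext_iff]; omega
    simp only [e, map_add, map_smul, LinearMap.add_apply, LinearMap.smul_apply, smul_eq_mul, hF,
      e1, e2, e3]
    set p : K := if x.val + y.val = m then 1 else 0
    set q : K := if x = y then 1 else 0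
    linear_combination (c * c * p) * hI + (2 * I * q) * hc' - q * hI
  have hNi : ∀ i, N ((N ^ i) w) = (N ^ (i + 1)) w := by
    intro i; rw [pow_succ', Module.End.mul_apply]
  refine ⟨a, m, e, hee, ?_, ?_⟩
  · intro x y
    have hFN : F (N (e x)) (e y) = canonicalBlock I a (m + 1) x y - if x = y then a else 0 := by
      have hx := x.2
      have hy := y.2
      have e0 : (m - x.val + 1 + (m - y.val) = m) ↔ (x.val + y.val = m + 1) := by omega
      have e1 : (m - x.val + 1 + y.val = m) ↔ (y.val + 1 = x.val) := by omega
      have e2 : (x.val + 1 + (m - y.val) = m) ↔ (x.val + 1 = y.val) := by omega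
      have e3 : (x.val + 1 + y.val = m) ↔ (x.val + y.val + 2 = m + 1) := by omega
      simp only [e, map_add, map_smul, LinearMap.add_apply, LinearMap.smul_apply, smul_eq_mul, hF,
        hNi, canonicalBlock, Matrix.of_apply, e0, e1, e2, e3]
      have e4 : (if x.val + 1 = y.val ∨ y.val + 1 = x.val then (1 : K) else 0) =
          (if x.val + 1 = y.val then 1 else 0) + (if y.val + 1 = x.val then 1 else 0) := by
        split_ifs <;> first | omega | simp
      rw [e4]
      set p : K := if x.val + y.val = m + 1 then 1 else 0
      set q : K := if x.val + y.val + 2 = m + 1 then 1 else 0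
      set r : K := if x.val + 1 = y.val then 1 else 0
      set t : K := if y.val + 1 = x.val then 1 else 0
      linear_combination (p + I * r + I * t + I ^ 2 * q) * hc' - ((r + t) / 2 + I / 2 * q) * hI
    have hE : ∀ u u', F (A u) u' = F (N u) u' + a * F u u' := by
      intro u u'
      rw [hA', map_add, map_smul]
      simp only [LinearMap.add_apply, LinearMap.smul_apply, smul_eq_mul]
    rw [← hAG, hE, hFN, hee]
    split_ifs <;> ring
  -- `e_j` and `e_(m-j)` together give `N^j w`, so the `e_x` span the cyclic space of `w`. It is
  -- stable under `A`; hence its `F`-complement is also `G`-orthogonal to it.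
  · intro v hv0 x
    have key : ∀ j ≤ m, F ((N ^ j) w) v = 0 := by
      intro j hj
      have hc0 : c ≠ 0 := by
        intro h
        rw [h] at hc'
        exact div_ne_zero (neg_ne_zero.2 hI0) two_ne_zero (by linear_combination -hc')
      have h1 := hv0 ⟨j, by omega⟩
      have h2 := hv0 ⟨m - j, by omega⟩
      simp only [e, map_add, map_smul, LinearMap.add_apply, LinearMap.smul_apply, smul_eq_mul,
        mul_eq_zero, hc0, false_or, show m - (m - j) = j by omega] at h1 h2
      have : (2 : K) * F ((N ^ j) w) v = 0 := by linear_combination h2 - I * h1 + F ((N ^ j) w) v * hI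
      simpa using this
    have key' : ∀ j, F ((N ^ j) w) v = 0 := by
      intro j
      rcases le_or_gt j m with h | h
      · exact key j h
      · rw [hz j h]; simp
    rw [← hAG, hA']
    simp only [e, map_add, map_smul, LinearMap.add_apply, LinearMap.smul_apply, smul_eq_mul, hNi,
      key']
    simp

/-- Adjoin one block to a list of blocks. -/
def BlockData.cons {K : Type*} (a : K) (m : ℕ) (d : BlockData K) : BlockData K where
  num := d.num + 1
  eig := Fin.cons a d.eig
  size := Fin.cons (m + 1) d.size
  size_pos := by
    intro k
    refine Fin.cases ?_ (fun k => ?_) k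
    · simp
    · simpa using d.size_pos k

/-- The rows of the added block. -/
def BlockData.consZero {K : Type*} (a : K) (m : ℕ) (d : BlockData K) (x : Fin (m + 1)) :
    (BlockData.cons a m d).Index :=
  ⟨(0 : Fin (d.num + 1)), x⟩

/-- The rows of the old blocks. -/
def BlockData.consSucc {K : Type*} (a : K) (m : ℕ) (d : BlockData K) (p : d.Index) :
    (BlockData.cons a m d).Index :=
  ⟨(p.1.succ : Fin (d.num + 1)), p.2⟩

theorem BlockData.cons_cases {K : Type*} {a : K} {m : ℕ} {d : BlockData K}
    {P : (BlockData.cons a m d).Index → Prop} (h0 : ∀ x, P (BlockData.consZero a m d x))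
    (h1 : ∀ p, P (BlockData.consSucc a m d p)) (q) : P q := by
  obtain ⟨k, x⟩ := q
  exact Fin.cases (motive := fun k : Fin (d.num + 1) =>
    ∀ x : Fin ((BlockData.cons a m d).size k), P ⟨k, x⟩) h0 (fun k x => h1 ⟨k, x⟩) k x

theorem BlockData.consZero_inj {K : Type*} {a : K} {m : ℕ} {d : BlockData K} {x y : Fin (m + 1)} :
    BlockData.consZero a m d x = BlockData.consZero a m d y ↔ x = y := by
  constructor
  · intro h
    exact eq_of_heq (Sigma.mk.inj_iff.1 h).2
  · rintro rfl; rfl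

theorem BlockData.consSucc_inj {K : Type*} {a : K} {m : ℕ} {d : BlockData K} {p q : d.Index} :
    BlockData.consSucc a m d p = BlockData.consSucc a m d q ↔ p = q := by
  constructor
  · obtain ⟨k, x⟩ := p
    obtain ⟨l, y⟩ := q
    intro h
    obtain ⟨h1, h2⟩ := Sigma.mk.inj_iff.1 h
    exact Sigma.ext (Fin.succ_injective _ h1) h2
  · rintro rfl; rfl

theorem BlockData.consZero_ne_consSucc {K : Type*} {a : K} {m : ℕ} {d : BlockData K}
    {x : Fin (m + 1)} {p : d.Index} :
    BlockData.consZero a m d x ≠ BlockData.consSucc a m d p := fun h =>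
  absurd (congrArg Sigma.fst h) (Fin.succ_ne_zero p.1).symm

theorem BlockData.cons_matrix_zero_zero {K : Type*} [Field K] {I a : K} {m : ℕ} {d : BlockData K}
    (x y : Fin (m + 1)) : (BlockData.cons a m d).matrix I (BlockData.consZero a m d x)
      (BlockData.consZero a m d y) = canonicalBlock I a (m + 1) x y :=
  Matrix.blockDiagonal'_apply_eq (fun k : Fin (d.num + 1) =>
    canonicalBlock I ((BlockData.cons a m d).eig k) ((BlockData.cons a m d).size k)) 0 x y

theorem BlockData.cons_matrix_zero_succ {K : Type*} [Field K] {I a : K} {m : ℕ} {d : BlockData K}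
    (x : Fin (m + 1)) (p : d.Index) : (BlockData.cons a m d).matrix I (BlockData.consZero a m d x)
      (BlockData.consSucc a m d p) = 0 :=
  Matrix.blockDiagonal'_apply_ne (fun k : Fin (d.num + 1) =>
    canonicalBlock I ((BlockData.cons a m d).eig k) ((BlockData.cons a m d).size k)) (k := (0 : Fin (d.num + 1)))
    (k' := (p.1.succ : Fin (d.num + 1))) x p.2 (Fin.succ_ne_zero p.1).symm

theorem BlockData.cons_matrix_succ_zero {K : Type*} [Field K] {I a : K} {m : ℕ} {d : BlockData K}
    (x : Fin (m + 1)) (p : d.Index) : (BlockData.cons a m d).matrix I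
      (BlockData.consSucc a m d p) (BlockData.consZero a m d x) = 0 :=
  Matrix.blockDiagonal'_apply_ne (fun k : Fin (d.num + 1) =>
    canonicalBlock I ((BlockData.cons a m d).eig k) ((BlockData.cons a m d).size k)) (k := (p.1.succ : Fin (d.num + 1)))
    (k' := (0 : Fin (d.num + 1))) p.2 x (Fin.succ_ne_zero p.1)

theorem BlockData.cons_matrix_succ_succ {K : Type*} [Field K] {I a : K} {m : ℕ} {d : BlockData K}
    (p q : d.Index) : (BlockData.cons a m d).matrix I (BlockData.consSucc a m d p)
      (BlockData.consSucc a m d q) = d.matrix I p q := by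
  obtain ⟨k, x⟩ := p
  obtain ⟨l, y⟩ := q
  by_cases hkl : k = l
  · subst hkl
    exact (Matrix.blockDiagonal'_apply_eq (fun k : Fin (d.num + 1) =>
      canonicalBlock I ((BlockData.cons a m d).eig k) ((BlockData.cons a m d).size k))
        k.succ x y).trans (Matrix.blockDiagonal'_apply_eq (fun k =>
      canonicalBlock I (d.eig k) (d.size k)) k x y).symm
  · exact (Matrix.blockDiagonal'_apply_ne (fun k : Fin (d.num + 1) =>
      canonicalBlock I ((BlockData.cons a m d).eig k) ((BlockData.cons a m d).size k))
        (k := (k.succ : Fin (d.num + 1))) (k' := (l.succ : Fin (d.num + 1)))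
        x y (fun h => hkl (Fin.succ_injective _ h))).trans (Matrix.blockDiagonal'_apply_ne
      (fun k => canonicalBlock I (d.eig k) (d.size k)) x y hkl).symm

/-- Families indexed by the rows of the enlarged matrix. -/
def BlockData.consFamily {K V : Type*} (a : K) {m : ℕ} {d : BlockData K} (e₀ : Fin (m + 1) → V)
    (e : d.Index → V) : (BlockData.cons a m d).Index → V := fun p =>
  Fin.cases (motive := fun k : Fin (d.num + 1) => Fin ((BlockData.cons a m d).size k) → V)
    (fun x => e₀ x) (fun k x => e ⟨k, x⟩) p.1 p.2

theorem BlockData.consFamily_zero {K V : Type*} {a : K} {m : ℕ} {d : BlockData K}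
    (e₀ : Fin (m + 1) → V) (e : d.Index → V) (x : Fin (m + 1)) :
    BlockData.consFamily a e₀ e (BlockData.consZero a m d x) = e₀ x := rfl

theorem BlockData.consFamily_succ {K V : Type*} {a : K} {m : ℕ} {d : BlockData K}
    (e₀ : Fin (m + 1) → V) (e : d.Index → V) (p : d.Index) :
    BlockData.consFamily a e₀ e (BlockData.consSucc a m d p) = e p := rfl

/-- Two symmetric forms, the first of which is nondegenerate, have a simultaneous canonical form:
the first becomes the identity and the second a canonical matrix. -/
theorem exists_canonical_basis {V : Type*} [AddCommGroup V] [Module K V] [FiniteDimensional K V]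
    (I : K) (hI : I ^ 2 = -1) (F G : LinearMap.BilinForm K V)
    (hs : ∀ x y, F x y = F y x) (hG : ∀ x y, G x y = G y x) (n : ℕ) :
    ∀ E : Submodule K V, finrank K E = n → (∀ x ∈ E, (∀ y ∈ E, F x y = 0) → x = 0) →
    ∃ (d : BlockData K) (e : d.Index → V), Submodule.span K (Set.range e) = E ∧
      (∀ k l, F (e k) (e l) = if k = l then 1 else 0) ∧
      ∀ k l, G (e k) (e l) = d.matrix I k l := by
  induction n using Nat.strong_induction_on with
  | _ n ih =>
    intro E hE hn
    rcases subsingleton_or_nontrivial E with hsub | hnt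
    · refine ⟨⟨0, fun _ => 0, fun _ => 1, fun _ => one_pos⟩, fun p => p.1.elim0, ?_,
        fun p => p.1.elim0, fun p => p.1.elim0⟩
      rw [Submodule.subsingleton_iff_eq_bot] at hsub
      rw [hsub, Submodule.span_eq_bot]
      rintro x ⟨p, _⟩
      exact p.1.elim0
    · obtain ⟨a, m, e₀, h1, h2, h3⟩ := exists_block I hI (F.restrict E) (G.restrict E)
        (fun x y => hs x y) (fun x y => hG x y)
        (fun x hx => Subtype.ext (hn x x.2 fun y hy => hx ⟨y, hy⟩))
      have h1' : ∀ x y, F (e₀ x) (e₀ y) = if x = y then 1 else 0 := h1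
      have h2' : ∀ x y, G (e₀ x) (e₀ y) = canonicalBlock I a (m + 1) x y := h2
      -- The induction continues with the `F`-complement of the block, which `h3` makes
      -- `G`-orthogonal to the block as well.
      let E' : Submodule K V := E ⊓ ⨅ x, LinearMap.ker (F (e₀ x))
      have hE' : ∀ v, v ∈ E' ↔ v ∈ E ∧ ∀ x, F (e₀ x) v = 0 := by
        intro v; simp [E', Submodule.mem_inf, Submodule.mem_iInf]
      have hsplit : ∀ v ∈ E, v - ∑ x, F (e₀ x) v • (e₀ x : V) ∈ E' := by
        intro v hv
        rw [hE']
        refine ⟨E.sub_mem hv (E.sum_mem fun x _ => E.smul_mem _ (e₀ x).2), fun y => ?_⟩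
        simp [map_sub, map_sum, h1']
      have hE'E : E' ≤ E := inf_le_left
      have hlt : finrank K E' < n := by
        rw [← hE]
        refine Submodule.finrank_lt_finrank_of_lt (lt_of_le_of_ne hE'E ?_)
        intro h
        have h0 : (e₀ 0 : V) ∈ E' := by
          rw [h]
          exact (e₀ 0).2
        have := ((hE' _).1 h0).2 0
        rw [h1'] at this
        simp at this
      obtain ⟨d, e, he1, he2, he3⟩ := ih _ hlt E' rfl (by
        intro x hx hx'
        refine hn x (hE'E hx) fun y hy => ?_
        have hy' : y = (y - ∑ x, F (e₀ x) y • (e₀ x : V)) + ∑ x, F (e₀ x) y • (e₀ x : V) := by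
          abel
        rw [hy', map_add, hx' _ (hsplit y hy), map_sum, zero_add]
        refine Finset.sum_eq_zero fun z _ => ?_
        rw [map_smul, hs x, ((hE' _).1 hx).2, smul_zero])
      have heE' : ∀ k, e k ∈ E' := fun k => he1 ▸ Submodule.subset_span ⟨k, rfl⟩
      have hF0 : ∀ x k, F (e₀ x) (e k) = 0 := fun x k => ((hE' _).1 (heE' k)).2 x
      have hG0 : ∀ x k, G (e₀ x) (e k) = 0 := fun x k =>
        h3 ⟨e k, hE'E (heE' k)⟩ (fun y => hF0 y k) x
      refine ⟨BlockData.cons a m d, BlockData.consFamily a (fun x => (e₀ x : V)) e, ?_, ?_, ?_⟩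
      · apply le_antisymm
        · rw [Submodule.span_le]
          rintro _ ⟨p, rfl⟩
          induction p using BlockData.cons_cases with
          | h0 x => exact (e₀ x).2
          | h1 p => exact hE'E (heE' p)
        · intro v hv
          have hv' : v = (v - ∑ x, F (e₀ x) v • (e₀ x : V)) + ∑ x, F (e₀ x) v • (e₀ x : V) := by
            abel
          rw [hv']
          refine Submodule.add_mem _ ?_ (Submodule.sum_mem _ fun x _ => Submodule.smul_mem _ _ ?_)
          · have : Submodule.span K (Set.range e) ≤ Submodule.span K
                (Set.range (BlockData.consFamily a (fun x => (e₀ x : V)) e)) := by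
              apply Submodule.span_mono
              rintro _ ⟨p, rfl⟩
              exact ⟨BlockData.consSucc a m d p, rfl⟩
            exact this (he1 ▸ hsplit v hv)
          · exact Submodule.subset_span ⟨BlockData.consZero a m d x, rfl⟩
      · intro p q
        induction p using BlockData.cons_cases <;> induction q using BlockData.cons_cases
        · simp only [BlockData.consFamily_zero, BlockData.consZero_inj, h1']
        · simp only [BlockData.consFamily_zero, BlockData.consFamily_succ,
            BlockData.consZero_ne_consSucc, hF0, if_false]
        · simp only [BlockData.consFamily_zero, BlockData.consFamily_succ,
            BlockData.consZero_ne_consSucc.symm, hs (e _), hF0, if_false]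
        · simp only [BlockData.consFamily_succ, BlockData.consSucc_inj, he2]
      · intro p q
        induction p using BlockData.cons_cases <;> induction q using BlockData.cons_cases
        · simp only [BlockData.consFamily_zero, BlockData.cons_matrix_zero_zero, h2']
        · simp only [BlockData.consFamily_zero, BlockData.consFamily_succ,
            BlockData.cons_matrix_zero_succ, hG0]
        · simp only [BlockData.consFamily_zero, BlockData.consFamily_succ,
            BlockData.cons_matrix_succ_zero, hG (e _), hG0]
        · simp only [BlockData.consFamily_succ, BlockData.cons_matrix_succ_succ, he3]

end CanonicalForm

end AdditiveQuadric

namespace AdditiveQuadric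

/-! ### Uniqueness of the blocks of a canonical matrix -/

section JordanUniqueness

open Matrix

variable {K : Type*} [Field K]

/-- The dimension of the kernel of a matrix. -/
noncomputable def nullity {ι : Type*} [Fintype ι] (M : Matrix ι ι K) : ℕ :=
  finrank K (LinearMap.ker M.mulVecLin)

theorem nullity_eq_of_mul_eq {ι ι' : Type*} [Fintype ι] [Fintype ι'] [DecidableEq ι]
    [DecidableEq ι'] {M : Matrix ι ι K} {M' : Matrix ι' ι' K} {P : Matrix ι' ι K}
    {Q : Matrix ι ι' K} (hPQ : P * Q = 1) (hQP : Q * P = 1) (h : M' * P = P * M) :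
    nullity M' = nullity M := by
  have h' : M * Q = Q * M' := by
    calc M * Q = Q * (P * M) * Q := by rw [← Matrix.mul_assoc, hQP, Matrix.one_mul]
      _ = Q * M' := by rw [← h, Matrix.mul_assoc, Matrix.mul_assoc, hPQ, Matrix.mul_one]
  refine LinearEquiv.finrank_eq (LinearEquiv.ofLinearMap
    ((Q.mulVecLin.comp (Submodule.subtype _)).codRestrict _ ?_)
    ((P.mulVecLin.comp (Submodule.subtype _)).codRestrict _ ?_) ?_ ?_)
  · rintro ⟨v, hv⟩
    rw [LinearMap.mem_ker, mulVecLin_apply] at hv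
    simp [LinearMap.mem_ker, Matrix.mulVec_mulVec, h']
    rw [← Matrix.mulVec_mulVec, hv, Matrix.mulVec_zero]
  · rintro ⟨v, hv⟩
    rw [LinearMap.mem_ker, mulVecLin_apply] at hv
    simp [LinearMap.mem_ker, Matrix.mulVec_mulVec, h]
    rw [← Matrix.mulVec_mulVec, hv, Matrix.mulVec_zero]
  · ext v : 2
    simp [Matrix.mulVec_mulVec, hQP]
  · ext v : 2
    simp [Matrix.mulVec_mulVec, hPQ]

theorem nullity_smul {ι : Type*} [Fintype ι] {c : K} (hc : c ≠ 0) (M : Matrix ι ι K) :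
    nullity (c • M) = nullity M := by
  have : LinearMap.ker (c • M).mulVecLin = LinearMap.ker M.mulVecLin := by
    ext v
    simp [hc]
  unfold nullity
  rw [this]

theorem nullity_eq_zero {ι : Type*} [Fintype ι] [DecidableEq ι] {M : Matrix ι ι K}
    (h : IsUnit M) : nullity M = 0 := by
  unfold nullity
  rw [Submodule.finrank_eq_zero, LinearMap.ker_eq_bot]
  exact Matrix.mulVec_injective_iff_isUnit.2 h

theorem blockDiagonal'_mulVec {o : Type*} [Fintype o] [DecidableEq o] {n : o → Type*}
    [∀ b, Fintype (n b)] (A : ∀ b, Matrix (n b) (n b) K) (v : (Σ b, n b) → K) (b : o) (x : n b) :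
    (blockDiagonal' A *ᵥ v) ⟨b, x⟩ = (A b *ᵥ fun y => v ⟨b, y⟩) x := by
  simp only [Matrix.mulVec, dotProduct, Fintype.sum_sigma]
  rw [Finset.sum_eq_single b]
  · simp [blockDiagonal'_apply_eq]
  · intro c _ hc
    refine Finset.sum_eq_zero fun y _ => ?_
    rw [blockDiagonal'_apply_ne _ _ _ hc.symm, zero_mul]
  · simp

theorem nullity_blockDiagonal' {o : Type*} [Fintype o] [DecidableEq o] {n : o → Type*}
    [∀ b, Fintype (n b)] (A : ∀ b, Matrix (n b) (n b) K) :
    nullity (blockDiagonal' A) = ∑ b, nullity (A b) := by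
  unfold nullity
  rw [← Module.finrank_pi_fintype]
  refine LinearEquiv.finrank_eq
    { toFun := fun v b => ⟨fun x => v.1 ⟨b, x⟩, ?_⟩
      invFun := fun f => ⟨fun p => (f p.1).1 p.2, ?_⟩
      map_add' := fun _ _ => rfl
      map_smul' := fun _ _ => rfl
      left_inv := fun _ => rfl
      right_inv := fun _ => rfl }
  · rw [LinearMap.mem_ker, mulVecLin_apply]
    ext x
    rw [← blockDiagonal'_mulVec]
    have := v.2
    rw [LinearMap.mem_ker, mulVecLin_apply] at this
    rw [this]; rfl
  · rw [LinearMap.mem_ker, mulVecLin_apply]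
    ext ⟨b, x⟩
    rw [blockDiagonal'_mulVec]
    have := (f b).2
    rw [LinearMap.mem_ker, mulVecLin_apply] at this
    exact congrFun this x

/-- The nilpotent upper shift matrix. -/
def shift (K : Type*) [Field K] (m : ℕ) : Matrix (Fin m) (Fin m) K :=
  Matrix.of fun x y => if x.val + 1 = y.val then 1 else 0

theorem shift_mulVec (m : ℕ) (v : Fin m → K) (x : Fin m) :
    (shift K m *ᵥ v) x = if h : x.val + 1 < m then v ⟨x.val + 1, h⟩ else 0 := by
  simp only [shift, Matrix.mulVec, dotProduct, Matrix.of_apply, ite_mul, one_mul, zero_mul]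
  split_ifs with h
  · rw [Finset.sum_eq_single ⟨x.val + 1, h⟩]
    · simp
    · intro y _ hy
      rw [if_neg]
      intro h'
      exact hy (Fin.ext h'.symm)
    · simp
  · refine Finset.sum_eq_zero fun y _ => if_neg ?_
    have := y.2
    omega

theorem shift_pow_mulVec (m k : ℕ) (v : Fin m → K) (x : Fin m) :
    (shift K m ^ k *ᵥ v) x = if h : x.val + k < m then v ⟨x.val + k, h⟩ else 0 := by
  induction k generalizing x with
  | zero => simp
  | succ k ih =>
    rw [pow_succ', ← Matrix.mulVec_mulVec, shift_mulVec]
    by_cases h1 : x.val + 1 < m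
    · rw [dif_pos h1, ih]
      by_cases h2 : x.val + 1 + k < m
      · rw [dif_pos (by simpa using h2), dif_pos (by omega)]
        congr 1
        ext
        simp; omega
      · rw [dif_neg (by simpa using h2), dif_neg (by omega)]
    · rw [dif_neg h1, dif_neg (by omega)]

theorem nullity_shift_pow (m k : ℕ) : nullity (shift K m ^ k) = min k m := by
  classical
  have hk : ∀ v : Fin m → K, v ∈ LinearMap.ker (shift K m ^ k).mulVecLin ↔
      ∀ y : Fin m, k ≤ y.val → v y = 0 := by
    intro v
    rw [LinearMap.mem_ker, mulVecLin_apply]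
    constructor
    · intro h y hy
      have := congrFun h ⟨y.val - k, by omega⟩
      rw [shift_pow_mulVec, dif_pos (by have := y.2; simp; omega)] at this
      rw [← Pi.zero_apply (M := fun _ => K) (⟨y.val - k, by omega⟩ : Fin m), ← this]
      congr 1
      ext
      simp; omega
    · intro h
      ext x
      rw [shift_pow_mulVec]
      split_ifs with h'
      · exact h _ (by simp)
      · rfl
  have e : LinearMap.ker (shift K m ^ k).mulVecLin ≃ₗ[K] (Fin (min k m) → K) :=
    { toFun := fun v x => v.1 ⟨x.val, by have := x.2; omega⟩
      invFun := fun f => ⟨fun y => if h : y.val < min k m then f ⟨y.val, h⟩ else 0, by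
        rw [hk]
        intro y hy
        rw [dif_neg (by omega)]⟩
      map_add' := fun _ _ => rfl
      map_smul' := fun _ _ => rfl
      left_inv := by
        rintro ⟨v, hv⟩
        ext y
        by_cases h : y.val < min k m
        · simp [h]
        · have := (hk v).1 hv y (by have := y.2; omega)
          simp only [h, dite_false, this]
      right_inv := by
        intro f
        ext x
        exact dif_pos x.2 }
  unfold nullity
  rw [e.finrank_eq, Module.finrank_fin_fun]

theorem isUnit_shift_add {m : ℕ} {c : K} (hc : c ≠ 0) :
    IsUnit (shift K m + c • (1 : Matrix (Fin m) (Fin m) K)) := by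
  rw [Matrix.isUnit_iff_isUnit_det, Matrix.det_of_isUpperTriangular]
  · simp [shift, hc]
  · intro x y hxy
    have hxy' : y < x := hxy
    have h1 : ¬ x.val + 1 = y.val := by rw [Fin.lt_def] at hxy'; omega
    simp [shift, h1, hxy'.ne']

/-- The change of basis from a canonical block to a Jordan block. -/
def jordanChange (I : K) (m : ℕ) : Matrix (Fin m) (Fin m) K :=
  Matrix.of fun x y => (if x = y then 1 else 0) - I * (if x.val + y.val + 1 = m then 1 else 0)

theorem sum_mul_anti {m : ℕ} (f : Fin m → K) (y : Fin m) :
    ∑ z : Fin m, f z * (if z.val + y.val + 1 = m then 1 else 0) = f y.rev := by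
  rw [Finset.sum_eq_single y.rev]
  · have := y.2
    rw [if_pos, mul_one]
    rw [Fin.val_rev]; omega
  · intro z _ hz
    rw [if_neg, mul_zero]
    intro h
    apply hz
    ext
    rw [Fin.val_rev]; omega
  · simp

theorem sum_mul_single {m : ℕ} (f : Fin m → K) (y : Fin m) :
    ∑ z : Fin m, f z * (if z = y then 1 else 0) = f y := by
  simp

theorem sum_single_mul {m : ℕ} (f : Fin m → K) (x : Fin m) :
    ∑ z : Fin m, (if x = z then 1 else 0) * f z = f x := by
  simp

/-- With `J` the antidiagonal permutation matrix, `jordanChange I m = 1 - I J`, and `(1 - I J)(1 + I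
J) = 1 - I² J² = 2`. -/
theorem jordanChange_mul [CharZero K] {I : K} (hI : I ^ 2 = -1) (m : ℕ) :
    jordanChange I m * ((1 / 2 : K) • jordanChange (-I) m) = 1 ∧
    ((1 / 2 : K) • jordanChange (-I) m) * jordanChange I m = 1 := by
  have key : jordanChange I m * ((1 / 2 : K) • jordanChange (-I) m) = 1 := by
    ext x y
    have hx := x.2
    have hy := y.2
    rw [Matrix.mul_smul, Matrix.smul_apply, Matrix.mul_apply]
    simp only [jordanChange, Matrix.of_apply, Matrix.one_apply]
    have : ∀ z : Fin m, (((if x = z then 1 else 0) - I * if x.val + z.val + 1 = m then 1 else 0) *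
        ((if z = y then 1 else 0) - -I * if z.val + y.val + 1 = m then 1 else 0)) =
        ((if x = z then 1 else 0) - I * if x.val + z.val + 1 = m then 1 else 0) *
          (if z = y then 1 else 0) +
        (I * ((if x = z then 1 else 0) - I * if x.val + z.val + 1 = m then 1 else 0)) *
          (if z.val + y.val + 1 = m then 1 else 0) := by intro z; ring
    simp only [this, Finset.sum_add_distrib, sum_mul_anti, sum_mul_single, Fin.val_rev]
    have e1 : (x = y.rev) ↔ (x.val + y.val + 1 = m) := by
      rw [Fin.ext_iff, Fin.val_rev]; omega
    have e2 : (x.val + (m - (y.val + 1)) + 1 = m) ↔ x = y := by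
      rw [Fin.ext_iff]; omega
    simp only [e1, e2, smul_eq_mul]
    linear_combination (-(1 / 2 : K) * if x = y then 1 else 0) * hI
  exact ⟨key, mul_eq_one_comm.1 key⟩

/-- With `S` the shift and `J` the antidiagonal permutation, `J S J = Sᵀ`, so `(1 - I J) S (1 + I J)
/ 2 = (S + Sᵀ + I (S J - J S)) / 2`. This is the canonical block with eigenvalue 0, which is thus a
symmetric conjugate of a Jordan block. -/
theorem canonicalBlock_mul_jordanChange [CharZero K] {I : K} (hI : I ^ 2 = -1) (a c : K) (m : ℕ) :
    (canonicalBlock I a m - c • (1 : Matrix (Fin m) (Fin m) K)) * jordanChange I m =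
      jordanChange I m * (shift K m + (a - c) • (1 : Matrix (Fin m) (Fin m) K)) := by
  have h0 : canonicalBlock I a m = canonicalBlock I 0 m + a • (1 : Matrix (Fin m) (Fin m) K) := by
    ext x y
    simp only [canonicalBlock, Matrix.of_apply, Matrix.add_apply, Matrix.smul_apply,
      Matrix.one_apply, smul_eq_mul]
    split_ifs <;> ring
  have key : canonicalBlock I 0 m * jordanChange I m = jordanChange I m * shift K m := by
    ext x y
    have hx := x.2
    have hy := y.2
    rw [Matrix.mul_apply, Matrix.mul_apply]
    simp only [jordanChange, shift, Matrix.of_apply]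
    have h1 : ∀ z : Fin m, canonicalBlock I 0 m x z *
        ((if z = y then 1 else 0) - I * if z.val + y.val + 1 = m then 1 else 0) =
        canonicalBlock I 0 m x z * (if z = y then 1 else 0) +
        (-I * canonicalBlock I 0 m x z) * (if z.val + y.val + 1 = m then 1 else 0) := by
      intro z; ring
    have h2 : ∀ z : Fin m, ((if x = z then 1 else 0) - I * if x.val + z.val + 1 = m then 1 else 0) *
        (if z.val + 1 = y.val then 1 else 0) =
        (if x = z then 1 else 0) * (if z.val + 1 = y.val then 1 else 0) +
        (-I * (if z.val + 1 = y.val then 1 else 0)) * (if z.val + x.val + 1 = m then 1 else 0) := by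
      intro z
      rw [show z.val + x.val + 1 = x.val + z.val + 1 by ring]
      ring
    simp only [h1, h2, Finset.sum_add_distrib, sum_mul_anti, sum_mul_single, sum_single_mul,
      Fin.val_rev]
    simp only [canonicalBlock, Matrix.of_apply, Fin.val_rev, ite_self]
    have e1 : (if x.val + 1 = m - (y.val + 1) ∨ m - (y.val + 1) + 1 = x.val then (1 : K) else 0) =
        (if x.val + y.val + 2 = m then 1 else 0) + (if x.val + y.val = m then 1 else 0) := by
      split_ifs <;> first | omega | simp
    have e0 : (if x.val + 1 = y.val ∨ y.val + 1 = x.val then (1 : K) else 0) =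
        (if x.val + 1 = y.val then 1 else 0) + (if y.val + 1 = x.val then 1 else 0) := by
      split_ifs <;> first | omega | simp
    have e2 : (x.val + (m - (y.val + 1)) + 2 = m) ↔ x.val + 1 = y.val := by omega
    have e3 : (x.val + (m - (y.val + 1)) = m) ↔ y.val + 1 = x.val := by omega
    have e4 : (m - (x.val + 1) + 1 = y.val) ↔ x.val + y.val = m := by omega
    rw [e0, e1]
    simp only [e2, e3, e4]
    linear_combination (-(1 / 2 : K) * ((if x.val + 1 = y.val then 1 else 0) -
      (if y.val + 1 = x.val then 1 else 0))) * hI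
  rw [h0, add_sub_assoc, Matrix.add_mul, key, Matrix.mul_add, ← sub_smul, Matrix.smul_mul,
    Matrix.mul_smul, Matrix.one_mul, Matrix.mul_one]

theorem nullity_canonicalBlock [CharZero K] [DecidableEq K] {I : K} (hI : I ^ 2 = -1) (a c : K)
    (m k : ℕ) :
    nullity ((canonicalBlock I a m - c • (1 : Matrix (Fin m) (Fin m) K)) ^ k) =
      if a = c then min k m else 0 := by
  obtain ⟨h1, h2⟩ := jordanChange_mul hI m
  have hpow : ∀ k, (canonicalBlock I a m - c • (1 : Matrix (Fin m) (Fin m) K)) ^ k *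
      jordanChange I m =
      jordanChange I m * (shift K m + (a - c) • (1 : Matrix (Fin m) (Fin m) K)) ^ k := by
    intro k
    induction k with
    | zero => simp
    | succ k ih =>
      rw [pow_succ, Matrix.mul_assoc, canonicalBlock_mul_jordanChange hI, ← Matrix.mul_assoc, ih,
        Matrix.mul_assoc, ← pow_succ]
  rw [nullity_eq_of_mul_eq h1 h2 (hpow k)]
  split_ifs with h
  · rw [h, sub_self, zero_smul, add_zero, nullity_shift_pow]
  · exact nullity_eq_zero ((isUnit_shift_add (sub_ne_zero.2 h)).pow k)

/-- These similarity invariants determine all the blocks when `c` and `k` vary. -/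
theorem nullity_matrix [CharZero K] [DecidableEq K] {I : K} (hI : I ^ 2 = -1) (d : BlockData K)
    (c : K) (k : ℕ) :
    nullity ((d.matrix I - c • (1 : Matrix d.Index d.Index K)) ^ k) =
      ∑ b, if d.eig b = c then min k (d.size b) else 0 := by
  have h : d.matrix I - c • (1 : Matrix d.Index d.Index K) = blockDiagonal' fun b =>
      canonicalBlock I (d.eig b) (d.size b) - c • (1 : Matrix (Fin (d.size b)) _ K) := by
    have := blockDiagonal'_sub (fun b => canonicalBlock I (d.eig b) (d.size b))
      (c • fun b => (1 : Matrix (Fin (d.size b)) (Fin (d.size b)) K))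
    rw [blockDiagonal'_smul] at this
    have h1 := blockDiagonal'_one (α := K) (m' := fun b => Fin (d.size b))
    rw [BlockData.matrix, ← h1]
    exact this.symm
  rw [h, ← blockDiagonal'_pow, nullity_blockDiagonal']
  refine Finset.sum_congr rfl fun b _ => ?_
  rw [Pi.pow_apply, nullity_canonicalBlock hI]

/-- Canonical matrices whose affine transforms are similar have the same blocks, up to a
permutation and the transformation of the eigenvalues. -/
theorem exists_perm_of_similar [CharZero K] {I : K} (hI : I ^ 2 = -1) {d d' : BlockData K}
    {a h : K} (ha : a ≠ 0) {P : Matrix d'.Index d.Index K} {Q : Matrix d.Index d'.Index K}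
    (hPQ : P * Q = 1) (hQP : Q * P = 1)
    (hP : d'.matrix I * P = P * (a • d.matrix I + h • (1 : Matrix d.Index d.Index K))) :
    ∃ σ : Fin d.num ≃ Fin d'.num,
      ∀ k, d'.size (σ k) = d.size k ∧ d'.eig (σ k) = a * d.eig k + h := by
  classical
  have hD : ∀ (c : K) (k : ℕ), (∑ b, if d'.eig b = a * c + h then min k (d'.size b) else 0) =
      ∑ b, if d.eig b = c then min k (d.size b) else 0 := by
    intro c k
    rw [← nullity_matrix hI, ← nullity_matrix hI, 
      ← nullity_smul (pow_ne_zero k ha) ((d.matrix I - _) ^ k), ← smul_pow]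
    apply nullity_eq_of_mul_eq hPQ hQP
    have h1 : (d'.matrix I - (a * c + h) • (1 : Matrix d'.Index d'.Index K)) * P =
        P * (a • (d.matrix I - c • (1 : Matrix d.Index d.Index K))) := by
      have e1 : ((a * c + h) • (1 : Matrix d'.Index d'.Index K)) * P = (a * c + h) • P := by
        rw [Matrix.smul_mul, Matrix.one_mul]
      rw [Matrix.sub_mul, hP, e1, smul_sub, Matrix.mul_sub, Matrix.mul_add]
      simp only [Matrix.mul_smul, Matrix.mul_one, smul_smul, add_smul]
      abel
    induction k with
    | zero => simp
    | succ k ih => rw [pow_succ, Matrix.mul_assoc, h1, ← Matrix.mul_assoc, ih, Matrix.mul_assoc,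
        ← pow_succ]
  have hcount : ∀ (c : K) (n : ℕ), (∑ b, if d'.eig b = a * c + h ∧ d'.size b = n + 1 then 1 else 0) =
      ∑ b, if d.eig b = c ∧ d.size b = n + 1 then 1 else 0 := by
    intro c n
    -- The second difference of `k ↦ min k size` at `k = n + 1` vanishes unless the size is exactly
    -- `n + 1`, so the nullities count the blocks of each size.
    have hid : ∀ (dd : BlockData K) (c : K),
        (∑ b, if dd.eig b = c ∧ dd.size b = n + 1 then 1 else 0) +
        ((∑ b, if dd.eig b = c then min n (dd.size b) else 0) +
        (∑ b, if dd.eig b = c then min (n + 2) (dd.size b) else 0)) =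
        2 * (∑ b, if dd.eig b = c then min (n + 1) (dd.size b) else 0) := by
      intro dd c
      rw [← Finset.sum_add_distrib, ← Finset.sum_add_distrib, Finset.mul_sum]
      refine Finset.sum_congr rfl fun b _ => ?_
      by_cases h1 : dd.eig b = c <;> by_cases h2 : dd.size b = n + 1 <;> simp [h1, h2] <;> omega
    have h1 := hid d' (a * c + h)
    have h2 := hid d c
    rw [hD, hD, hD] at h1
    omega
  let f : Fin d.num → K × ℕ := fun b => (a * d.eig b + h, d.size b)
  let f' : Fin d'.num → K × ℕ := fun b => (d'.eig b, d'.size b)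
  -- Each pair of eigenvalue and size has the same multiplicity on both sides; size 0 does not
  -- occur. Matching the fibres gives the permutation.
  have hcard : ∀ p, Nonempty ({b // f b = p} ≃ {b // f' b = p}) := by
    rintro ⟨x, n⟩
    refine ⟨Fintype.equivOfCardEq ?_⟩
    rw [Fintype.card_subtype, Fintype.card_subtype, Finset.card_filter, Finset.card_filter]
    rcases n with _ | n
    · rw [Finset.sum_eq_zero, Finset.sum_eq_zero]
      · intro b _
        rw [if_neg]
        intro h0
        exact (d'.size_pos b).ne' (congrArg Prod.snd h0)
      · intro b _
        rw [if_neg]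
        intro h0
        exact (d.size_pos b).ne' (congrArg Prod.snd h0)
    · have := hcount ((x - h) / a) n
      have e1 : a * ((x - h) / a) + h = x := by field_simp; ring
      rw [e1] at this
      simp only [f, f', Prod.mk.injEq]
      rw [this]
      refine Finset.sum_congr rfl fun b _ => ?_
      have : a * d.eig b + h = x ↔ d.eig b = (x - h) / a := by
        rw [eq_div_iff ha]
        constructor <;> intro h <;> linear_combination h
      rw [this]
  refine ⟨Equiv.ofFiberEquiv fun p => (hcard p).some, fun k => ?_⟩
  have := Equiv.ofFiberEquiv_map (fun p => (hcard p).some) k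
  exact ⟨congrArg Prod.snd this, congrArg Prod.fst this⟩

end JordanUniqueness

end AdditiveQuadric

namespace AdditiveQuadric

/-! ### Normal form of a pair of symmetric forms along the chain of radicals -/

section Pencil

variable {K V : Type*} [Field K] [AddCommGroup V] [Module K V]

/-- The kernel of the restriction of a bilinear form to a subspace. -/
def radOn (F : LinearMap.BilinForm K V) (U : Submodule K V) : Submodule K V where
  carrier := {α | α ∈ U ∧ ∀ β ∈ U, F α β = 0}
  zero_mem' := ⟨U.zero_mem, fun _ _ => by simp⟩
  add_mem' := fun {a b} ha hb => ⟨U.add_mem ha.1 hb.1, fun β hβ => by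
    rw [map_add, LinearMap.add_apply, ha.2 β hβ, hb.2 β hβ, add_zero]⟩
  smul_mem' := fun c a ha => ⟨U.smul_mem c ha.1, fun β hβ => by
    rw [map_smul, LinearMap.smul_apply, ha.2 β hβ, smul_zero]⟩

theorem mem_radOn {F : LinearMap.BilinForm K V} {U : Submodule K V} {α : V} :
    α ∈ radOn F U ↔ α ∈ U ∧ ∀ β ∈ U, F α β = 0 := Iff.rfl

/-- The subspace orthogonal to the `F`-radical with respect to `G`. -/
def nextOn (F G : LinearMap.BilinForm K V) (U : Submodule K V) : Submodule K V where
  carrier := {α | α ∈ U ∧ ∀ β ∈ radOn F U, G α β = 0}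
  zero_mem' := ⟨U.zero_mem, fun _ _ => by simp⟩
  add_mem' := fun {a b} ha hb => ⟨U.add_mem ha.1 hb.1, fun β hβ => by
    rw [map_add, LinearMap.add_apply, ha.2 β hβ, hb.2 β hβ, add_zero]⟩
  smul_mem' := fun c a ha => ⟨U.smul_mem c ha.1, fun β hβ => by
    rw [map_smul, LinearMap.smul_apply, ha.2 β hβ, smul_zero]⟩

theorem mem_nextOn {F G : LinearMap.BilinForm K V} {U : Submodule K V} {α : V} :
    α ∈ nextOn F G U ↔ α ∈ U ∧ ∀ β ∈ radOn F U, G α β = 0 := Iff.rfl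

theorem radOn_le {F : LinearMap.BilinForm K V} {U : Submodule K V} : radOn F U ≤ U :=
  fun _ h => h.1

theorem nextOn_le {F G : LinearMap.BilinForm K V} {U : Submodule K V} : nextOn F G U ≤ U :=
  fun _ h => h.1

/-- The chain of subspaces obtained by iterating `nextOn`. -/
def upOn (F G : LinearMap.BilinForm K V) (U : Submodule K V) (k : ℕ) : Submodule K V :=
  (nextOn F G)^[k] U

theorem upOn_zero {F G : LinearMap.BilinForm K V} {U : Submodule K V} : upOn F G U 0 = U := rfl

theorem upOn_succ {F G : LinearMap.BilinForm K V} {U : Submodule K V} {k : ℕ} :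
    upOn F G U (k + 1) = upOn F G (nextOn F G U) k := rfl

theorem upOn_succ' {F G : LinearMap.BilinForm K V} {U : Submodule K V} {k : ℕ} :
    upOn F G U (k + 1) = nextOn F G (upOn F G U k) :=
  Function.iterate_succ_apply' _ _ _

/-- The stopping condition for the chain. -/
def StopsOn (F G : LinearMap.BilinForm K V) (U : Submodule K V) : Prop :=
  nextOn F G U = U ∨ ¬ radOn F U ≤ radOn F (nextOn F G U) ∨ radOn F U = radOn F (nextOn F G U)

/-- The letter given by a stage of the chain. -/
def LetterOn (F G : LinearMap.BilinForm K V) (U : Submodule K V) : Triple.Letter → Prop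
  | .A => nextOn F G U = U
  | .B => nextOn F G U ≠ U ∧ ¬ radOn F U ≤ radOn F (nextOn F G U)
  | .C => nextOn F G U ≠ U ∧ radOn F U = radOn F (nextOn F G U)

/-- The number of the elements `f_i` for given letter and level. -/
def numFOf (L : Triple.Letter) (s : ℕ) : ℕ :=
  match L with
  | .A => s
  | .B => s
  | .C => s + 1

open Classical in
/-- A normal form of a pair of symmetric forms on `U`, modulo a common kernel `Z`, where
`z` spans the kernel of the first form modulo `Z`. -/
structure PencilBasis (F G : LinearMap.BilinForm K V) (Z U : Submodule K V) (z : V)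
    (L : Triple.Letter) (s p : ℕ) where
  g : ℕ → V
  f : ℕ → V
  e : Fin p → V
  g_zero : ∃ c : K, c ≠ 0 ∧ g 0 = c • z
  g_mem : ∀ j ≤ s, g j ∈ radOn F (upOn F G U j)
  g_notMem : ∀ j < s, g (j + 1) ∉ radOn F (upOn F G U j)
  f_mem : ∀ i < numFOf L s, f i ∈ upOn F G U i
  f_notMem : ∀ i < numFOf L s, f i ∉ upOn F G U (i + 1)
  e_mem : ∀ k, e k ∈ upOn F G U (numFOf L s)
  up_le : upOn F G U (numFOf L s) ≤
    radOn F (upOn F G U (numFOf L s)) ⊔ Submodule.span K (Set.range e)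
  le_span : U ≤ Z ⊔ Submodule.span K (g '' Set.Iic s) ⊔ Submodule.span K (Set.range e) ⊔
    Submodule.span K (f '' Set.Iio (numFOf L s))
  F_e_e : ∀ k l, F (e k) (e l) = if k = l then 1 else 0
  F_f_e : ∀ i < numFOf L s, ∀ k, F (f i) (e k) = 0
  G_f_e : ∀ i < numFOf L s, ∀ k, G (f i) (e k) = 0
  F_g_e : ∀ j ≤ s, ∀ k, F (g j) (e k) = 0
  G_g_e : ∀ j ≤ s, ∀ k, G (g j) (e k) = 0
  F_g_g : ∀ i ≤ s, ∀ j ≤ s, F (g i) (g j) = 0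
  G_g_g : ∀ i ≤ s, ∀ j ≤ s, G (g i) (g j) = if L = .B ∧ i = s ∧ j = s then 1 else 0
  F_f_g : ∀ i < numFOf L s, ∀ j ≤ s, F (f i) (g j) = if j = i + 1 then 1 else 0
  G_f_g : ∀ i < numFOf L s, ∀ j ≤ s, G (f i) (g j) = if j = i then 1 else 0
  F_f_f : ∀ i < numFOf L s, ∀ j < numFOf L s, F (f i) (f j) = if i = s ∧ j = s then 1 else 0
  G_f_f : ∀ i < numFOf L s, ∀ j < numFOf L s, G (f i) (f j) = 0

variable {F G : LinearMap.BilinForm K V} {Z U : Submodule K V} {z : V}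

theorem radOn_sub_mem (hFs : ∀ x y, F x y = F y x) {x y : V} (hx : x ∈ radOn F U) (hy : y ∈ U) :
    F y x = 0 := by rw [hFs]; exact hx.2 y hy

/-- Modulo `Z`, which `G` does not see, the `F`-radical is spanned by `z`; passing to the next stage
therefore costs a single linear condition. -/
theorem mem_nextOn_iff (hGs : ∀ x y, G x y = G y x) (hG : ∀ x ∈ Z, ∀ y ∈ U, G x y = 0)
    (hrad : radOn F U = Z ⊔ Submodule.span K {z}) {x : V} :
    x ∈ nextOn F G U ↔ x ∈ U ∧ G x z = 0 := by
  rw [mem_nextOn, hrad]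
  constructor
  · rintro ⟨h1, h2⟩
    exact ⟨h1, h2 z (Submodule.mem_sup_right (Submodule.mem_span_singleton_self z))⟩
  · rintro ⟨h1, h2⟩
    refine ⟨h1, fun β hβ => ?_⟩
    obtain ⟨a, ha, b, hb, rfl⟩ := Submodule.mem_sup.1 hβ
    obtain ⟨c, rfl⟩ := Submodule.mem_span_singleton.1 hb
    rw [map_add, hGs, hG a ha x h1, map_smul, h2, smul_zero, add_zero]

theorem le_radOn_nextOn (hZ : Z ≤ U)
    (hF : ∀ x ∈ Z, ∀ y ∈ U, F x y = 0) (hG : ∀ x ∈ Z, ∀ y ∈ U, G x y = 0) :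
    Z ≤ radOn F (nextOn F G U) := fun x hx =>
  ⟨⟨hZ hx, fun y hy => hG x hx y hy.1⟩, fun y hy => hF x hx y hy.1⟩

theorem upOn_le_self (k : ℕ) : upOn F G U k ≤ U := by
  induction k generalizing U with
  | zero => exact le_rfl
  | succ k ih => rw [upOn_succ]; exact ih.trans nextOn_le

theorem le_radOn_upOn (hZ : Z ≤ U)
    (hF : ∀ x ∈ Z, ∀ y ∈ U, F x y = 0) (hG : ∀ x ∈ Z, ∀ y ∈ U, G x y = 0) (k : ℕ) :
    Z ≤ radOn F (upOn F G U k) := by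
  have h : ∀ k, Z ≤ upOn F G U k := by
    intro k
    induction k with
    | zero => exact hZ
    | succ k ih =>
      rw [upOn_succ']
      exact fun x hx => ⟨ih hx, fun y hy => hG x hx y (upOn_le_self k (radOn_le hy))⟩
  exact fun x hx => ⟨h k hx, fun y hy => hF x hx y (upOn_le_self k hy)⟩

/-- An orthonormal basis of a complement of a subspace of the kernel. -/
theorem exists_orthonormal_complement [IsAlgClosed K] [CharZero K] [FiniteDimensional K V]
    (hFs : ∀ x y, F x y = F y x) (hGs : ∀ x y, G x y = G y x) {A B : Submodule K V}
    (h0 : ∀ x ∈ A, ∀ y ∈ B, F x y = 0) (hrad : ∀ x ∈ B, (∀ y ∈ B, F x y = 0) → x ∈ A) :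
    ∃ (p : ℕ) (e : Fin p → V), (∀ k, e k ∈ B) ∧ B ≤ A ⊔ Submodule.span K (Set.range e) ∧
      ∀ k l, F (e k) (e l) = if k = l then 1 else 0 := by
  obtain ⟨E, hE1, hE2⟩ := Submodule.exists_isCompl (A.comap B.subtype)
  have hE : ∀ x ∈ E.map B.subtype, (∀ y ∈ E.map B.subtype, F x y = 0) → x = 0 := by
    rintro _ ⟨x, hx, rfl⟩ h
    have hxA : (x : V) ∈ A := by
      refine hrad x x.2 fun y hy => ?_
      have : (⟨y, hy⟩ : B) ∈ A.comap B.subtype ⊔ E := by rw [codisjoint_iff.1 hE2]; trivial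
      obtain ⟨a, ha, b, hb, hab⟩ := Submodule.mem_sup.1 this
      have hy' : y = a + b := (congrArg Subtype.val hab).symm
      rw [hy', map_add, hFs, h0 a ha x x.2, zero_add]
      exact h b ⟨b, hb, rfl⟩
    have := Submodule.disjoint_def.1 hE1 x hxA hx
    rw [this, map_zero]
  obtain ⟨I, hI⟩ := IsAlgClosed.exists_pow_nat_eq (-1 : K) zero_lt_two
  -- The canonical basis serves here only as an `F`-orthonormal basis; its information on `G` is
  -- discarded.
  obtain ⟨d, e, h1, h2, -⟩ := exists_canonical_basis I hI F G hFs hGs _ _ rfl hE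
  let σ := Fintype.equivFin d.Index
  refine ⟨Fintype.card d.Index, e ∘ σ.symm, fun k => ?_, ?_, fun k l => ?_⟩
  · have : e (σ.symm k) ∈ E.map B.subtype := h1 ▸ Submodule.subset_span ⟨_, rfl⟩
    obtain ⟨x, _, hx⟩ := this
    have hx' : (x : V) = (e ∘ σ.symm) k := hx
    rw [← hx']
    exact x.2
  · rw [σ.symm.surjective.range_comp, h1]
    intro y hy
    have : (⟨y, hy⟩ : B) ∈ A.comap B.subtype ⊔ E := by rw [codisjoint_iff.1 hE2]; trivial
    obtain ⟨a, ha, b, hb, hab⟩ := Submodule.mem_sup.1 this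
    have hy' : y = a + b := (congrArg Subtype.val hab).symm
    rw [hy']
    exact Submodule.add_mem_sup ha ⟨b, hb, rfl⟩
  · simp only [Function.comp_apply, h2, EmbeddingLike.apply_eq_iff_eq]

theorem span_image_Iic_zero (g : ℕ → V) :
    Submodule.span K (g '' Set.Iic 0) = Submodule.span K {g 0} := by
  congr 1
  ext x
  simp [eq_comm]

/-- All of `U` is `G`-orthogonal to its `F`-radical, so an orthonormal basis of any complement of
the radical will do and no `f_i` is needed. -/
theorem pencilBasis_A [IsAlgClosed K] [CharZero K] [FiniteDimensional K V]
    (hFs : ∀ x y, F x y = F y x) (hGs : ∀ x y, G x y = G y x)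
    (hrad : radOn F U = Z ⊔ Submodule.span K {z})
    (hA : nextOn F G U = U) : ∃ p, Nonempty (PencilBasis F G Z U z .A 0 p) := by
  obtain ⟨p, e, h1, h2, h3⟩ := exists_orthonormal_complement (F := F) (G := G) hFs hGs
    (A := radOn F U) (B := U) (fun x hx y hy => hx.2 y hy) (fun x hx h => ⟨hx, h⟩)
  have hz : z ∈ radOn F U := hrad ▸ Submodule.mem_sup_right (Submodule.mem_span_singleton_self z)
  have hGz : ∀ x ∈ U, G z x = 0 := fun x hx => by
    rw [hGs]
    rw [← hA] at hx
    exact hx.2 z hz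
  refine ⟨p, ⟨{
    g := fun _ => z
    f := fun _ => 0
    e := e
    g_zero := ⟨1, one_ne_zero, (one_smul K z).symm⟩
    g_mem := fun j hj => by obtain rfl := Nat.le_zero.1 hj; exact hz
    g_notMem := fun j hj => absurd hj (Nat.not_lt_zero j)
    f_mem := fun j hj => absurd hj (Nat.not_lt_zero j)
    f_notMem := fun j hj => absurd hj (Nat.not_lt_zero j)
    e_mem := h1
    up_le := h2
    le_span := ?_
    F_e_e := h3
    F_f_e := fun j hj => absurd hj (Nat.not_lt_zero j)
    G_f_e := fun j hj => absurd hj (Nat.not_lt_zero j)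
    F_g_e := fun _ _ k => hz.2 _ (h1 k)
    G_g_e := fun _ _ k => hGz _ (h1 k)
    F_g_g := fun _ _ _ _ => hz.2 _ hz.1
    G_g_g := fun _ _ _ _ => by simpa using hGz _ hz.1
    F_f_g := fun j hj => absurd hj (Nat.not_lt_zero j)
    G_f_g := fun j hj => absurd hj (Nat.not_lt_zero j)
    F_f_f := fun j hj => absurd hj (Nat.not_lt_zero j)
    G_f_f := fun j hj => absurd hj (Nat.not_lt_zero j) }⟩⟩
  rw [span_image_Iic_zero, ← hrad]
  exact h2.trans le_sup_left

/-- The radical fails to survive because `G z z ≠ 0`. Then `U` is the sum of the next stage and the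
line of `z`, so the `e_k` can be taken in the next stage, where they are `G`-orthogonal to `z`; a
square root normalizes `G z z` to 1. -/
theorem pencilBasis_B [IsAlgClosed K] [CharZero K] [FiniteDimensional K V]
    (hFs : ∀ x y, F x y = F y x) (hGs : ∀ x y, G x y = G y x) (hZ : Z ≤ U)
    (hF : ∀ x ∈ Z, ∀ y ∈ U, F x y = 0) (hG : ∀ x ∈ Z, ∀ y ∈ U, G x y = 0)
    (hrad : radOn F U = Z ⊔ Submodule.span K {z})
    (hB : ¬ radOn F U ≤ radOn F (nextOn F G U)) :
    ∃ p, Nonempty (PencilBasis F G Z U z .B 0 p) := by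
  have hz : z ∈ radOn F U := hrad ▸ Submodule.mem_sup_right (Submodule.mem_span_singleton_self z)
  have hmem : ∀ {x}, x ∈ nextOn F G U ↔ x ∈ U ∧ G x z = 0 := mem_nextOn_iff hGs hG hrad
  have hzz : G z z ≠ 0 := by
    intro h
    apply hB
    rw [hrad]
    refine sup_le (le_radOn_nextOn hZ hF hG) ?_
    rw [Submodule.span_singleton_le_iff_mem]
    exact ⟨hmem.2 ⟨hz.1, h⟩, fun y hy => hz.2 y hy.1⟩
  have hproj : ∀ x ∈ U, x - (G x z / G z z) • z ∈ nextOn F G U := fun x hx => by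
    rw [hmem]
    refine ⟨U.sub_mem hx (U.smul_mem _ hz.1), ?_⟩
    simp [hzz]
  obtain ⟨p, e, h1, h2, h3⟩ := exists_orthonormal_complement (F := F) (G := G) hFs hGs
    (A := Z) (B := nextOn F G U)
    (fun x hx y hy => hF x hx y hy.1) (fun x hx h => by
      have hxr : x ∈ radOn F U := by
        refine ⟨hx.1, fun y hy => ?_⟩
        have := h _ (hproj y hy)
        rw [map_sub, map_smul, hFs x z, hz.2 x hx.1, smul_zero, sub_zero] at this
        exact this
      rw [hrad] at hxr
      obtain ⟨a, ha, b, hb, rfl⟩ := Submodule.mem_sup.1 hxr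
      obtain ⟨c, rfl⟩ := Submodule.mem_span_singleton.1 hb
      have := (hmem.1 hx).2
      rw [map_add, LinearMap.add_apply, hG a ha z hz.1, zero_add, map_smul, LinearMap.smul_apply,
        smul_eq_mul, mul_eq_zero, or_iff_left hzz] at this
      rw [this, zero_smul, add_zero]
      exact ha)
  obtain ⟨c, hc⟩ := IsAlgClosed.exists_pow_nat_eq (G z z)⁻¹ zero_lt_two
  have hc0 : c ≠ 0 := by
    rintro rfl
    exact inv_ne_zero hzz (by simpa using hc.symm)
  have hU : U ≤ radOn F U ⊔ Submodule.span K (Set.range e) := by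
    intro x hx
    have hx' : x = (x - (G x z / G z z) • z) + (G x z / G z z) • z := by abel
    rw [hx']
    refine Submodule.add_mem _ ?_ (Submodule.mem_sup_left (Submodule.smul_mem _ _ hz))
    have : Z ⊔ Submodule.span K (Set.range e) ≤ radOn F U ⊔ Submodule.span K (Set.range e) :=
      sup_le_sup_right (hrad ▸ le_sup_left) _
    exact this (h2 (hproj x hx))
  refine ⟨p, ⟨{
    g := fun _ => c • z
    f := fun _ => 0
    e := e
    g_zero := ⟨c, hc0, rfl⟩
    g_mem := fun j hj => by obtain rfl := Nat.le_zero.1 hj; exact Submodule.smul_mem _ _ hz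
    g_notMem := fun j hj => absurd hj (Nat.not_lt_zero j)
    f_mem := fun j hj => absurd hj (Nat.not_lt_zero j)
    f_notMem := fun j hj => absurd hj (Nat.not_lt_zero j)
    e_mem := fun k => (h1 k).1
    up_le := hU
    le_span := ?_
    F_e_e := h3
    F_f_e := fun j hj => absurd hj (Nat.not_lt_zero j)
    G_f_e := fun j hj => absurd hj (Nat.not_lt_zero j)
    F_g_e := fun _ _ k => by
      rw [map_smul, LinearMap.smul_apply, hz.2 _ (h1 k).1, smul_zero]
    G_g_e := fun _ _ k => by
      rw [map_smul, LinearMap.smul_apply, hGs, (hmem.1 (h1 k)).2, smul_zero]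
    F_g_g := fun _ _ _ _ => by
      rw [map_smul, map_smul, LinearMap.smul_apply, hz.2 _ hz.1, smul_zero, smul_zero]
    G_g_g := fun i hi j hj => by
      rw [if_pos ⟨rfl, Nat.le_zero.1 hi, Nat.le_zero.1 hj⟩, map_smul, map_smul,
        LinearMap.smul_apply, smul_smul, ← pow_two, hc, smul_eq_mul, inv_mul_cancel₀ hzz]
    F_f_g := fun j hj => absurd hj (Nat.not_lt_zero j)
    G_f_g := fun j hj => absurd hj (Nat.not_lt_zero j)
    F_f_f := fun j hj => absurd hj (Nat.not_lt_zero j)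
    G_f_f := fun j hj => absurd hj (Nat.not_lt_zero j) }⟩⟩
  rw [span_image_Iic_zero, Submodule.span_singleton_smul_eq (IsUnit.mk0 c hc0), ← hrad]
  exact hU.trans le_sup_left

theorem le_nextOn_sup (hGs : ∀ x y, G x y = G y x) (hG : ∀ x ∈ Z, ∀ y ∈ U, G x y = 0)
    (hrad : radOn F U = Z ⊔ Submodule.span K {z}) {φ : V} (hφ : φ ∈ U) (hφz : G φ z ≠ 0) :
    U ≤ nextOn F G U ⊔ Submodule.span K {φ} := by
  intro x hx
  have hx' : x = (x - (G x z / G φ z) • φ) + (G x z / G φ z) • φ := by abel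
  rw [hx']
  refine Submodule.add_mem_sup ?_ (Submodule.smul_mem _ _ (Submodule.mem_span_singleton_self φ))
  rw [mem_nextOn_iff hGs hG hrad]
  refine ⟨U.sub_mem hx (U.smul_mem _ hφ), ?_⟩
  simp [hφz]

theorem exists_apply_ne_zero (hGs : ∀ x y, G x y = G y x) (hG : ∀ x ∈ Z, ∀ y ∈ U, G x y = 0)
    (hrad : radOn F U = Z ⊔ Submodule.span K {z}) (hA : nextOn F G U ≠ U) :
    ∃ φ ∈ U, G φ z ≠ 0 := by
  by_contra! h
  exact hA (le_antisymm nextOn_le fun x hx => (mem_nextOn_iff hGs hG hrad).2 ⟨hx, h x hx⟩)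

/-- The next stage is a hyperplane with the same radical. A vector `φ` outside it, made
`F`-orthogonal to the `e_k`, has `F φ φ ≠ 0`: otherwise it would lie in the radical of `U`, hence in
the hyperplane. This `φ` becomes the last `f`. Subtracting multiples of the radical vector `g₀` then
removes the unwanted values of `G` without affecting `F`. -/
theorem pencilBasis_C [IsAlgClosed K] [CharZero K] [FiniteDimensional K V]
    (hFs : ∀ x y, F x y = F y x) (hGs : ∀ x y, G x y = G y x)
    (hG : ∀ x ∈ Z, ∀ y ∈ U, G x y = 0)
    (hrad : radOn F U = Z ⊔ Submodule.span K {z})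
    (hA : nextOn F G U ≠ U) (hC : radOn F U = radOn F (nextOn F G U)) :
    ∃ p, Nonempty (PencilBasis F G Z U z .C 0 p) := by
  have hz : z ∈ radOn F U := hrad ▸ Submodule.mem_sup_right (Submodule.mem_span_singleton_self z)
  have hmem : ∀ {x}, x ∈ nextOn F G U ↔ x ∈ U ∧ G x z = 0 := mem_nextOn_iff hGs hG hrad
  have hz1 : z ∈ nextOn F G U := by rw [hC] at hz; exact hz.1
  obtain ⟨φ₀, hφ₀, hφ₀z⟩ := exists_apply_ne_zero hGs hG hrad hA
  obtain ⟨p, e, h1, h2, h3⟩ := exists_orthonormal_complement (F := F) (G := G) hFs hGs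
    (A := radOn F U) (B := nextOn F G U)
    (fun x hx y hy => hx.2 y hy.1) (fun x hx h => by rw [hC]; exact ⟨hx, h⟩)
  have hGz : ∀ x ∈ nextOn F G U, G x z = 0 := fun x hx => (hmem.1 hx).2
  obtain ⟨φ₁, hφ₁, hφ₁z, hφ₁e⟩ : ∃ φ ∈ U, G φ z ≠ 0 ∧ ∀ k, F φ (e k) = 0 := by
    refine ⟨φ₀ - ∑ k, F φ₀ (e k) • e k, U.sub_mem hφ₀ (U.sum_mem fun k _ => U.smul_mem _ (h1 k).1),
      ?_, fun l => ?_⟩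
    · simp only [map_sub, map_sum, map_smul, LinearMap.sub_apply, LinearMap.sum_apply,
        LinearMap.smul_apply, hGz _ (h1 _)]
      simpa using hφ₀z
    · simp [map_sub, map_sum, h3]
  have hsup := le_nextOn_sup hGs hG hrad hφ₁ hφ₁z
  have hφ₁F : F φ₁ φ₁ ≠ 0 := by
    intro h
    have : φ₁ ∈ radOn F U := by
      refine ⟨hφ₁, fun y hy => ?_⟩
      have hle : U ≤ LinearMap.ker (F φ₁) := by
        refine hsup.trans (sup_le (h2.trans (sup_le ?_ ?_)) ?_)
        · exact fun x hx => radOn_sub_mem hFs hx hφ₁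
        · rw [Submodule.span_le]
          rintro _ ⟨k, rfl⟩
          exact hφ₁e k
        · rw [Submodule.span_singleton_le_iff_mem]
          exact h
      exact hle hy
    rw [hC] at this
    exact hφ₁z (hGz _ this.1)
  obtain ⟨c, hc⟩ := IsAlgClosed.exists_pow_nat_eq (F φ₁ φ₁)⁻¹ zero_lt_two
  have hc0 : c ≠ 0 := by
    rintro rfl
    exact inv_ne_zero hφ₁F (by simpa using hc.symm)
  obtain ⟨φ, hφ, hφz, hφe, hφφ, hφs⟩ : ∃ φ ∈ U, G φ z ≠ 0 ∧ (∀ k, F φ (e k) = 0) ∧ F φ φ = 1 ∧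
      U ≤ nextOn F G U ⊔ Submodule.span K {φ} := by
    have hcz : G (c • φ₁) z ≠ 0 := by
      rw [map_smul, LinearMap.smul_apply, smul_eq_mul]
      exact mul_ne_zero hc0 hφ₁z
    refine ⟨c • φ₁, U.smul_mem _ hφ₁, hcz, fun k => ?_, ?_,
      le_nextOn_sup hGs hG hrad (U.smul_mem _ hφ₁) hcz⟩
    · rw [map_smul, LinearMap.smul_apply, hφ₁e, smul_zero]
    · rw [map_smul, map_smul, LinearMap.smul_apply, smul_smul, ← pow_two, hc, smul_eq_mul,
        inv_mul_cancel₀ hφ₁F]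
  set g₀ := (G φ z)⁻¹ • z with hg₀
  have hg₀r : g₀ ∈ radOn F U := Submodule.smul_mem _ _ hz
  have hg₀1 : g₀ ∈ nextOn F G U := Submodule.smul_mem _ _ hz1
  have hFg : ∀ x ∈ U, F g₀ x = 0 := hg₀r.2
  have hFg' : ∀ x ∈ U, F x g₀ = 0 := fun x hx => radOn_sub_mem hFs hg₀r hx
  have hGg' : ∀ x ∈ nextOn F G U, G x g₀ = 0 := fun x hx => by
    rw [hg₀, map_smul, hGz x hx, smul_zero]
  have hGg : ∀ x ∈ nextOn F G U, G g₀ x = 0 := fun x hx => by rw [hGs, hGg' x hx]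
  have hGφ : G φ g₀ = 1 := by rw [hg₀, map_smul, smul_eq_mul, inv_mul_cancel₀ hφz]
  have hGφ' : G g₀ φ = 1 := by rw [hGs, hGφ]
  have hup1 : upOn F G U 1 = nextOn F G U := rfl
  refine ⟨p, ⟨{
    g := fun _ => g₀
    -- The factor one half appears because `G φ g₀ = 1` enters the square twice.
    f := fun _ => φ - (1 / 2 * G φ φ) • g₀
    e := fun k => e k - G φ (e k) • g₀
    g_zero := ⟨(G φ z)⁻¹, inv_ne_zero hφz, rfl⟩
    g_mem := fun j hj => by obtain rfl := Nat.le_zero.1 hj; exact hg₀r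
    g_notMem := fun j hj => absurd hj (Nat.not_lt_zero j)
    f_mem := fun j hj => by
      obtain rfl := Nat.lt_one_iff.1 hj
      exact U.sub_mem hφ (U.smul_mem _ hg₀r.1)
    f_notMem := fun j hj h => by
      obtain rfl := Nat.lt_one_iff.1 hj
      have h' := hGz _ h
      rw [map_sub, map_smul, LinearMap.sub_apply, LinearMap.smul_apply, hGz _ hg₀1, smul_zero,
        sub_zero] at h'
      exact hφz h'
    e_mem := fun k => Submodule.sub_mem _ (h1 k) (Submodule.smul_mem _ _ hg₀1)
    up_le := ?_
    le_span := ?_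
    F_e_e := fun k l => by
      have hk := (h1 k).1
      have hl := (h1 l).1
      simp [h3, hFg _ hg₀r.1, hFg _ hl, hFg' _ hk]
    F_f_e := fun i hi k => by
      have hk := (h1 k).1
      simp [hφe, hFg _ hg₀r.1, hFg _ hk, hFg' _ hφ]
    G_f_e := fun i hi k => by
      have hk := h1 k
      simp [hGg _ hg₀1, hGg _ hk, hGφ]
    F_g_e := fun j hj k => by
      have hk := (h1 k).1
      simp [hFg _ hg₀r.1, hFg _ hk]
    G_g_e := fun j hj k => by
      have hk := h1 k
      simp [hGg _ hg₀1, hGg _ hk]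
    F_g_g := fun _ _ _ _ => hFg _ hg₀r.1
    G_g_g := fun i hi j hj => by rw [hGg _ hg₀1, if_neg]; rintro ⟨h, -⟩; cases h
    F_f_g := fun i hi j hj => by
      rw [if_neg (by omega)]
      simp [hFg' _ hφ, hFg _ hg₀r.1]
    G_f_g := fun i hi j hj => by
      obtain rfl := Nat.lt_one_iff.1 hi
      obtain rfl := Nat.le_zero.1 hj
      simp [hGφ, hGg _ hg₀1]
    F_f_f := fun i hi j hj => by
      rw [if_pos ⟨Nat.lt_one_iff.1 hi, Nat.lt_one_iff.1 hj⟩]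
      simp [hφφ, hFg _ hφ, hFg' _ hφ, hFg _ hg₀r.1]
    G_f_f := fun i hi j hj => by
      simp [hGφ, hGφ', hGg _ hg₀1]
      ring }⟩⟩
  · have hr : radOn F (upOn F G U (numFOf .C 0)) = radOn F U := hC.symm
    rw [hr]
    refine h2.trans (sup_le le_sup_left ?_)
    rw [Submodule.span_le]
    rintro _ ⟨k, rfl⟩
    have : e k = (G φ (e k) • g₀) + (e k - G φ (e k) • g₀) := by abel
    rw [SetLike.mem_coe, this]
    exact Submodule.add_mem_sup (Submodule.smul_mem _ _ hg₀r) (Submodule.subset_span ⟨k, rfl⟩)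
  · rw [span_image_Iic_zero, Submodule.span_singleton_smul_eq (IsUnit.mk0 _ (inv_ne_zero hφz)),
      ← hrad]
    set S := radOn F U ⊔ Submodule.span K (Set.range fun k => e k - G φ (e k) • g₀) ⊔
      Submodule.span K ((fun _ : ℕ => φ - (1 / 2 * G φ φ) • g₀) '' Set.Iio (numFOf .C 0))
    have hS1 : radOn F U ≤ S := le_sup_left.trans le_sup_left
    have hS2 : ∀ k, e k ∈ S := fun k => by
      have : e k = (e k - G φ (e k) • g₀) + (G φ (e k) • g₀) := by abel
      rw [this]
      exact S.add_mem (Submodule.mem_sup_left (Submodule.mem_sup_right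
        (Submodule.subset_span ⟨k, rfl⟩))) (S.smul_mem _ (hS1 hg₀r))
    have hS3 : φ ∈ S := by
      have : φ = (φ - (1 / 2 * G φ φ) • g₀) + (1 / 2 * G φ φ) • g₀ := by abel
      rw [this]
      exact S.add_mem (Submodule.mem_sup_right (Submodule.subset_span ⟨0, Nat.one_pos, rfl⟩))
        (S.smul_mem _ (hS1 hg₀r))
    refine hφs.trans (sup_le (h2.trans (sup_le hS1 ?_)) ?_)
    · rw [Submodule.span_le]
      rintro _ ⟨k, rfl⟩
      exact hS2 k
    · rw [Submodule.span_singleton_le_iff_mem]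
      exact hS3

/-- An element of the new radical that is `F`-orthogonal to `φ` lies in the old one, so the radical
grows by at most one dimension. -/
theorem radOn_nextOn_eq (hle : radOn F U < radOn F (nextOn F G U))
    {φ : V} (hφ : U ≤ nextOn F G U ⊔ Submodule.span K {φ}) :
    ∃ z₁, z₁ ∉ radOn F U ∧ radOn F (nextOn F G U) = radOn F U ⊔ Submodule.span K {z₁} := by
  obtain ⟨z₁, hz₁, hz₁'⟩ := SetLike.exists_of_lt hle
  have key : ∀ x ∈ radOn F (nextOn F G U), F x φ = 0 → x ∈ radOn F U := by
    intro x hx h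
    refine ⟨hx.1.1, fun y hy => ?_⟩
    obtain ⟨a, ha, b, hb, rfl⟩ := Submodule.mem_sup.1 (hφ hy)
    obtain ⟨c, rfl⟩ := Submodule.mem_span_singleton.1 hb
    rw [map_add, hx.2 a ha, map_smul, h, smul_zero, zero_add]
  have hz₁φ : F z₁ φ ≠ 0 := fun h => hz₁' (key z₁ hz₁ h)
  refine ⟨z₁, hz₁', le_antisymm (fun x hx => ?_) (sup_le hle.le ?_)⟩
  · have hx' : x = (x - (F x φ / F z₁ φ) • z₁) + (F x φ / F z₁ φ) • z₁ := by abel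
    rw [hx']
    refine Submodule.add_mem_sup (key _ (Submodule.sub_mem _ hx (Submodule.smul_mem _ _ hz₁)) ?_)
      (Submodule.smul_mem _ _ (Submodule.mem_span_singleton_self _))
    simp [hz₁φ]
  · rw [Submodule.span_singleton_le_iff_mem]
    exact hz₁

/-- A vector dual to the first of the elements `g_j` and orthogonal to all the others. -/
theorem PencilBasis.exists_dual [CharZero K] {L : Triple.Letter} {s p : ℕ}
    (hFs : ∀ x y, F x y = F y x) (X : PencilBasis F G Z U z L s p)
    {φ : V} (hφg : F φ (X.g 0) ≠ 0) :
    ∃ (a : K) (v : V), a ≠ 0 ∧ v ∈ U ∧ F (a • φ - v) (X.g 0) = 1 ∧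
      (∀ k, F (a • φ - v) (X.e k) = 0) ∧ (∀ j < s, F (a • φ - v) (X.g (j + 1)) = 0) ∧
      (∀ i < numFOf L s, F (a • φ - v) (X.f i) = 0) ∧ F (a • φ - v) (a • φ - v) = 0 := by
  have hsN : ∀ {i}, i < s → i < numFOf L s := by
    intro i hi
    cases L <;> simp only [numFOf] <;> omega
  have hg : ∀ j ≤ s, X.g j ∈ U := fun j hj => upOn_le_self j (X.g_mem j hj).1
  have hf : ∀ i < numFOf L s, X.f i ∈ U := fun j hj => upOn_le_self j (X.f_mem j hj)
  have he : ∀ k, X.e k ∈ U := fun k => upOn_le_self _ (X.e_mem k)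
  obtain ⟨v₁, hv₁, hv₁g0, hv₁e, hv₁g, hv₁f⟩ : ∃ v ∈ U, F v (X.g 0) = 0 ∧
      (∀ k, F v (X.e k) = F φ (X.e k)) ∧ (∀ j < s, F v (X.g (j + 1)) = F φ (X.g (j + 1))) ∧
      ∀ i < numFOf L s, F v (X.f i) = F φ (X.f i) := by
    -- `F` pairs each `e k` with itself, `f j` with `g (j + 1)` and, for the letter `C` (the case `s
    -- < numFOf L s`), `f s` with itself. The vector is the projection of `φ` written in this dual
    -- system.
    refine ⟨∑ k, F φ (X.e k) • X.e k + ∑ j ∈ Finset.range s, F φ (X.g (j + 1)) • X.f j +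
      ∑ i ∈ Finset.range s, F φ (X.f i) • X.g (i + 1) +
      (if s < numFOf L s then F φ (X.f s) • X.f s else 0), ?_, ?_⟩
    · refine U.add_mem (U.add_mem (U.add_mem ?_ ?_) ?_) ?_
      · exact U.sum_mem fun k _ => U.smul_mem _ (he k)
      · exact U.sum_mem fun j hj => U.smul_mem _ (hf j (hsN (Finset.mem_range.1 hj)))
      · exact U.sum_mem fun i hi => U.smul_mem _ (hg (i + 1) (Finset.mem_range.1 hi))
      · split_ifs with h
        · exact U.smul_mem _ (hf s h)
        · exact U.zero_mem
    set v := ∑ k, F φ (X.e k) • X.e k + ∑ j ∈ Finset.range s, F φ (X.g (j + 1)) • X.f j +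
      ∑ i ∈ Finset.range s, F φ (X.f i) • X.g (i + 1) +
      (if s < numFOf L s then F φ (X.f s) • X.f s else 0) with hvdef
    have hv : ∀ x, F v x = ∑ k, F φ (X.e k) * F (X.e k) x +
        ∑ j ∈ Finset.range s, F φ (X.g (j + 1)) * F (X.f j) x +
        ∑ i ∈ Finset.range s, F φ (X.f i) * F (X.g (i + 1)) x +
        (if s < numFOf L s then F φ (X.f s) * F (X.f s) x else 0) := by
      intro x
      rw [hvdef]
      split_ifs <;> simp [map_add, map_sum]
    have z1 : ∀ x, (∀ k, F (X.e k) x = 0) → ∑ k, F φ (X.e k) * F (X.e k) x = 0 := fun x hx =>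
      Finset.sum_eq_zero fun k _ => by rw [hx, mul_zero]
    have z2 : ∀ x, (∀ j < s, F (X.f j) x = 0) →
        ∑ j ∈ Finset.range s, F φ (X.g (j + 1)) * F (X.f j) x = 0 := fun x hx =>
      Finset.sum_eq_zero fun k hk => by rw [hx k (Finset.mem_range.1 hk), mul_zero]
    have z3 : ∀ x, (∀ j < s, F (X.g (j + 1)) x = 0) →
        ∑ i ∈ Finset.range s, F φ (X.f i) * F (X.g (i + 1)) x = 0 := fun x hx =>
      Finset.sum_eq_zero fun k hk => by rw [hx k (Finset.mem_range.1 hk), mul_zero]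
    have z4 : ∀ x, (s < numFOf L s → F (X.f s) x = 0) →
        (if s < numFOf L s then F φ (X.f s) * F (X.f s) x else 0) = 0 := fun x hx => by
      split_ifs with h
      · rw [hx h, mul_zero]
      · rfl
    refine ⟨?_, fun k => ?_, fun j hj => ?_, fun i hi => ?_⟩
    · rw [hv, z1 _ fun k => by rw [hFs]; exact X.F_g_e 0 (Nat.zero_le _) k,
        z2 _ fun j hj => by rw [X.F_f_g j (hsN hj) 0 (Nat.zero_le _), if_neg (by omega)],
        z3 _ fun j hj => X.F_g_g _ hj _ (Nat.zero_le _),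
        z4 _ fun h => by rw [X.F_f_g s h 0 (Nat.zero_le _), if_neg (by omega)]]
      simp
    · rw [hv, z2 _ fun j hj => X.F_f_e j (hsN hj) k, z3 _ fun j hj => X.F_g_e _ hj k,
        z4 _ fun h => X.F_f_e s h k]
      simp [X.F_e_e]
    · rw [hv, z1 _ fun k => by rw [hFs]; exact X.F_g_e (j + 1) hj k,
        z3 _ fun i hi => X.F_g_g _ hi _ hj,
        z4 _ fun h => by rw [X.F_f_g s h (j + 1) hj, if_neg (by omega)],
        Finset.sum_eq_single_of_mem j (Finset.mem_range.2 hj) fun i hi hij => by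
          rw [X.F_f_g i (hsN (Finset.mem_range.1 hi)) (j + 1) hj, if_neg (by omega), mul_zero],
        X.F_f_g j (hsN hj) (j + 1) hj]
      simp
    · rw [hv, z1 _ fun k => by rw [hFs]; exact X.F_f_e i hi k,
        z2 _ fun j hj => by rw [X.F_f_f j (hsN hj) i hi, if_neg (by omega)]]
      have h3 : ∀ j < s, F (X.g (j + 1)) (X.f i) = if j = i then 1 else 0 := fun j hj => by
        rw [hFs, X.F_f_g i hi (j + 1) hj]
        simp only [Nat.add_right_cancel_iff]
      by_cases his : i < s
      · rw [z4 _ fun h => by rw [X.F_f_f s h i hi, if_neg (by omega)],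
          Finset.sum_eq_single_of_mem i (Finset.mem_range.2 his) fun j hj hij => by
            rw [h3 j (Finset.mem_range.1 hj), if_neg hij, mul_zero], h3 i his]
        simp
      · have his' : i = s := by
          cases L <;> simp only [numFOf] at hi <;> omega
        subst his'
        rw [z3 _ fun j hj => by rw [h3 j hj, if_neg (by omega)], if_pos hi, X.F_f_f i hi i hi]
        simp
  have hF0 : ∀ x ∈ U, F x (X.g 0) = 0 := fun x hx =>
    radOn_sub_mem hFs (X.g_mem 0 (Nat.zero_le _)) hx
  set a := (F φ (X.g 0))⁻¹ with ha
  obtain ⟨φ₁, hφ₁⟩ : ∃ φ₁, φ₁ = a • (φ - v₁) := ⟨_, rfl⟩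
  have hφ₁g0 : F φ₁ (X.g 0) = 1 := by
    simp [hφ₁, hv₁g0, ha, hφg]
  have hφ₂ : ∀ x ∈ U, F (a • φ - (a • v₁ + (1 / 2 * F φ₁ φ₁) • X.g 0)) x = F φ₁ x := by
    intro x hx
    have h1 : a • φ - (a • v₁ + (1 / 2 * F φ₁ φ₁) • X.g 0) =
      φ₁ - (1 / 2 * F φ₁ φ₁) • X.g 0 := by rw [hφ₁, smul_sub]; abel
    rw [h1, map_sub, map_smul, LinearMap.sub_apply, LinearMap.smul_apply,
      (X.g_mem 0 (Nat.zero_le _)).2 x hx, smul_zero, sub_zero]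
  -- The multiple of `X.g 0` makes the vector isotropic; its products with `U` do not change,
  -- because `X.g 0` lies in the `F`-radical of `U`.
  refine ⟨a, a • v₁ + (1 / 2 * F φ₁ φ₁) • X.g 0, inv_ne_zero hφg, U.add_mem (U.smul_mem _ hv₁)
    (U.smul_mem _ (hg 0 (Nat.zero_le _))), ?_, fun k => ?_, fun j hj => ?_, fun i hi => ?_, ?_⟩
  · rw [hφ₂ _ (hg 0 (Nat.zero_le _)), hφ₁g0]
  · rw [hφ₂ _ (he k)]
    simp [hφ₁, hv₁e]
  · rw [hφ₂ _ (hg _ hj)]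
    simp [hφ₁, hv₁g j hj]
  · rw [hφ₂ _ (hf i hi)]
    simp [hφ₁, hv₁f i hi]
  · have h1 : a • φ - (a • v₁ + (1 / 2 * F φ₁ φ₁) • X.g 0) =
      φ₁ - (1 / 2 * F φ₁ φ₁) • X.g 0 := by rw [hφ₁, smul_sub]; abel
    rw [h1]
    have h2 : F (X.g 0) (X.g 0) = 0 := hF0 _ (hg 0 (Nat.zero_le _))
    have h3 : F (X.g 0) φ₁ = 1 := by rw [hFs, hφ₁g0]
    simp only [map_sub, map_smul, LinearMap.sub_apply, LinearMap.smul_apply, h2, h3, hφ₁g0,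
      smul_eq_mul]
    ring

theorem span_image_Iic_le {S : Submodule K V} {g : ℕ → V} {s : ℕ} (h : ∀ j ≤ s, g j ∈ S) :
    Submodule.span K (g '' Set.Iic s) ≤ S := by
  rw [Submodule.span_le]
  rintro _ ⟨j, hj, rfl⟩
  exact h j hj

theorem span_image_Iio_le {S : Submodule K V} {g : ℕ → V} {s : ℕ} (h : ∀ j < s, g j ∈ S) :
    Submodule.span K (g '' Set.Iio s) ≤ S := by
  rw [Submodule.span_le]
  rintro _ ⟨j, hj, rfl⟩
  exact h j hj

theorem span_range_le {S : Submodule K V} {ι : Type*} {e : ι → V} (h : ∀ k, e k ∈ S) :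
    Submodule.span K (Set.range e) ≤ S := by
  rw [Submodule.span_le]
  rintro _ ⟨k, rfl⟩
  exact h k

theorem numFOf_succ (L : Triple.Letter) (s : ℕ) : numFOf L (s + 1) = numFOf L s + 1 := by
  cases L <;> rfl

/-- Extending a normal form by one step of the chain. -/
theorem PencilBasis.extend [CharZero K] {L : Triple.Letter} {s p : ℕ} {z₁ : V}
    (hFs : ∀ x y, F x y = F y x) (hGs : ∀ x y, G x y = G y x)
    (hG : ∀ x ∈ Z, ∀ y ∈ U, G x y = 0)
    (hrad : radOn F U = Z ⊔ Submodule.span K {z})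
    (hle : radOn F U ≤ radOn F (nextOn F G U)) (hz₁ : z₁ ∉ radOn F U) {φ₀ : V} (hφ₀ : φ₀ ∈ U)
    (hφ₀z : G φ₀ z ≠ 0)
    (X : PencilBasis F G (radOn F U) (nextOn F G U) z₁ L s p) :
    Nonempty (PencilBasis F G Z U z L (s + 1) p) := by
  have hz : z ∈ radOn F U := hrad ▸ Submodule.mem_sup_right (Submodule.mem_span_singleton_self z)
  have hmem : ∀ {x}, x ∈ nextOn F G U ↔ x ∈ U ∧ G x z = 0 := mem_nextOn_iff hGs hG hrad
  have hz1 : z ∈ nextOn F G U := (hle hz).1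
  have hGz : ∀ x ∈ nextOn F G U, G x z = 0 := fun x hx => (hmem.1 hx).2
  have hg1 : ∀ j ≤ s, X.g j ∈ nextOn F G U := fun j hj => upOn_le_self j (X.g_mem j hj).1
  have hf1 : ∀ i < numFOf L s, X.f i ∈ nextOn F G U := fun j hj => upOn_le_self j (X.f_mem j hj)
  have he1 : ∀ k, X.e k ∈ nextOn F G U := fun k => upOn_le_self _ (X.e_mem k)
  -- Otherwise `X.g 0`, already `F`-orthogonal to the hyperplane, would lie in the radical of `U`,
  -- and so would `z₁`.
  have hφg : F φ₀ (X.g 0) ≠ 0 := by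
    intro h
    obtain ⟨c, hc, hgc⟩ := X.g_zero
    have hr := X.g_mem 0 (Nat.zero_le _)
    have : X.g 0 ∈ radOn F U := by
      refine ⟨nextOn_le hr.1, fun y hy => ?_⟩
      obtain ⟨a, ha, b, hb, rfl⟩ := Submodule.mem_sup.1 (le_nextOn_sup hGs hG hrad hφ₀ hφ₀z hy)
      obtain ⟨t, rfl⟩ := Submodule.mem_span_singleton.1 hb
      rw [map_add, hr.2 a ha, map_smul, hFs, h, smul_zero, zero_add]
    rw [hgc] at this
    exact hz₁ ((Submodule.smul_mem_iff _ hc).1 this)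
  obtain ⟨a, v, ha, hv, q1, q2, q3, q4, q5⟩ := X.exists_dual hFs hφg
  obtain ⟨φ, hφ', hφU, hφz⟩ : ∃ φ, a • φ₀ - v = φ ∧ φ ∈ U ∧ G φ z ≠ 0 := by
    refine ⟨_, rfl, U.sub_mem (U.smul_mem _ hφ₀) (nextOn_le hv), ?_⟩
    simp [hGz v hv, ha, hφ₀z]
  rw [hφ'] at q1 q2 q3 q4 q5
  have hφs := le_nextOn_sup hGs hG hrad hφU hφz
  set g₀ := (G φ z)⁻¹ • z with hg₀
  have hg₀r : g₀ ∈ radOn F U := Submodule.smul_mem _ _ hz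
  have hg₀1 : g₀ ∈ nextOn F G U := Submodule.smul_mem _ _ hz1
  have hFg : ∀ x ∈ U, F g₀ x = 0 := hg₀r.2
  have hFg' : ∀ x ∈ U, F x g₀ = 0 := fun x hx => radOn_sub_mem hFs hg₀r hx
  have hGg' : ∀ x ∈ nextOn F G U, G x g₀ = 0 := fun x hx => by
    rw [hg₀, map_smul, hGz x hx, smul_zero]
  have hGg : ∀ x ∈ nextOn F G U, G g₀ x = 0 := fun x hx => by rw [hGs, hGg' x hx]
  have hGφ : G φ g₀ = 1 := by rw [hg₀, map_smul, smul_eq_mul, inv_mul_cancel₀ hφz]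
  have hGφ' : G g₀ φ = 1 := by rw [hGs, hGφ]
  have hup : ∀ j, g₀ ∈ radOn F (upOn F G (nextOn F G U) j) := fun j =>
    le_radOn_upOn (fun x hx => (hle hx).1) (fun x hx y hy => hx.2 y (nextOn_le hy))
      (fun x hx y hy => by rw [hGs]; exact hy.2 x hx) j hg₀r
  -- The shift kills `G` against `φ`. It preserves both forms on `nextOn F G U`, because `g₀` is in
  -- the `F`-radical of `U` and is `G`-orthogonal to `nextOn F G U`.
  let t : V → V := fun x => x - G φ x • g₀
  have ht : ∀ x, t x = x - G φ x • g₀ := fun _ => rfl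
  have htF : ∀ x ∈ nextOn F G U, ∀ y ∈ nextOn F G U, F (t x) (t y) = F x y := by
    intro x hx y hy
    simp [ht, hFg _ hg₀r.1, hFg _ hy.1, hFg' _ hx.1]
  have htG : ∀ x ∈ nextOn F G U, ∀ y ∈ nextOn F G U, G (t x) (t y) = G x y := by
    intro x hx y hy
    simp [ht, hGg _ hg₀1, hGg _ hy, hGg' _ hx]
  have htg : ∀ x ∈ nextOn F G U, t x ∈ nextOn F G U := fun x hx =>
    Submodule.sub_mem _ hx (Submodule.smul_mem _ _ hg₀1)
  have htφF : ∀ x ∈ U, F (φ - (1 / 2 * G φ φ) • g₀) (t x) = F φ x := by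
    intro x hx
    simp [ht, hFg _ hg₀r.1, hFg _ hx, hFg' _ hφU]
  have htφG : ∀ x ∈ nextOn F G U, G (φ - (1 / 2 * G φ φ) • g₀) (t x) = 0 := by
    intro x hx
    simp [ht, hGg _ hg₀1, hGg _ hx, hGφ]
  have htmem : ∀ {S : Submodule K V} {x}, g₀ ∈ S → (t x ∈ S ↔ x ∈ S) := by
    intro S x hS
    exact S.sub_mem_iff_left (S.smul_mem _ hS)
  let g' : ℕ → V := fun j => Nat.casesOn j g₀ fun j => t (X.g j)
  let f' : ℕ → V := fun j => Nat.casesOn j (φ - (1 / 2 * G φ φ) • g₀) fun j => t (X.f j)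
  have hg'0 : g' 0 = g₀ := rfl
  have hg'1 : ∀ j, g' (j + 1) = t (X.g j) := fun _ => rfl
  have hf'0 : f' 0 = φ - (1 / 2 * G φ φ) • g₀ := rfl
  have hf'1 : ∀ j, f' (j + 1) = t (X.f j) := fun _ => rfl
  refine ⟨{
    g := g'
    f := f'
    e := fun k => t (X.e k)
    g_zero := ⟨(G φ z)⁻¹, inv_ne_zero hφz, rfl⟩
    g_mem := ?_
    g_notMem := ?_
    f_mem := ?_
    f_notMem := ?_
    e_mem := ?_
    up_le := ?_
    le_span := ?_
    F_e_e := fun k l => by rw [htF _ (he1 k) _ (he1 l), X.F_e_e]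
    F_f_e := ?_
    G_f_e := ?_
    F_g_e := ?_
    G_g_e := ?_
    F_g_g := ?_
    G_g_g := ?_
    F_f_g := ?_
    G_f_g := ?_
    F_f_f := ?_
    G_f_f := ?_ }⟩
  · rintro (_ | j) hj
    · exact hg₀r
    · rw [hg'1, upOn_succ, htmem (hup j)]
      exact X.g_mem j (by omega)
  · rintro (_ | j) hj
    · rw [hg'1, upOn_zero, htmem hg₀r]
      intro h
      obtain ⟨c, hc, hgc⟩ := X.g_zero
      rw [hgc] at h
      exact hz₁ ((Submodule.smul_mem_iff _ hc).1 h)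
    · rw [hg'1, upOn_succ, htmem (hup j)]
      exact X.g_notMem j (by omega)
  · rw [numFOf_succ]
    rintro (_ | i) hi
    · exact U.sub_mem hφU (U.smul_mem _ hg₀r.1)
    · rw [hf'1, upOn_succ, htmem (hup i).1]
      exact X.f_mem i (by omega)
  · rw [numFOf_succ]
    rintro (_ | i) hi
    · intro h
      have h' := hGz _ h
      rw [hf'0, map_sub, map_smul, LinearMap.sub_apply, LinearMap.smul_apply, hGz _ hg₀1,
        smul_zero, sub_zero] at h'
      exact hφz h'
    · rw [hf'1, upOn_succ, htmem (hup _).1]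
      exact X.f_notMem i (by omega)
  · intro k
    rw [numFOf_succ, upOn_succ, htmem (hup _).1]
    exact X.e_mem k
  · rw [numFOf_succ, upOn_succ]
    refine X.up_le.trans (sup_le le_sup_left (span_range_le fun k => ?_))
    rw [← htmem (x := X.e k) (Submodule.mem_sup_left (hup (numFOf L s)))]
    exact Submodule.mem_sup_right (Submodule.subset_span ⟨k, rfl⟩)
  · rw [numFOf_succ]
    set S := Z ⊔ Submodule.span K (g' '' Set.Iic (s + 1)) ⊔
      Submodule.span K (Set.range fun k => t (X.e k)) ⊔
      Submodule.span K (f' '' Set.Iio (numFOf L s + 1)) with hS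
    have hZS : Z ≤ S := le_sup_left.trans (le_sup_left.trans le_sup_left)
    have hgS : ∀ j ≤ s + 1, g' j ∈ S := fun j hj => Submodule.mem_sup_left
      (Submodule.mem_sup_left (Submodule.mem_sup_right (Submodule.subset_span ⟨j, hj, rfl⟩)))
    have heS : ∀ k, t (X.e k) ∈ S := fun k => Submodule.mem_sup_left
      (Submodule.mem_sup_right (Submodule.subset_span ⟨k, rfl⟩))
    have hfS : ∀ j < numFOf L s + 1, f' j ∈ S := fun j hj =>
      Submodule.mem_sup_right (Submodule.subset_span ⟨j, hj, rfl⟩)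
    have hg₀S : g₀ ∈ S := hgS 0 (Nat.zero_le _)
    have hrS : radOn F U ≤ S := by
      rw [hrad]
      refine sup_le hZS ?_
      rw [Submodule.span_singleton_le_iff_mem]
      rw [hg₀] at hg₀S
      exact (Submodule.smul_mem_iff _ (inv_ne_zero hφz)).1 hg₀S
    refine hφs.trans (sup_le (X.le_span.trans ?_) ?_)
    · refine sup_le (sup_le (sup_le hrS ?_) ?_) ?_
      · exact span_image_Iic_le fun j hj => (htmem hg₀S).1 (hgS (j + 1) (by omega))
      · exact span_range_le fun k => (htmem hg₀S).1 (heS k)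
      · exact span_image_Iio_le fun j hj => (htmem hg₀S).1 (hfS (j + 1) (by omega))
    · rw [Submodule.span_singleton_le_iff_mem]
      exact (S.sub_mem_iff_left (S.smul_mem _ hg₀S)).1 (hfS 0 (Nat.succ_pos _))
  · rw [numFOf_succ]
    rintro (_ | i) hi k
    · rw [hf'0, htφF _ (he1 k).1, q2]
    · rw [hf'1, htF _ (hf1 i (by omega)) _ (he1 k), X.F_f_e i (by omega)]
  · rw [numFOf_succ]
    rintro (_ | i) hi k
    · rw [hf'0, htφG _ (he1 k)]
    · rw [hf'1, htG _ (hf1 i (by omega)) _ (he1 k), X.G_f_e i (by omega)]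
  · rintro (_ | j) hj k
    · exact hFg _ (htg _ (he1 k)).1
    · rw [hg'1, htF _ (hg1 j (by omega)) _ (he1 k), X.F_g_e j (by omega)]
  · rintro (_ | j) hj k
    · exact hGg _ (htg _ (he1 k))
    · rw [hg'1, htG _ (hg1 j (by omega)) _ (he1 k), X.G_g_e j (by omega)]
  · have h1 : ∀ j ≤ s + 1, g' j ∈ U := by
      rintro (_ | j) hj
      · exact hg₀r.1
      · exact (htg _ (hg1 j (by omega))).1
    rintro (_ | i) hi j hj
    · exact hFg _ (h1 j hj)
    · rcases j with _ | j
      · exact hFg' _ (h1 _ hi)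
      · rw [hg'1, hg'1, htF _ (hg1 i (by omega)) _ (hg1 j (by omega)),
          X.F_g_g i (by omega) j (by omega)]
  · have h1 : ∀ j ≤ s + 1, g' j ∈ nextOn F G U := by
      rintro (_ | j) hj
      · exact hg₀1
      · exact htg _ (hg1 j (by omega))
    rintro (_ | i) hi j hj
    · rw [if_neg (by omega)]
      exact hGg _ (h1 j hj)
    · rcases j with _ | j
      · rw [if_neg (by omega)]
        exact hGg' _ (h1 _ hi)
      · rw [hg'1, hg'1, htG _ (hg1 i (by omega)) _ (hg1 j (by omega)),
          X.G_g_g i (by omega) j (by omega)]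
        congr 1
        simp
  · rw [numFOf_succ]
    rintro (_ | i) hi (_ | j) hj
    · rw [if_neg (by omega)]
      exact hFg' _ (U.sub_mem hφU (U.smul_mem _ hg₀r.1))
    · rw [hf'0, hg'1, htφF _ (hg1 j (by omega)).1]
      rcases j with _ | j
      · rw [q1, if_pos rfl]
      · rw [q3 j (by omega), if_neg (by omega)]
    · rw [if_neg (by omega)]
      exact hFg' _ (htg _ (hf1 i (by omega))).1
    · rw [hf'1, hg'1, htF _ (hf1 i (by omega)) _ (hg1 j (by omega)),
        X.F_f_g i (by omega) j (by omega)]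
      simp only [Nat.add_right_cancel_iff]
  · rw [numFOf_succ]
    rintro (_ | i) hi (_ | j) hj
    · rw [if_pos rfl, hf'0, hg'0]
      simp [hGφ, hGg _ hg₀1]
    · rw [hf'0, hg'1, htφG _ (hg1 j (by omega)), if_neg (by omega)]
    · rw [if_neg (by omega)]
      exact hGg' _ (htg _ (hf1 i (by omega)))
    · rw [hf'1, hg'1, htG _ (hf1 i (by omega)) _ (hg1 j (by omega)),
        X.G_f_g i (by omega) j (by omega)]
      simp only [Nat.add_right_cancel_iff]
  · rw [numFOf_succ]
    rintro (_ | i) hi (_ | j) hj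
    · rw [if_neg (by omega), hf'0]
      simp [q5, hFg _ hφU, hFg' _ hφU, hFg _ hg₀r.1]
    · rw [hf'0, hf'1, htφF _ (hf1 j (by omega)).1, q4 j (by omega), if_neg (by omega)]
    · rw [hf'0, hf'1, hFs, htφF _ (hf1 i (by omega)).1, q4 i (by omega), if_neg (by omega)]
    · rw [hf'1, hf'1, htF _ (hf1 i (by omega)) _ (hf1 j (by omega)),
        X.F_f_f i (by omega) j (by omega)]
      simp only [Nat.add_right_cancel_iff]
  · rw [numFOf_succ]
    rintro (_ | i) hi (_ | j) hj
    · rw [hf'0]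
      simp [hGφ, hGφ', hGg _ hg₀1]
      ring
    · rw [hf'0, hf'1, htφG _ (hf1 j (by omega))]
    · rw [hf'0, hf'1, hGs, htφG _ (hf1 i (by omega))]
    · rw [hf'1, hf'1, htG _ (hf1 i (by omega)) _ (hf1 j (by omega)),
        X.G_f_f i (by omega) j (by omega)]

/-- Every pair of symmetric forms whose first member has a one-dimensional kernel modulo a common
kernel has a normal form. -/
theorem exists_pencilBasis [IsAlgClosed K] [CharZero K] [FiniteDimensional K V]
    (hFs : ∀ x y, F x y = F y x) (hGs : ∀ x y, G x y = G y x) (L : Triple.Letter) (s : ℕ) :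
    ∀ (Z U : Submodule K V) (z : V), Z ≤ U → (∀ x ∈ Z, ∀ y ∈ U, F x y = 0) →
      (∀ x ∈ Z, ∀ y ∈ U, G x y = 0) → radOn F U = Z ⊔ Submodule.span K {z} →
      (∀ k < s, ¬ StopsOn F G (upOn F G U k)) → LetterOn F G (upOn F G U s) L →
      ∃ p, Nonempty (PencilBasis F G Z U z L s p) := by
  induction s with
  | zero =>
    intro Z U z hZ hF hG hrad _ hL
    cases L with
    | A => exact pencilBasis_A hFs hGs hrad hL
    | B => exact pencilBasis_B hFs hGs hZ hF hG hrad hL.2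
    | C => exact pencilBasis_C hFs hGs hG hrad hL.1 hL.2
  | succ s ih =>
    intro Z U z hZ hF hG hrad hns hL
    have h0 := hns 0 (Nat.succ_pos s)
    rw [upOn_zero, StopsOn] at h0
    push Not at h0
    obtain ⟨h1, h2, h3⟩ := h0
    obtain ⟨φ, hφ, hφz⟩ := exists_apply_ne_zero hGs hG hrad h1
    obtain ⟨z₁, hz₁, hrad₁⟩ := radOn_nextOn_eq (lt_of_le_of_ne h2 h3)
      (le_nextOn_sup hGs hG hrad hφ hφz)
    -- The old radical becomes the common kernel of the next stage, and `z₁` spans the new radical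
    -- modulo it.
    obtain ⟨p, ⟨X⟩⟩ := ih (radOn F U) (nextOn F G U) z₁ (fun x hx => (h2 hx).1)
      (fun x hx y hy => hx.2 y (nextOn_le hy)) (fun x hx y hy => by rw [hGs]; exact hy.2 x hx)
      hrad₁ (fun k hk => hns (k + 1) (by omega)) hL
    exact ⟨p, X.extend hFs hGs hG hrad h2 hz₁ hφ hφz⟩

end Pencil

end AdditiveQuadric

namespace AdditiveQuadric

/-! ### Distinguished elements of a triple of corank two -/

section Structure

variable {K R : Type*} [Field K] [CommRing R] [IsLocalRing R] [Algebra K R]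

theorem finrank_le_inf_ker [FiniteDimensional K R] (U : Submodule K R) (f : R →ₗ[K] K) :
    finrank K U ≤ finrank K (U ⊓ LinearMap.ker f : Submodule K R) + 1 := by
  have h1 := LinearMap.finrank_range_add_finrank_ker (f.domRestrict U)
  have h2 : finrank K (LinearMap.range (f.domRestrict U)) ≤ 1 :=
    (Submodule.finrank_le _).trans (by simp)
  have h3 : finrank K (LinearMap.ker (f.domRestrict U)) =
      finrank K (U ⊓ LinearMap.ker f : Submodule K R) := by
    have : (U ⊓ LinearMap.ker f : Submodule K R) =
        (LinearMap.ker (f.domRestrict U)).map U.subtype := by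
      ext x
      simp only [Submodule.mem_inf, Submodule.mem_map, LinearMap.mem_ker, Subtype.exists,
        LinearMap.domRestrict_apply, Submodule.subtype_apply]
      constructor
      · rintro ⟨h, h'⟩
        exact ⟨x, h, h', rfl⟩
      · rintro ⟨y, hy, h, rfl⟩
        exact ⟨hy, h⟩
    rw [this, Submodule.finrank_map_subtype_eq]
  omega

theorem mem_maxSubspace {x : R} : x ∈ maxSubspace K R ↔ x ∈ IsLocalRing.maximalIdeal R := Iff.rfl

theorem mul_mem_maxSubspace {x : R} (y : R) (hx : x ∈ maxSubspace K R) :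
    x * y ∈ maxSubspace K R := Ideal.mul_mem_right y (IsLocalRing.maximalIdeal R) hx

theorem maxSq_le : maxSq K R ≤ maxSubspace K R := fun _ hx => Ideal.pow_le_self two_ne_zero hx

theorem mul_mem_maxSq {x y : R} (hx : x ∈ maxSubspace K R) (hy : y ∈ maxSubspace K R) :
    x * y ∈ maxSq K R := by
  change x * y ∈ IsLocalRing.maximalIdeal R ^ 2
  rw [pow_two]
  exact Ideal.mul_mem_mul hx hy

/-- The residue field is a finite extension of `K`, hence equal to `K`. -/
theorem exists_sub_smul_one_mem [IsAlgClosed K] [FiniteDimensional K R] (r : R) :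
    ∃ c : K, r - c • (1 : R) ∈ maxSubspace K R := by
  have : Function.Bijective (algebraMap K (IsLocalRing.ResidueField R)) :=
    IsAlgClosed.algebraMap_bijective_of_isIntegral
  obtain ⟨c, hc⟩ := this.2 (IsLocalRing.residue R r)
  refine ⟨c, ?_⟩
  rw [mem_maxSubspace, ← IsLocalRing.residue_eq_zero_iff, map_sub, ← hc,
    ← Algebra.algebraMap_eq_smul_one, sub_eq_zero]
  rfl

/-- A nonunit of a local algebra has no nonzero eigenvalue. -/
theorem eq_zero_of_mul_eq_smul {x z : R} {c : K} (hx : x ∈ maxSubspace K R) (hz : z ≠ 0)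
    (h : x * z = c • z) : c = 0 := by
  by_contra hc
  have hu : IsUnit (algebraMap K R c - x) := by
    have hc1 : IsUnit (algebraMap K R c) := (IsUnit.mk0 _ hc).map _
    by_contra hn
    have h3 := (IsLocalRing.mem_maximalIdeal _).2 hn
    have h4 := Ideal.add_mem _ h3 hx
    rw [sub_add_cancel] at h4
    exact (IsLocalRing.mem_maximalIdeal _).1 h4 hc1
  apply hz
  have : (algebraMap K R c - x) * z = 0 := by
    rw [sub_mul, h, ← Algebra.smul_def, sub_self]
  exact hu.mul_right_eq_zero.1 this

namespace Triple

variable (T : Triple K R)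

/-- Reduces the form to the functional `F 1`, with which most later identities are proved. -/
theorem F_eq {a : R} (ha : a ∈ T.W) (x : R) : T.F a x = -T.F 1 (a * x) := by
  have := T.F_invariant a ha 1 x
  rw [mul_one] at this
  exact eq_neg_of_add_eq_zero_left this

theorem F_one_W [CharZero K] {a : R} (ha : a ∈ T.W) : T.F 1 a = 0 := by
  have := T.F_eq ha 1
  rw [mul_one, T.F_symm a 1] at this
  have h2 : (2 : K) * T.F 1 a = 0 := by linear_combination this
  simpa using h2

/-- Both terms of `F (a b) c + F b (a c) = 0` equal `-F 1 (a b c)`, and 2 is invertible. -/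
theorem F_one_mul_mul [CharZero K] {a b c : R} (ha : a ∈ T.W) (hb : b ∈ T.W) (hc : c ∈ T.W) :
    T.F 1 (a * b * c) = 0 := by
  have h1 := T.F_invariant a ha b c
  have h2 := T.F_eq hb (a * c)
  have h3 := T.F_eq hc (a * b)
  rw [T.F_symm c] at h3
  rw [show b * (a * c) = a * b * c by ring] at h2
  rw [show c * (a * b) = a * b * c by ring] at h3
  have : (2 : K) * T.F 1 (a * b * c) = 0 := by linear_combination h2 + h3 - h1
  simpa using this

theorem exists_decomp (r : R) :
    ∃ c : K, ∃ w ∈ T.W, ∃ y ∈ maxSq K R, r = algebraMap K R c + w + y := by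
  have hr : r ∈ Algebra.adjoin K (T.W : Set R) := by rw [T.W_generates]; trivial
  induction hr using Algebra.adjoin_induction with
  | mem x hx => exact ⟨0, x, hx, 0, zero_mem _, by simp⟩
  | algebraMap c => exact ⟨c, 0, zero_mem _, 0, zero_mem _, by simp⟩
  | add x y _ _ hx hy =>
    obtain ⟨c, w, hw, u, hu, rfl⟩ := hx
    obtain ⟨c', w', hw', u', hu', rfl⟩ := hy
    exact ⟨c + c', w + w', add_mem hw hw', u + u', add_mem hu hu', by rw [map_add]; ring⟩
  | mul x y _ _ hx hy =>
    obtain ⟨c, w, hw, u, hu, rfl⟩ := hx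
    obtain ⟨c', w', hw', u', hu', rfl⟩ := hy
    refine ⟨c * c', c • w' + c' • w, add_mem (T.W.smul_mem _ hw') (T.W.smul_mem _ hw),
      c • u' + c' • u + (w + u) * (w' + u'), add_mem (add_mem (Submodule.smul_mem _ _ hu')
        (Submodule.smul_mem _ _ hu)) (mul_mem_maxSq (add_mem (T.W_le hw) (maxSq_le hu))
          (add_mem (T.W_le hw') (maxSq_le hu'))), ?_⟩
    simp only [Algebra.smul_def, map_mul]
    ring

theorem algebraMap_mem_max {c : K} (h : algebraMap K R c ∈ maxSubspace K R) : c = 0 := by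
  by_contra hc
  exact (IsLocalRing.mem_maximalIdeal _).1 h ((IsUnit.mk0 _ hc).map (algebraMap K R))

theorem max_le : maxSubspace K R ≤ T.W ⊔ maxSq K R := by
  intro r hr
  obtain ⟨c, w, hw, u, hu, rfl⟩ := T.exists_decomp r
  have : algebraMap K R c ∈ maxSubspace K R := by
    have := sub_mem (sub_mem hr (maxSq_le hu)) (T.W_le hw)
    rwa [add_sub_cancel_right, add_sub_cancel_right] at this
  rw [algebraMap_mem_max this, map_zero, zero_add]
  exact Submodule.add_mem_sup hw hu

theorem exists_maxSq_notMem : ∃ b ∈ maxSq K R, b ∉ T.W := by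
  by_contra! h
  have h1 : maxSubspace K R ≤ T.W := T.max_le.trans (sup_le le_rfl h)
  have h2 := T.W_hyperplane
  rw [le_antisymm h1 T.W_le] at h2
  omega

theorem exists_sub_smul_mem [FiniteDimensional K R] {b : R} (hb : b ∈ maxSubspace K R)
    (hbW : b ∉ T.W) {x : R} (hx : x ∈ maxSubspace K R) : ∃ t : K, x - t • b ∈ T.W := by
  have h1 : T.W ⊔ Submodule.span K {b} = maxSubspace K R := by
    have hle : T.W ⊔ Submodule.span K {b} ≤ maxSubspace K R :=
      sup_le T.W_le ((Submodule.span_singleton_le_iff_mem _ _).2 hb)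
    refine Submodule.eq_of_le_of_finrank_le hle ?_
    rw [← T.W_hyperplane]
    refine Submodule.finrank_lt_finrank_of_lt (lt_of_le_of_ne le_sup_left fun h => hbW ?_)
    rw [h]
    exact Submodule.mem_sup_right (Submodule.mem_span_singleton_self b)
  rw [← h1] at hx
  obtain ⟨w, hw, y, hy, rfl⟩ := Submodule.mem_sup.1 hx
  obtain ⟨t, rfl⟩ := Submodule.mem_span_singleton.1 hy
  exact ⟨t, by rwa [add_sub_cancel_right]⟩

/-- By invariance the kernel is stable under `W`, which generates `R`; so it is an ideal. -/
theorem mul_mem_ker (x : R) {r : R} (hr : r ∈ LinearMap.ker T.F) : x * r ∈ LinearMap.ker T.F := by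
  have hx : x ∈ Algebra.adjoin K (T.W : Set R) := by rw [T.W_generates]; trivial
  induction hx using Algebra.adjoin_induction generalizing r with
  | mem a ha =>
    rw [LinearMap.mem_ker] at hr ⊢
    ext c
    have := T.F_invariant a ha r c
    rw [hr] at this
    simpa using this
  | algebraMap c =>
    rw [← Algebra.smul_def]
    exact Submodule.smul_mem _ _ hr
  | add x y _ _ hx hy =>
    rw [add_mul]
    exact add_mem (hx hr) (hy hr)
  | mul x y _ _ hx hy =>
    rw [mul_assoc]
    exact hx (hy hr)

theorem one_notMem_ker : (1 : R) ∉ LinearMap.ker T.F := by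
  intro h
  obtain ⟨a, _, b, _, hab⟩ := T.F_ne_zero
  have := T.mul_mem_ker a h
  rw [mul_one, LinearMap.mem_ker] at this
  rw [this] at hab
  exact hab rfl

theorem F_one_of_mem_ker {r : R} (hr : r ∈ LinearMap.ker T.F) : T.F 1 r = 0 := by
  rw [T.F_symm, LinearMap.mem_ker.1 hr, LinearMap.zero_apply]

variable [CharZero K] [FiniteDimensional K R]

/-- Singular points are represented by vectors of `Ker F`, and a point is fixed when `W` annihilates
its representative. -/
theorem exists_mul_ne_zero (h : ¬ T.sing ⊆ T.fix) :
    ∃ w ∈ T.W, ∃ z ∈ LinearMap.ker T.F, w * z ≠ 0 := by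
  rw [Set.not_subset] at h
  obtain ⟨p, hp, hpf⟩ := h
  have hz : p.rep ∈ LinearMap.ker T.F := by
    rw [LinearMap.mem_ker]
    ext r
    simpa using hp.2 r
  by_contra! hcon
  exact hpf ⟨hp.1, fun w => (T.act_eq_iff w p).2 (hcon w w.2 _ hz)⟩

variable [IsAlgClosed K]

/-- `R` is spanned by `1`, `b` and `W`, and `F 1` kills `1` and `W`. If it also killed `b`, then `1`
would lie in the proper ideal `Ker F`. -/
theorem F_one_ne_zero {b : R} (hb : b ∈ maxSubspace K R) (hbW : b ∉ T.W) : T.F 1 b ≠ 0 := by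
  intro h
  apply T.one_notMem_ker
  rw [LinearMap.mem_ker]
  ext x
  obtain ⟨c, hc⟩ := exists_sub_smul_one_mem (K := K) x
  obtain ⟨t, ht⟩ := T.exists_sub_smul_mem hb hbW hc
  have : x = c • (1 : R) + t • b + (x - c • (1 : R) - t • b) := by abel
  rw [this, map_add, T.F_one_W ht, map_add, map_smul, map_smul, T.F_one_one, h]
  simp

/-- As a proper ideal the kernel lies in the maximal ideal, inside which `W` is the zero set of the
functional `F 1`. -/
theorem ker_le_W : LinearMap.ker T.F ≤ T.W := by
  intro r hr
  have hrm : r ∈ maxSubspace K R := by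
    by_contra h
    have hu : IsUnit r := by
      by_contra h'
      exact h ((IsLocalRing.mem_maximalIdeal _).2 h')
    obtain ⟨u, rfl⟩ := hu
    apply T.one_notMem_ker
    have := T.mul_mem_ker (↑u⁻¹ : R) hr
    rwa [Units.inv_mul] at this
  obtain ⟨b, hb, hbW⟩ := T.exists_maxSq_notMem
  obtain ⟨t, ht⟩ := T.exists_sub_smul_mem (maxSq_le hb) hbW hrm
  have h1 := T.F_one_W ht
  rw [map_sub, T.F_one_of_mem_ker hr, map_smul, zero_sub, neg_eq_zero, smul_eq_mul, mul_eq_zero,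
    or_iff_left (T.F_one_ne_zero (maxSq_le hb) hbW)] at h1
  rwa [h1, zero_smul, sub_zero] at ht

/-- Distinguished elements of a triple of corank two: `μ₁, μ₂` span the kernel of the form, and
`b₀` is a socle element outside `W`. -/
structure Frame where
  μ₁ : R
  μ₂ : R
  b₀ : R
  w : R
  w_mem : w ∈ T.W
  ker_eq : LinearMap.ker T.F = Submodule.span K {μ₁, μ₂}
  w_mul : w * μ₂ = μ₁
  μ₁_ne : μ₁ ≠ 0
  max_mul_μ₂ : ∀ x ∈ maxSubspace K R, ∃ c : K, x * μ₂ = c • μ₁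
  μ₁_mul : ∀ x ∈ maxSubspace K R, μ₁ * x = 0
  b₀_mem : b₀ ∈ maxSq K R
  F_one_b₀ : T.F 1 b₀ = -1
  b₀_mul : ∀ x ∈ maxSubspace K R, b₀ * x = 0
  W_mul_W : ∀ a ∈ T.W, ∀ b ∈ T.W, a * b - T.F a b • b₀ ∈ LinearMap.ker T.F

/-- Take `r` outside `Ker F` in the last power of the maximal ideal not contained in `Ker F`: its
products with the maximal ideal lie in the next power. If `r` were in `W`, then `F r x = -F 1 (r x)`
would vanish for all `x`. -/
theorem exists_mem_socle_mod_ker : ∃ r ∈ maxSubspace K R, r ∉ T.W ∧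
    ∀ x ∈ maxSubspace K R, x * r ∈ LinearMap.ker T.F := by
  classical
  obtain ⟨n, hn⟩ : IsNilpotent (IsLocalRing.maximalIdeal R) := by
    have : IsArtinianRing R := IsArtinianRing.of_finite K R
    have h := IsArtinianRing.isNilpotent_jacobson_bot (R := R)
    rwa [IsLocalRing.jacobson_eq_maximalIdeal ⊥ bot_ne_top] at h
  have hex : ∃ n, ∀ r ∈ IsLocalRing.maximalIdeal R ^ n, r ∈ LinearMap.ker T.F :=
    ⟨n, fun r hr => by rw [hn] at hr; rw [(Submodule.mem_bot R).1 hr]; exact zero_mem _⟩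
  obtain ⟨b, hb, hbW⟩ := T.exists_maxSq_notMem
  have h2 : 2 < Nat.find hex := by
    rw [Nat.lt_find_iff]
    intro m hm h
    exact hbW (T.ker_le_W (h b (Ideal.pow_le_pow_right hm hb)))
  obtain ⟨m, hm⟩ : ∃ m, Nat.find hex = m + 1 := ⟨Nat.find hex - 1, by omega⟩
  have h3 := Nat.find_min hex (m := m) (by omega)
  push Not at h3
  obtain ⟨r, hr, hrk⟩ := h3
  have hrm : r ∈ maxSubspace K R := Ideal.pow_le_self (by omega) hr
  have hker : ∀ x ∈ maxSubspace K R, x * r ∈ LinearMap.ker T.F := fun x hx => by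
    refine Nat.find_spec hex _ ?_
    rw [hm, pow_succ']
    exact Ideal.mul_mem_mul hx hr
  refine ⟨r, hrm, fun hrW => hrk ?_, hker⟩
  rw [LinearMap.mem_ker]
  ext x
  obtain ⟨c, hc⟩ := exists_sub_smul_one_mem (K := K) x
  rw [T.F_eq hrW, show r * x = c • r + (x - c • (1 : R)) * r by
    rw [sub_mul, smul_mul_assoc, one_mul]; ring, map_add, map_smul, T.F_one_W hrW,
    T.F_one_of_mem_ker (hker _ hc)]
  simp

/-- With `r` as in `exists_mem_socle_mod_ker`, `R = K 1 + K r + W`, and elements of `W` are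
automatically orthogonal to `1` and `r`. -/
theorem mem_ker_of_orthogonal {a : R} (ha : a ∈ T.W) (h : ∀ b ∈ T.W, T.F a b = 0) :
    a ∈ LinearMap.ker T.F := by
  obtain ⟨r, hr, hrW, hrk⟩ := T.exists_mem_socle_mod_ker
  rw [LinearMap.mem_ker]
  ext x
  obtain ⟨c, hc⟩ := exists_sub_smul_one_mem (K := K) x
  obtain ⟨t, ht⟩ := T.exists_sub_smul_mem hr hrW hc
  have : x = c • (1 : R) + t • r + (x - c • (1 : R) - t • r) := by abel
  rw [this, map_add, h _ ht, map_add, map_smul, map_smul, T.F_symm a 1, T.F_one_W ha, T.F_eq ha,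
    T.F_one_of_mem_ker (hrk a (T.W_le ha))]
  simp

/-- A vector `z` of the kernel not annihilated by some `w ∈ W` gives `Ker F = ⟨w z, z⟩`. The
annihilator of the kernel in `W` is large enough to contain `x` with `F x x = 1`, and `b₀ = x²`.
That `b₀` lies in the socle comes from rebracketing products in which some factors kill the kernel.
-/
theorem exists_frame (hcorank : T.corank = 2) (hdim : 5 ≤ T.dim) (hunfixed : ¬ T.sing ⊆ T.fix) :
    Nonempty T.Frame := by
  obtain ⟨w, hw, z, hz, hwz⟩ := T.exists_mul_ne_zero hunfixed
  have hz0 : z ≠ 0 := fun h => hwz (by rw [h, mul_zero])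
  have hli : LinearIndependent K ![w * z, z] := by
    rw [LinearIndependent.pair_iff]
    intro s t h
    have h1 : (s • w) * z = (-t) • z := by
      rw [smul_mul_assoc, neg_smul]
      exact eq_neg_of_add_eq_zero_left h
    have ht := eq_zero_of_mul_eq_smul (Submodule.smul_mem _ s (T.W_le hw)) hz0 h1
    rw [neg_eq_zero] at ht
    rw [ht, zero_smul, add_zero] at h
    exact ⟨(smul_eq_zero.1 h).resolve_right hwz, ht⟩
  have hker : LinearMap.ker T.F = Submodule.span K {w * z, z} := by
    symm
    refine Submodule.eq_of_le_of_finrank_le ?_ ?_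
    · rw [Submodule.span_le]
      rintro x (rfl | rfl)
      · exact T.mul_mem_ker w hz
      · exact hz
    · have h1 : finrank K (LinearMap.ker T.F) = 2 := hcorank
      have h2 := finrank_span_eq_card hli
      rw [Matrix.range_cons_cons_empty, Fintype.card_fin] at h2
      rw [h1, h2]
  have hmz : ∀ x ∈ maxSubspace K R, ∃ c : K, x * z = c • (w * z) := by
    intro x hx
    have h1 := T.mul_mem_ker x hz
    rw [hker] at h1
    obtain ⟨s, t, h2⟩ := Submodule.mem_span_pair.1 h1
    have h3 : (x - s • w) * z = t • z := by
      rw [sub_mul, smul_mul_assoc, ← h2, add_sub_cancel_left]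
    have ht := eq_zero_of_mul_eq_smul (sub_mem hx (Submodule.smul_mem _ s (T.W_le hw))) hz0 h3
    exact ⟨s, by rw [← h2, ht, zero_smul, add_zero]⟩
  have hwwz : w * (w * z) = 0 := by
    obtain ⟨c, hc⟩ := hmz (w * w) (mul_mem_maxSubspace _ (T.W_le hw))
    rw [mul_assoc] at hc
    rw [hc, eq_zero_of_mul_eq_smul (T.W_le hw) hwz hc, zero_smul]
  have hμ : ∀ x ∈ maxSubspace K R, w * z * x = 0 := by
    intro x hx
    obtain ⟨c, hc⟩ := hmz x hx
    rw [mul_assoc, mul_comm z x, hc, mul_smul_comm, hwwz, smul_zero]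
  obtain ⟨r, hr, hrW, hrk⟩ := T.exists_mem_socle_mod_ker
  have hφr := T.F_one_ne_zero hr hrW
  -- products of two elements of `W`
  have hprod : ∀ a ∈ T.W, ∀ b ∈ T.W, ∃ t : K, a * b - t • r ∈ LinearMap.ker T.F ∧
      T.F a b = -t * T.F 1 r := by
    intro a ha b hb
    obtain ⟨t, ht⟩ := T.exists_sub_smul_mem hr hrW (mul_mem_maxSubspace b (T.W_le ha))
    have hk : a * b - t • r ∈ LinearMap.ker T.F := by
      refine T.mem_ker_of_orthogonal ht fun c hc => ?_
      rw [T.F_eq ht, sub_mul, map_sub, T.F_one_mul_mul ha hb hc, smul_mul_assoc, map_smul,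
        mul_comm r c, T.F_one_of_mem_ker (hrk c (T.W_le hc))]
      simp
    refine ⟨t, hk, ?_⟩
    have h1 := T.F_one_of_mem_ker hk
    rw [map_sub, map_smul, smul_eq_mul] at h1
    rw [T.F_eq ha]
    linear_combination -h1
  obtain ⟨γ, hγ⟩ : ∃ γ : R →ₗ[K] K, γ (w * z) = 1 := by
    obtain ⟨γ, -, hγ⟩ := LinearMap.exists_extend_of_notMem (p := (⊥ : Submodule K R)) 0
      (v := w * z) (by simpa using hwz) (1 : K)
    exact ⟨γ, hγ⟩
  -- As `x z` is a multiple of `w z`, this one linear condition says `x z = 0`; so `V₁` is the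
  -- annihilator of `Ker F` in `W`.
  let V₁ : Submodule K R := T.W ⊓ LinearMap.ker (γ ∘ₗ LinearMap.mulRight K z)
  have hV₁ : ∀ x ∈ V₁, ∀ k ∈ LinearMap.ker T.F, x * k = 0 := by
    rintro x ⟨hxW, hx⟩ k hk
    have hxz : x * z = 0 := by
      obtain ⟨c, hc⟩ := hmz x (T.W_le hxW)
      have : γ (x * z) = 0 := hx
      rw [hc, map_smul, hγ, smul_eq_mul, mul_one] at this
      rw [hc, this, zero_smul]
    rw [hker] at hk
    obtain ⟨s, t, rfl⟩ := Submodule.mem_span_pair.1 hk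
    rw [mul_add, mul_smul_comm, mul_smul_comm, hxz, mul_comm x (w * z), hμ x (T.W_le hxW)]
    simp
  have hker2 : finrank K (LinearMap.ker T.F) = 2 := hcorank
  have hV₁dim : 4 ≤ finrank K V₁ := by
    have := finrank_le_inf_ker T.W (γ ∘ₗ LinearMap.mulRight K z)
    have h5 : 5 ≤ finrank K T.W := hdim
    change 4 ≤ finrank K (T.W ⊓ LinearMap.ker (γ ∘ₗ LinearMap.mulRight K z) : Submodule K R)
    omega
  -- After one more linear condition the dimension is still at least 3, whereas `Ker F` has
  -- dimension 2.
  have hnot : ∀ f : R →ₗ[K] K, ∃ u ∈ V₁, f u = 0 ∧ u ∉ LinearMap.ker T.F := by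
    intro f
    by_contra! h
    have h1 : V₁ ⊓ LinearMap.ker f ≤ LinearMap.ker T.F := fun u hu => h u hu.1 hu.2
    have h2 := Submodule.finrank_mono h1
    have h3 := finrank_le_inf_ker V₁ f
    omega
  -- Otherwise `F` vanishes on `V₁` by polarization. Since `W = V₁ + K w`, an element of `V₁`
  -- orthogonal to `w` would then be orthogonal to `W`.
  obtain ⟨x₀, hx₀, hx₀F⟩ : ∃ x ∈ V₁, T.F x x ≠ 0 := by
    by_contra! h
    obtain ⟨u, hu, huw, huk⟩ := hnot (T.F w)
    apply huk
    refine T.mem_ker_of_orthogonal hu.1 fun b hb => ?_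
    obtain ⟨c, hc⟩ := hmz b (T.W_le hb)
    have hb' : b - c • w ∈ V₁ := by
      refine ⟨sub_mem hb (T.W.smul_mem c hw), ?_⟩
      have : (b - c • w) * z = 0 := by rw [sub_mul, hc, smul_mul_assoc, sub_self]
      change γ ((b - c • w) * z) = 0
      rw [this, map_zero]
    have e1 := h _ (V₁.add_mem hu hb')
    have e2 := h _ hb'
    have e3 := h _ hu
    simp only [map_add, LinearMap.add_apply, e2, e3, T.F_symm (b - c • w) u] at e1
    have e4 : (2 : K) * T.F u (b - c • w) = 0 := by linear_combination e1
    have e5 : T.F u (b - c • w) = 0 := by simpa using e4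
    rwa [map_sub, map_smul, T.F_symm u w, huw, smul_zero, sub_zero] at e5
  obtain ⟨a, ha⟩ := IsAlgClosed.exists_pow_nat_eq (T.F x₀ x₀)⁻¹ zero_lt_two
  obtain ⟨x, hx, hxx⟩ : ∃ x ∈ V₁, T.F x x = 1 := by
    refine ⟨a • x₀, V₁.smul_mem a hx₀, ?_⟩
    rw [map_smul, map_smul, LinearMap.smul_apply, smul_smul, ← pow_two, ha, smul_eq_mul,
      inv_mul_cancel₀ hx₀F]
  have hxv : ∀ v ∈ T.W, T.F x v = 0 → x * v ∈ LinearMap.ker T.F := by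
    intro v hv h
    obtain ⟨t, ht, ht'⟩ := hprod x hx.1 v hv
    have : t = 0 := by
      rw [h] at ht'
      have := mul_eq_zero.1 ht'.symm
      rw [or_iff_left hφr, neg_eq_zero] at this
      exact this
    rwa [this, zero_smul, sub_zero] at ht
  -- Two readings of `x u v`: modulo `Ker F`, which `x` kills, `u v` is a nonzero multiple of `r`;
  -- and `x v` lies in `Ker F`, which `u` kills.
  have hxr : x * r = 0 := by
    obtain ⟨u, hu, hxu, huk⟩ := hnot (T.F x)
    obtain ⟨v', hv', huv'⟩ : ∃ v ∈ T.W, T.F u v ≠ 0 := by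
      by_contra! h
      exact huk (T.mem_ker_of_orthogonal hu.1 h)
    set v := v' - T.F x v' • x with hvdef
    have hvW : v ∈ T.W := sub_mem hv' (T.W.smul_mem _ hx.1)
    have hxv0 : T.F x v = 0 := by
      rw [hvdef, map_sub, map_smul, hxx, smul_eq_mul, mul_one, sub_self]
    have huv : T.F u v ≠ 0 := by
      rw [hvdef, map_sub, map_smul, T.F_symm u x, hxu, smul_zero, sub_zero]
      exact huv'
    obtain ⟨t, ht, ht'⟩ := hprod u hu.1 v hvW
    have ht0 : t ≠ 0 := by
      rintro rfl
      exact huv (by rw [ht']; ring)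
    have h1 := hV₁ x hx _ ht
    have h2 := hV₁ u hu _ (hxv v hvW hxv0)
    have h3 : t • (x * r) = 0 := by
      rw [← mul_smul_comm]
      linear_combination h2 - h1
    exact (smul_eq_zero.1 h3).resolve_left ht0
  obtain ⟨t₀, ht₀, ht₀'⟩ := hprod x hx.1 x hx.1
  have hxxx : x * x * x = 0 := by
    have h1 := hV₁ x hx _ ht₀
    rw [mul_sub, mul_smul_comm, hxr, smul_zero, sub_zero] at h1
    rw [mul_assoc]
    exact h1
  have hxxy : ∀ y ∈ T.W, x * x * y = 0 := by
    intro y hy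
    have h1 : y - T.F x y • x ∈ T.W := sub_mem hy (T.W.smul_mem _ hx.1)
    have h2 := hxv _ h1 (by rw [map_sub, map_smul, hxx, smul_eq_mul, mul_one, sub_self])
    have h3 := hV₁ x hx _ h2
    rw [mul_sub, mul_sub, mul_smul_comm, mul_smul_comm, ← mul_assoc, ← mul_assoc, hxxx, smul_zero,
      sub_zero] at h3
    exact h3
  have hφ : T.F 1 (x * x) = -1 := by
    have := T.F_eq hx.1 x
    rw [hxx] at this
    linear_combination this
  have hxxm : x * x ∈ maxSubspace K R := mul_mem_maxSubspace x (T.W_le hx.1)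
  have hxxW : x * x ∉ T.W := by
    intro h
    rw [T.F_one_W h] at hφ
    norm_num at hφ
  refine ⟨⟨w * z, z, x * x, w, hw, hker, rfl, hwz, hmz, hμ,
    mul_mem_maxSq (T.W_le hx.1) (T.W_le hx.1), hφ, fun y hy => ?_, fun a ha b hb => ?_⟩⟩
  · obtain ⟨t, ht⟩ := T.exists_sub_smul_mem hxxm hxxW hy
    have h1 := hxxy _ ht
    have h2 : x * x * (x * x) = 0 := by rw [← mul_assoc, hxxx, zero_mul]
    rwa [mul_sub, mul_smul_comm, h2, smul_zero, sub_zero] at h1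
  · obtain ⟨t, ht, ht'⟩ := hprod a ha b hb
    have h1 : a * b - T.F a b • (x * x) =
        (a * b - t • r) - T.F a b • (x * x - t₀ • r) := by
      have h2 : T.F a b * t₀ = t := by
        rw [hxx] at ht₀'
        rw [ht']
        linear_combination -t * ht₀'
      rw [smul_sub, smul_smul, h2]
      abel
    rw [h1]
    exact sub_mem ht (Submodule.smul_mem _ _ ht₀)

end Triple

end Structure

end AdditiveQuadric

namespace AdditiveQuadric

/-! ### From the normal form of two bilinear forms to a multiplication table -/

section TableSection

variable {K R : Type*} [Field K] [CommRing R] [IsLocalRing R] [Algebra K R]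

theorem Triple.numF_eq [FiniteDimensional K R] (T : Triple K R) :
    T.numF = numFOf T.letter T.level := by
  unfold Triple.numF numFOf
  cases T.letter <;> rfl

theorem le_numFOf (L : Triple.Letter) (s : ℕ) : s ≤ numFOf L s := by
  cases L <;> simp [numFOf]

theorem numFOf_le (L : Triple.Letter) (s : ℕ) : numFOf L s ≤ s + 1 := by
  cases L <;> simp [numFOf]

open Classical in
/-- A multiplication table of the shape of a normalized set, in which the matrix `M` is arbitrary
and `f_1² = h μ₂` with an arbitrary scalar `h`. -/
structure Table (T : Triple K R) (L : Triple.Letter) (s : ℕ) (h : K) {ι : Type*}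
    (M : Matrix ι ι K) where
  μ₁ : R
  b₀ : R
  f : ℕ → R
  g : ℕ → R
  e : ι → R
  b₀_mem : b₀ ∈ maxSq K R
  b₀_notMem : b₀ ∉ T.W
  b₀_mul : ∀ w ∈ maxSubspace K R, b₀ * w = 0
  μ₁_mul : ∀ w ∈ maxSubspace K R, μ₁ * w = 0
  ker_eq : LinearMap.ker T.F = Submodule.span K {μ₁, g 0}
  ker_li : LinearIndependent K ![μ₁, g 0]
  f_mem : ∀ i, 1 ≤ i → i ≤ numFOf L s → f i ∈ T.upper (i - 1) ∧ f i ∉ T.upper i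
  g_mem : ∀ j, 1 ≤ j → j ≤ s → g j ∈ T.lower j ∧ g j ∉ T.lower (j - 1)
  e_mem : ∀ k, e k ∈ T.upper (numFOf L s)
  upper_le : T.upper (numFOf L s) ≤ T.lower (numFOf L s) ⊔ Submodule.span K (Set.range e)
  W_le_span : T.W ≤ Submodule.span K {μ₁} ⊔ Submodule.span K (g '' Set.Iic s) ⊔
    Submodule.span K (Set.range e) ⊔
    Submodule.span K ((fun i => f (i + 1)) '' Set.Iio (numFOf L s))
  e_mul_e : ∀ k l, e k * e l = (if k = l then b₀ else 0) + M k l • μ₁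
  e_mul_f : ∀ k i, 1 ≤ i → i ≤ numFOf L s → e k * f i = 0
  e_mul_g : ∀ k j, j ≤ s → e k * g j = 0
  g_mul_g : ∀ i j, i ≤ s → j ≤ s → g i * g j = if L = .B ∧ i = s ∧ j = s then μ₁ else 0
  f_mul_g : ∀ i j, 1 ≤ i → i ≤ numFOf L s → j ≤ s →
    f i * g j = if i = j then b₀ else if i = j + 1 then μ₁ else 0
  f_mul_f : ∀ i j, 1 ≤ i → i < j → j ≤ numFOf L s → f i * f j = 0
  f_sq : ∀ i, 1 ≤ i → i ≤ numFOf L s →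
    f i * f i = (if i = 1 then h • g 0 else 0) + (if i = s + 1 then b₀ else 0)

namespace Triple

variable [FiniteDimensional K R] [IsAlgClosed K] [CharZero K] {T : Triple K R}

theorem upper_zero : T.upper 0 = T.W := rfl

theorem lower_zero : T.lower 0 = LinearMap.ker T.F := rfl

theorem mem_upper_succ {k : ℕ} {x : R} :
    x ∈ T.upper (k + 1) ↔ x ∈ T.upper k ∧ ∀ y ∈ T.lower k, x * y = 0 := Iff.rfl

theorem mem_lower_succ {k : ℕ} {x : R} :
    x ∈ T.lower (k + 1) ↔ x ∈ T.upper (k + 1) ∧ ∀ y ∈ T.upper (k + 1), T.F x y = 0 := Iff.rfl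

theorem upper_antitone : Antitone T.upper :=
  antitone_nat_of_succ_le fun _ _ hx => hx.1

theorem upper_le_W (k : ℕ) : T.upper k ≤ T.W := upper_antitone (Nat.zero_le k)

theorem lower_eq_radOn (k : ℕ) : T.lower k = radOn T.F (T.upper k) := by
  cases k with
  | zero =>
    ext x
    rw [lower_zero, upper_zero, mem_radOn]
    constructor
    · intro hx
      refine ⟨T.ker_le_W hx, fun y _ => ?_⟩
      rw [LinearMap.mem_ker.1 hx, LinearMap.zero_apply]
    · rintro ⟨h1, h2⟩
      exact T.mem_ker_of_orthogonal h1 h2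
  | succ k => rfl

theorem lower_le_upper (k : ℕ) : T.lower k ≤ T.upper k := by
  rw [lower_eq_radOn]
  exact radOn_le

/-- Coordinates of the products of elements of `W`. -/
theorem Frame.exists_coordinate (P : T.Frame) : ∃ (γ : R →ₗ[K] K) (h : K), γ P.μ₁ = 1 ∧
    γ P.b₀ = 0 ∧ γ P.μ₂ = 0 ∧ (∀ a ∈ maxSubspace K R, a * P.μ₂ = γ (a * P.μ₂) • P.μ₁) ∧
    h * γ (P.μ₂ * P.μ₂) = 0 ∧
    ∀ a ∈ T.W, ∀ b ∈ T.W, a * b = T.F a b • P.b₀ + γ (a * b) • P.μ₁ +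
      (h * γ (a * P.μ₂) * γ (b * P.μ₂)) • P.μ₂ := by
  have hk1 : P.μ₁ ∈ LinearMap.ker T.F := P.ker_eq ▸ Submodule.subset_span (by simp)
  have hk2 : P.μ₂ ∈ LinearMap.ker T.F := P.ker_eq ▸ Submodule.subset_span (by simp)
  have hwm := T.W_le P.w_mem
  have hμ₂ : P.μ₂ ≠ 0 := by
    intro h
    have := P.w_mul
    rw [h, mul_zero] at this
    exact P.μ₁_ne this.symm
  have hb : ∀ s t : K, ∀ x ∈ LinearMap.ker T.F, ∀ y ∈ LinearMap.ker T.F,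
      s • P.b₀ + t • x = y → s = 0 := by
    intro s t x hx y hy h
    have := T.F_one_of_mem_ker hy
    rw [← h, map_add, map_smul, map_smul, T.F_one_of_mem_ker hx, P.F_one_b₀] at this
    simpa using this
  obtain ⟨γ, hγ, hγ1⟩ := LinearMap.exists_extend_of_notMem
    (p := Submodule.span K {P.b₀, P.μ₂}) 0 (v := P.μ₁) (by
      rw [Submodule.mem_span_pair]
      rintro ⟨s, t, h⟩
      have hs := hb s t _ hk2 _ hk1 h
      rw [hs, zero_smul, zero_add, ← P.w_mul] at h
      have ht := eq_zero_of_mul_eq_smul hwm hμ₂ h.symm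
      rw [ht, zero_smul, P.w_mul] at h
      exact P.μ₁_ne h.symm) (1 : K)
  obtain ⟨γ', hγ', hγ'1⟩ := LinearMap.exists_extend_of_notMem
    (p := Submodule.span K {P.b₀, P.μ₁}) 0 (v := P.μ₂) (by
      rw [Submodule.mem_span_pair]
      rintro ⟨s, t, h⟩
      have hs := hb s t _ hk1 _ hk2 h
      rw [hs, zero_smul, zero_add] at h
      apply P.μ₁_ne
      rw [← P.w_mul, ← h, mul_smul_comm, mul_comm, P.μ₁_mul _ hwm, smul_zero]) (1 : K)
  have hγb : γ P.b₀ = 0 :=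
    LinearMap.congr_fun hγ ⟨P.b₀, Submodule.subset_span (by simp)⟩
  have hγ2 : γ P.μ₂ = 0 :=
    LinearMap.congr_fun hγ ⟨P.μ₂, Submodule.subset_span (by simp)⟩
  have hγ'b : γ' P.b₀ = 0 :=
    LinearMap.congr_fun hγ' ⟨P.b₀, Submodule.subset_span (by simp)⟩
  have hγ'2 : γ' P.μ₁ = 0 :=
    LinearMap.congr_fun hγ' ⟨P.μ₁, Submodule.subset_span (by simp)⟩
  have hμ : ∀ a ∈ maxSubspace K R, a * P.μ₂ = γ (a * P.μ₂) • P.μ₁ := by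
    intro a ha
    obtain ⟨c, hc⟩ := P.max_mul_μ₂ a ha
    rw [hc, map_smul, hγ1, smul_eq_mul, mul_one]
  have hab : ∀ a ∈ T.W, ∀ b ∈ T.W, a * b = T.F a b • P.b₀ + γ (a * b) • P.μ₁ +
      γ' (a * b) • P.μ₂ := by
    intro a ha b hb
    have h1 := P.W_mul_W a ha b hb
    rw [P.ker_eq, Submodule.mem_span_pair] at h1
    obtain ⟨s, t, h⟩ := h1
    have h2 : a * b = T.F a b • P.b₀ + s • P.μ₁ + t • P.μ₂ := by
      rw [add_assoc, h]; abel
    have h3 : γ (a * b) = s := by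
      rw [h2]; simp [hγ1, hγb, hγ2]
    have h4 : γ' (a * b) = t := by
      rw [h2]; simp [hγ'1, hγ'b, hγ'2]
    rw [h3, h4, ← h2]
  -- Only the component of `a b` along `μ₂` survives multiplication by `c`.
  have habc : ∀ a ∈ T.W, ∀ b ∈ T.W, ∀ c ∈ T.W,
      a * b * c = (γ' (a * b) * γ (c * P.μ₂)) • P.μ₁ := by
    intro a ha b hb c hc
    have hcm := T.W_le hc
    have h1 : a * b * c = γ' (a * b) • (c * P.μ₂) := by
      conv_lhs => rw [hab a ha b hb]
      rw [add_mul, add_mul, smul_mul_assoc, smul_mul_assoc, smul_mul_assoc,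
        P.b₀_mul c hcm, P.μ₁_mul c hcm, mul_comm P.μ₂ c, smul_zero, smul_zero, zero_add, zero_add]
    have h2 := hμ c hcm
    rw [h1, mul_smul, ← h2]
  -- Write `ℓ(a) = γ (a μ₂)`. Associativity forces the `μ₂`-component of `a b` to be `h ℓ(a) ℓ(b)`,
  -- with `h` its value for `a = b = w`, where `ℓ(w) = 1`.
  have hsym : ∀ a ∈ T.W, ∀ b ∈ T.W, ∀ c ∈ T.W,
      γ' (a * b) * γ (c * P.μ₂) = γ' (b * c) * γ (a * P.μ₂) := by
    intro a ha b hb c hc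
    have h1 := habc a ha b hb c hc
    have h2 := habc b hb c hc a ha
    have h3 : a * b * c = b * c * a := by ring
    rw [h1, h2, ← sub_eq_zero, ← sub_smul, smul_eq_zero, or_iff_left P.μ₁_ne, sub_eq_zero] at h3
    exact h3
  have hγw : γ (P.w * P.μ₂) = 1 := by rw [P.w_mul, hγ1]
  have hfin : ∀ a ∈ T.W, ∀ b ∈ T.W,
      γ' (a * b) = γ' (P.w * P.w) * γ (a * P.μ₂) * γ (b * P.μ₂) := by
    intro a ha b hb
    have h1 := hsym a ha b hb P.w P.w_mem
    have h2 := hsym b hb P.w P.w_mem P.w P.w_mem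
    rw [hγw, mul_one] at h1 h2
    rw [h1, h2]
    ring
  refine ⟨γ, γ' (P.w * P.w), hγ1, hγb, hγ2, hμ, ?_, fun a ha b hb => ?_⟩
  -- `w μ₂ = μ₁` has no component along `μ₂`, which gives `h ℓ(μ₂) = 0`.
  · have h1 := hfin P.w P.w_mem P.μ₂ (T.ker_le_W hk2)
    rw [P.w_mul, hγ'2, hγ1, mul_one] at h1
    exact h1.symm
  · rw [← hfin a ha b hb]
    exact hab a ha b hb

open Classical in
theorem letterOn_of_chain {G : LinearMap.BilinForm K R}
    (hup : ∀ k, T.upper k = upOn T.F G T.W k)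
    (hnext : ∀ k, T.ProdZero k ↔ nextOn T.F G (T.upper k) = T.upper k) :
    (∀ k < T.level, ¬ StopsOn T.F G (upOn T.F G T.W k)) ∧
      LetterOn T.F G (upOn T.F G T.W T.level) T.letter := by
  have hlow : ∀ k, T.lower k = radOn T.F (upOn T.F G T.W k) := fun k => by
    rw [lower_eq_radOn, hup]
  have hlow' : ∀ k, T.lower (k + 1) = radOn T.F (nextOn T.F G (upOn T.F G T.W k)) := fun k => by
    rw [hlow, upOn_succ']
  have hst : ∀ k, T.Stops k ↔ StopsOn T.F G (upOn T.F G T.W k) := by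
    intro k
    rw [Triple.Stops, StopsOn, hnext, hlow, hlow', hup]
  refine ⟨fun k hk h => Nat.find_min T.exists_stops hk ((hst k).2 h), ?_⟩
  have hs : T.Stops T.level := Nat.find_spec T.exists_stops
  rw [Triple.letter]
  by_cases h1 : T.ProdZero T.level
  · rw [if_pos h1]
    rw [hnext, hup] at h1
    exact h1
  · rw [if_neg h1]
    by_cases h2 : ¬ T.lower T.level ≤ T.lower (T.level + 1)
    · rw [if_pos h2]
      rw [hnext, hup] at h1
      rw [hlow, hlow'] at h2
      exact ⟨h1, h2⟩
    · rw [if_neg h2]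
      have h3 := (hs.resolve_left h1).resolve_left h2
      rw [hnext, hup] at h1
      rw [hlow, hlow'] at h3
      exact ⟨h1, h3⟩

/-- For `G a b = γ (a b)`, products of `V^(k)` with `V_(k)` have only a `μ₁`-component, so the chain
of the triple is the chain of the pair `(F, G)`, and the normal form of the pair becomes a table.
Keeping the `b₀` and `μ₁` of the frame is what later allows `b₀` to be varied. -/
theorem Frame.exists_table (P : T.Frame) : ∃ (h : K) (p : ℕ) (M : Matrix (Fin p) (Fin p) K)
    (X : Table T T.letter T.level h M), X.b₀ = P.b₀ ∧ X.μ₁ = P.μ₁ := by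
  obtain ⟨γ, h, hγ1, hγb, hγ2, hμ, hh, hmul⟩ := P.exists_coordinate
  have hk1 : P.μ₁ ∈ LinearMap.ker T.F := P.ker_eq ▸ Submodule.subset_span (by simp)
  have hk2 : P.μ₂ ∈ LinearMap.ker T.F := P.ker_eq ▸ Submodule.subset_span (by simp)
  have hμ₁W := T.ker_le_W hk1
  have hμ₂W := T.ker_le_W hk2
  let G : LinearMap.BilinForm K R := (LinearMap.mul K R).compr₂ γ
  have hGdef : ∀ a b, G a b = γ (a * b) := fun _ _ => rfl
  have hGs : ∀ a b, G a b = G b a := fun a b => by rw [hGdef, hGdef, mul_comm]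
  -- products of elements of `upper k` and `lower k`
  have hprod : ∀ k, ∀ a ∈ T.upper k, ∀ b ∈ T.lower k, a * b = G a b • P.μ₁ := by
    intro k a ha b hb
    have haW := upper_le_W k ha
    have hbW := upper_le_W k (lower_le_upper k hb)
    have hab := hmul a haW b hbW
    cases k with
    | zero =>
      rw [lower_zero, P.ker_eq] at hb
      obtain ⟨s, t, rfl⟩ := Submodule.mem_span_pair.1 hb
      rw [hGdef, mul_add, mul_smul_comm, mul_smul_comm, mul_comm a P.μ₁,
        P.μ₁_mul a (T.W_le haW), smul_zero, zero_add, map_smul]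
      rw [hμ a (T.W_le haW), smul_smul, map_smul, hγ1, smul_eq_mul, smul_eq_mul, mul_one]
    | succ k =>
      -- From stage 1 on the elements kill `μ₂`, so `a b` has no component along `μ₂`; it has none
      -- along `b₀` because `b` is in the `F`-radical.
      have h1 : a * P.μ₂ = 0 :=
        ((upper_antitone (Nat.succ_le_succ (Nat.zero_le k)) ha : a ∈ T.upper 1)).2 _ hk2
      rw [lower_eq_radOn] at hb
      rw [hab, radOn_sub_mem T.F_symm hb ha, h1, map_zero, mul_zero, zero_mul, zero_smul,
        zero_smul, add_zero, zero_add, hGdef]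
  have hprod0 : ∀ k, ∀ a ∈ T.upper k, ∀ b ∈ T.lower k, (a * b = 0 ↔ G a b = 0) := by
    intro k a ha b hb
    rw [hprod k a ha b hb, smul_eq_zero, or_iff_left P.μ₁_ne]
  have hnext : ∀ k, T.upper (k + 1) = nextOn T.F G (T.upper k) := by
    intro k
    ext x
    rw [mem_upper_succ, mem_nextOn, ← lower_eq_radOn]
    exact and_congr_right fun hx => forall₂_congr fun y hy => hprod0 k x hx y hy
  have hup : ∀ k, T.upper k = upOn T.F G T.W k := by
    intro k
    induction k with
    | zero => rfl
    | succ k ih => rw [hnext, upOn_succ', ih]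
  have hlow : ∀ k, T.lower k = radOn T.F (upOn T.F G T.W k) := fun k => by
    rw [lower_eq_radOn, hup]
  have hPZ : ∀ k, T.ProdZero k ↔ nextOn T.F G (T.upper k) = T.upper k := by
    intro k
    rw [← hnext]
    constructor
    · intro h
      exact le_antisymm (upper_antitone (Nat.le_succ k)) fun x hx => ⟨hx, fun y hy => h x hx y hy⟩
    · intro h x hx y hy
      rw [← h] at hx
      exact hx.2 y hy
  obtain ⟨hns, hL⟩ := letterOn_of_chain hup hPZ
  have hrad : radOn T.F T.W = Submodule.span K {P.μ₁} ⊔ Submodule.span K {P.μ₂} := by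
    have := T.lower_eq_radOn 0
    rw [lower_zero, upper_zero] at this
    rw [← this, P.ker_eq, Submodule.span_insert]
  obtain ⟨p, ⟨X⟩⟩ := exists_pencilBasis T.F_symm hGs T.letter T.level
    (Submodule.span K {P.μ₁}) T.W P.μ₂
    ((Submodule.span_singleton_le_iff_mem _ _).2 hμ₁W)
    (fun x hx y hy => by
      obtain ⟨c, rfl⟩ := Submodule.mem_span_singleton.1 hx
      rw [map_smul, LinearMap.mem_ker.1 hk1, smul_zero, LinearMap.zero_apply])
    (fun x hx y hy => by
      obtain ⟨c, rfl⟩ := Submodule.mem_span_singleton.1 hx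
      rw [hGdef, smul_mul_assoc, P.μ₁_mul y (T.W_le hy), smul_zero, map_zero]) hrad hns hL
  obtain ⟨c, hc, hg0⟩ := X.g_zero
  have hgW : ∀ j ≤ T.level, X.g j ∈ T.W := fun j hj => upOn_le_self j (X.g_mem j hj).1
  have hfW : ∀ i < numFOf T.letter T.level, X.f i ∈ T.W := fun j hj =>
    upOn_le_self j (X.f_mem j hj)
  have heW : ∀ k, X.e k ∈ T.W := fun k => upOn_le_self _ (X.e_mem k)
  have hμ₂g : P.μ₂ = c⁻¹ • X.g 0 := by rw [hg0, smul_smul, inv_mul_cancel₀ hc, one_smul]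
  -- the component of a product along `μ₂`
  have hℓ : ∀ a, γ (a * P.μ₂) = c⁻¹ * G a (X.g 0) := fun a => by
    rw [hGdef, hg0, mul_smul_comm, map_smul, smul_eq_mul, inv_mul_cancel_left₀ hc]
  have hmul0 : ∀ a ∈ T.W, ∀ b ∈ T.W, G a (X.g 0) = 0 ∨ G b (X.g 0) = 0 →
      a * b = T.F a b • P.b₀ + G a b • P.μ₁ := by
    intro a ha b hb hab
    rw [hmul a ha b hb, hℓ, hℓ]
    rcases hab with h0 | h0 <;> rw [h0] <;> simp [hGdef]
  -- Here `g_0 = c μ₂` and `ℓ(f_1) = c⁻¹`, so the `μ₂`-part of `f_1²` is `h c⁻² μ₂ = h c⁻³ g_0`. The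
  -- table numbers the `f_i` from 1, the pencil basis from 0.
  refine ⟨h * c⁻¹ ^ 3, p, fun k l => G (X.e k) (X.e l),
    { μ₁ := P.μ₁
      b₀ := P.b₀
      f := fun i => X.f (i - 1)
      g := X.g
      e := X.e
      b₀_mem := P.b₀_mem
      b₀_notMem := fun hb => by
        have := P.F_one_b₀
        rw [T.F_one_W hb] at this
        norm_num at this
      b₀_mul := P.b₀_mul
      μ₁_mul := P.μ₁_mul
      ker_eq := ?_
      ker_li := ?_
      f_mem := ?_
      g_mem := ?_
      e_mem := fun k => by rw [hup]; exact X.e_mem k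
      upper_le := by rw [hlow, hup]; exact X.up_le
      W_le_span := ?_
      e_mul_e := ?_
      e_mul_f := ?_
      e_mul_g := ?_
      g_mul_g := ?_
      f_mul_g := ?_
      f_mul_f := ?_
      f_sq := ?_ }, rfl, rfl⟩
  · rw [P.ker_eq, hg0, Submodule.span_insert, Submodule.span_insert,
      Submodule.span_singleton_smul_eq (IsUnit.mk0 c hc)]
  · rw [LinearIndependent.pair_iff]
    intro s t hst
    rw [hg0, smul_smul] at hst
    have h1 := congrArg (fun x => P.w * x) hst
    simp only [mul_add, mul_smul_comm, mul_comm P.w P.μ₁, P.μ₁_mul _ (T.W_le P.w_mem), P.w_mul,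
      smul_zero, zero_add, mul_zero, smul_eq_zero, or_iff_left P.μ₁_ne, mul_eq_zero,
      or_iff_left hc] at h1
    rw [h1, zero_mul, zero_smul, add_zero, smul_eq_zero, or_iff_left P.μ₁_ne] at hst
    exact ⟨hst, h1⟩
  · intro i hi1 hi
    obtain ⟨i, rfl⟩ : ∃ i', i = i' + 1 := ⟨i - 1, by omega⟩
    rw [hup, hup]
    exact ⟨X.f_mem i (by omega), X.f_notMem i (by omega)⟩
  · intro j hj1 hj
    obtain ⟨j, rfl⟩ : ∃ i', j = i' + 1 := ⟨j - 1, by omega⟩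
    rw [hlow, hlow]
    exact ⟨X.g_mem _ hj, X.g_notMem j hj⟩
  · exact X.le_span
  · intro k l
    rw [hmul0 _ (heW k) _ (heW l) (Or.inl (by rw [hGs]; exact X.G_g_e 0 (Nat.zero_le _) k)),
      X.F_e_e, ite_smul, one_smul, zero_smul]
    congr
  · intro k i hi1 hi
    rw [mul_comm, hmul0 _ (hfW (i - 1) (by omega)) _ (heW k)
      (Or.inr (by rw [hGs]; exact X.G_g_e 0 (Nat.zero_le _) k)),
      X.F_f_e _ (by omega), X.G_f_e _ (by omega), zero_smul, zero_smul, add_zero]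
  · intro k j hj
    rw [mul_comm, hmul0 _ (hgW j hj) _ (heW k)
      (Or.inr (by rw [hGs]; exact X.G_g_e 0 (Nat.zero_le _) k)),
      X.F_g_e _ hj, X.G_g_e _ hj, zero_smul, zero_smul, add_zero]
  · intro i j hi hj
    have hz : h * (γ (X.g i * P.μ₂) * γ (X.g j * P.μ₂)) = 0 := by
      by_cases hi0 : i = 0
      · subst hi0
        by_cases hj0 : j = 0
        · subst hj0
          rw [hg0, smul_mul_assoc, map_smul, smul_eq_mul]
          linear_combination (c * c * γ (P.μ₂ * P.μ₂)) * hh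
        · rw [hℓ (X.g j), X.G_g_g j hj 0 (Nat.zero_le _), if_neg (by omega)]
          simp
      · rw [hℓ (X.g i), X.G_g_g i hi 0 (Nat.zero_le _), if_neg (by omega)]
        simp
    rw [hmul _ (hgW i hi) _ (hgW j hj), mul_assoc, hz, ← hGdef, X.F_g_g i hi j hj,
      X.G_g_g i hi j hj, zero_smul, zero_smul, add_zero, zero_add, ite_smul, one_smul, zero_smul]
  · intro i j hi1 hi hj
    have hab : X.f (i - 1) * X.g j = T.F (X.f (i - 1)) (X.g j) • P.b₀ +
        G (X.f (i - 1)) (X.g j) • P.μ₁ := by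
      by_cases hj0 : j = 0
      · subst hj0
        have hz : h * γ (X.g 0 * P.μ₂) = 0 := by
          rw [hg0, smul_mul_assoc, map_smul, smul_eq_mul]
          linear_combination c * hh
        rw [hmul _ (hfW (i - 1) (by omega)) _ (hgW 0 hj), mul_assoc, mul_comm (γ (_ * P.μ₂)),
          ← mul_assoc, hz, zero_mul, zero_smul, add_zero, hGdef]
      · refine hmul0 _ (hfW (i - 1) (by omega)) _ (hgW j hj) (Or.inr ?_)
        rw [X.G_g_g j hj 0 (Nat.zero_le _), if_neg (by omega)]
    rw [hab, X.F_f_g _ (by omega) j hj, X.G_f_g _ (by omega) j hj]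
    by_cases h1 : i = j
    · rw [if_pos (by omega), if_neg (by omega), if_pos h1, one_smul, zero_smul, add_zero]
    · rw [if_neg (by omega), if_neg h1, zero_smul, zero_add]
      by_cases h2 : i = j + 1
      · rw [if_pos (by omega), if_pos h2, one_smul]
      · rw [if_neg (by omega), if_neg h2, zero_smul]
  · intro i j hi1 hij hj
    rw [hmul0 _ (hfW (i - 1) (by omega)) _ (hfW (j - 1) (by omega))
      (Or.inr (by rw [X.G_f_g _ (by omega) 0 (Nat.zero_le _), if_neg (by omega)])),
      X.F_f_f _ (by omega) _ (by omega), X.G_f_f _ (by omega) _ (by omega), if_neg (by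
        have := numFOf_le T.letter T.level
        omega), zero_smul, zero_smul, add_zero]
  · intro i hi1 hi
    rw [hmul _ (hfW (i - 1) (by omega)) _ (hfW (i - 1) (by omega)), ← hGdef,
      X.F_f_f _ (by omega) _ (by omega), X.G_f_f _ (by omega) _ (by omega), hℓ,
      X.G_f_g _ (by omega) 0 (Nat.zero_le _), zero_smul, add_zero, add_comm]
    congr 1
    · by_cases h1 : i = 1
      · rw [if_pos h1, if_pos (by omega), hg0, smul_smul]
        congr 1
        field_simp
      · rw [if_neg h1, if_neg (by omega)]
        simp
    · by_cases h1 : i = T.level + 1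
      · rw [if_pos h1, if_pos (by omega), one_smul]
      · rw [if_neg h1, if_neg (by omega), zero_smul]

end Triple

end TableSection

end AdditiveQuadric

namespace AdditiveQuadric

/-! ### Coordinates with respect to a table -/

section TableOperations

variable {K R : Type*} [Field K] [CommRing R] [IsLocalRing R] [Algebra K R]
variable [FiniteDimensional K R] [IsAlgClosed K] [CharZero K]
variable {T : Triple K R} {L : Triple.Letter} {s : ℕ} {h : K} {ι : Type*} {M : Matrix ι ι K}

theorem exists_sum_of_mem_span_image {t : Finset ℕ} {g : ℕ → R} {x : R}
    (hx : x ∈ Submodule.span K (g '' t)) : ∃ c : ℕ → K, x = ∑ j ∈ t, c j • g j := by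
  obtain ⟨c, rfl⟩ := (Submodule.mem_span_image_finset_iff_exists_fun K).1 hx
  refine ⟨fun j => if h : j ∈ t then c ⟨j, h⟩ else 0, Eq.trans ?_ (Finset.sum_coe_sort t _)⟩
  exact Finset.sum_congr rfl fun j _ => by simp

namespace Table

variable (X : Table T L s h M)

theorem μ₁_mem_ker : X.μ₁ ∈ LinearMap.ker T.F := X.ker_eq ▸ Submodule.subset_span (by simp)

theorem g_zero_mem_ker : X.g 0 ∈ LinearMap.ker T.F := X.ker_eq ▸ Submodule.subset_span (by simp)

theorem g_mem_lower {j : ℕ} (hj : j ≤ s) : X.g j ∈ T.lower j := by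
  rcases Nat.eq_zero_or_pos j with rfl | h
  · exact X.g_zero_mem_ker
  · exact (X.g_mem j h hj).1

theorem μ₁_mem : X.μ₁ ∈ T.W := T.ker_le_W X.μ₁_mem_ker

theorem g_mem_W {j : ℕ} (hj : j ≤ s) : X.g j ∈ T.W :=
  Triple.upper_le_W j (Triple.lower_le_upper j (X.g_mem_lower hj))

theorem e_mem_W (k : ι) : X.e k ∈ T.W := Triple.upper_le_W _ (X.e_mem k)

theorem f_mem_W {i : ℕ} (hi1 : 1 ≤ i) (hi : i ≤ numFOf L s) : X.f i ∈ T.W :=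
  Triple.upper_le_W _ (X.f_mem i hi1 hi).1

theorem W_le {S : Submodule K R} (h1 : X.μ₁ ∈ S) (h2 : ∀ j ≤ s, X.g j ∈ S)
    (h3 : ∀ k, X.e k ∈ S) (h4 : ∀ i, 1 ≤ i → i ≤ numFOf L s → X.f i ∈ S) : T.W ≤ S :=
  X.W_le_span.trans (sup_le (sup_le (sup_le
    ((Submodule.span_singleton_le_iff_mem _ _).2 h1) (span_image_Iic_le h2)) (span_range_le h3))
    (span_image_Iio_le fun i hi => h4 (i + 1) (by omega) (by omega)))

theorem μ₁_ne : X.μ₁ ≠ 0 := X.ker_li.ne_zero 0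

theorem coeff_b₀ {c : K} {w : R} (hw : w ∈ T.W) (h : c • X.b₀ + w = 0) : c = 0 := by
  by_contra hc
  apply X.b₀_notMem
  have h1 : X.b₀ = -(c⁻¹ • w) := by
    rw [eq_neg_iff_add_eq_zero, ← inv_smul_smul₀ hc X.b₀, ← smul_add, h, smul_zero]
  rw [h1]
  exact T.W.neg_mem (T.W.smul_mem _ hw)

theorem coeff_b₀_μ₁ {c c' : K} (h : c • X.b₀ + c' • X.μ₁ = 0) : c = 0 ∧ c' = 0 := by
  have hc := X.coeff_b₀ (T.W.smul_mem _ X.μ₁_mem) h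
  rw [hc, zero_smul, zero_add, smul_eq_zero, or_iff_left X.μ₁_ne] at h
  exact ⟨hc, h⟩

variable [Fintype ι]

/-- A linear combination of the elements of the table that lie in `W`. -/
noncomputable def comb (α : K) (β : ℕ → K) (κ : ι → K) (d : ℕ → K) : R :=
  α • X.μ₁ + ∑ j ∈ Finset.range (s + 1), β j • X.g j + ∑ k, κ k • X.e k +
    ∑ i ∈ Finset.range (numFOf L s), d i • X.f (i + 1)

theorem exists_comb {x : R} (hx : x ∈ T.W) : ∃ α β κ d, x = X.comb α β κ d := by
  obtain ⟨y, hy, z, hz, rfl⟩ := Submodule.mem_sup.1 (X.W_le_span hx)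
  obtain ⟨y, hy₁, u, hu, rfl⟩ := Submodule.mem_sup.1 hy
  obtain ⟨y, hy₂, v, hv, rfl⟩ := Submodule.mem_sup.1 hy₁
  obtain ⟨α, rfl⟩ := Submodule.mem_span_singleton.1 hy₂
  obtain ⟨κ, rfl⟩ := (Submodule.mem_span_range_iff_exists_fun K).1 hu
  rw [← Finset.coe_Iic] at hv
  rw [← Finset.coe_Iio] at hz
  obtain ⟨β, rfl⟩ := exists_sum_of_mem_span_image hv
  obtain ⟨d, rfl⟩ := exists_sum_of_mem_span_image hz
  refine ⟨α, β, κ, d, ?_⟩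
  have h1 : Finset.range (s + 1) = Finset.Iic s := by ext; simp
  have h2 : Finset.range (numFOf L s) = Finset.Iio (numFOf L s) := by ext; simp
  rw [comb, h1, h2]

theorem comb_mem (α : K) (β : ℕ → K) (κ : ι → K) (d : ℕ → K) : X.comb α β κ d ∈ T.W := by
  refine T.W.add_mem (T.W.add_mem (T.W.add_mem ?_ ?_) ?_) ?_
  · exact T.W.smul_mem _ X.μ₁_mem
  · refine Submodule.sum_mem _ fun j hj => T.W.smul_mem _ (X.g_mem_W ?_)
    have := Finset.mem_range.1 hj
    omega
  · exact Submodule.sum_mem _ fun k _ => T.W.smul_mem _ (X.e_mem_W k)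
  · refine Submodule.sum_mem _ fun j hj => T.W.smul_mem _ (X.f_mem_W (by omega) ?_)
    have := Finset.mem_range.1 hj
    omega

-- Multiplication by `g_j` detects the coefficient of `f_j` through `b₀` and that of `f_(j+1)`
-- through `μ₁`. Since `d` is numbered from 0, these are `d (j - 1)` and `d j`.
open Classical in
theorem comb_mul_g (α : K) (β : ℕ → K) (κ : ι → K) (d : ℕ → K) {j : ℕ} (hj : j ≤ s) :
    X.comb α β κ d * X.g j = (if 1 ≤ j then d (j - 1) else 0) • X.b₀ +
      ((if L = .B ∧ j = s then β s else 0) + (if j < numFOf L s then d j else 0)) • X.μ₁ := by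
  have h1 : ∑ i ∈ Finset.range (s + 1), β i • (X.g i * X.g j) =
      (if L = .B ∧ j = s then β s else 0) • X.μ₁ := by
    rw [Finset.sum_eq_single_of_mem s (by simp)]
    · rw [X.g_mul_g s j le_rfl hj]
      by_cases hL : L = .B ∧ j = s
      · rw [if_pos hL, if_pos ⟨hL.1, rfl, hL.2⟩]
      · rw [if_neg hL, if_neg fun h => hL ⟨h.1, h.2.2⟩, smul_zero, zero_smul]
    · intro i hi his
      rw [X.g_mul_g i j (by have := Finset.mem_range.1 hi; omega) hj, if_neg fun h => his h.2.1,
        smul_zero]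
  have h2 : ∑ i ∈ Finset.range (numFOf L s), d i • (X.f (i + 1) * X.g j) =
      (if 1 ≤ j then d (j - 1) else 0) • X.b₀ + (if j < numFOf L s then d j else 0) • X.μ₁ := by
    have hN := le_numFOf L s
    have h3 : ∀ i ∈ Finset.range (numFOf L s), d i • (X.f (i + 1) * X.g j) =
        (if i + 1 = j then d i • X.b₀ else 0) + (if i = j then d i • X.μ₁ else 0) := by
      intro i hi
      have := Finset.mem_range.1 hi
      rw [X.f_mul_g (i + 1) j (by omega) (by omega) hj]
      by_cases h4 : i + 1 = j
      · rw [if_pos h4, if_pos h4, if_neg (by omega), add_zero]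
      · rw [if_neg h4, if_neg h4, zero_add]
        by_cases h5 : i = j
        · rw [if_pos h5, if_pos (by omega)]
        · rw [if_neg h5, if_neg (by omega), smul_zero]
    rw [Finset.sum_congr rfl h3, Finset.sum_add_distrib]
    congr 1
    · rcases j with _ | j
      · simp
      · rw [Finset.sum_eq_single_of_mem j (by simp; omega)]
        · simp
        · intro i _ hij
          rw [if_neg (by omega)]
    · simp only [Finset.sum_ite_eq', Finset.mem_range]
      by_cases h4 : j < numFOf L s
      · rw [if_pos h4, if_pos h4]
      · rw [if_neg h4, if_neg h4, zero_smul]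
  have h3 : ∑ k, κ k • (X.e k * X.g j) = 0 :=
    Finset.sum_eq_zero fun k _ => by rw [X.e_mul_g k j hj, smul_zero]
  rw [comb]
  simp only [add_mul, Finset.sum_mul, smul_mul_assoc]
  rw [h1, h2, h3, X.μ₁_mul _ (T.W_le (X.g_mem_W hj)), smul_zero, add_smul]
  abel

open Classical in
theorem comb_mul_e (α : K) (β : ℕ → K) (κ : ι → K) (d : ℕ → K) (k : ι) :
    X.comb α β κ d * X.e k = κ k • X.b₀ + (∑ l, κ l * M l k) • X.μ₁ := by
  have h1 : ∑ i ∈ Finset.range (s + 1), β i • (X.g i * X.e k) = 0 :=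
    Finset.sum_eq_zero fun j hj => by
      have := Finset.mem_range.1 hj
      rw [mul_comm, X.e_mul_g k j (by omega), smul_zero]
  have h2 : ∑ i ∈ Finset.range (numFOf L s), d i • (X.f (i + 1) * X.e k) = 0 :=
    Finset.sum_eq_zero fun j hj => by
      have := Finset.mem_range.1 hj
      rw [mul_comm, X.e_mul_f k _ (by omega) (by omega), smul_zero]
  have h3 : ∑ l, κ l • (X.e l * X.e k) = κ k • X.b₀ + (∑ l, κ l * M l k) • X.μ₁ := by
    simp only [X.e_mul_e, smul_add, Finset.sum_add_distrib, smul_smul, Finset.sum_smul, smul_ite,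
      smul_zero, Finset.sum_ite_eq', Finset.mem_univ, if_true]
  rw [comb]
  simp only [add_mul, Finset.sum_mul, smul_mul_assoc]
  rw [h1, h2, h3, X.μ₁_mul _ (T.W_le (X.e_mem_W k)), smul_zero]
  abel

theorem comb_mul_f (α : K) (β : ℕ → K) (κ : ι → K) {i : ℕ} (hi : i < numFOf L s) :
    X.comb α β κ 0 * X.f (i + 1) = (if i + 1 ≤ s then β (i + 1) else 0) • X.b₀ +
      β i • X.μ₁ := by
  have hN := numFOf_le L s
  have h1 : ∑ j ∈ Finset.range (s + 1), β j • (X.g j * X.f (i + 1)) =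
      (if i + 1 ≤ s then β (i + 1) else 0) • X.b₀ + β i • X.μ₁ := by
    have h3 : ∀ j ∈ Finset.range (s + 1), β j • (X.g j * X.f (i + 1)) =
        (if j = i + 1 then β j • X.b₀ else 0) + (if j = i then β j • X.μ₁ else 0) := by
      intro j hj
      have := Finset.mem_range.1 hj
      rw [mul_comm, X.f_mul_g (i + 1) j (by omega) (by omega) (by omega)]
      by_cases h4 : i + 1 = j
      · rw [if_pos h4, if_pos h4.symm, if_neg (by omega), add_zero]
      · rw [if_neg h4, if_neg (Ne.symm h4), zero_add]
        by_cases h5 : j = i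
        · rw [if_pos h5, if_pos (by omega)]
        · rw [if_neg h5, if_neg (by omega), smul_zero]
    rw [Finset.sum_congr rfl h3, Finset.sum_add_distrib]
    simp only [Finset.sum_ite_eq', Finset.mem_range]
    rw [if_pos (show i < s + 1 by omega)]
    congr 1
    by_cases h4 : i + 1 ≤ s
    · rw [if_pos h4, if_pos (by omega)]
    · rw [if_neg h4, if_neg (by omega), zero_smul]
  have h2 : ∑ k, κ k • (X.e k * X.f (i + 1)) = 0 :=
    Finset.sum_eq_zero fun k _ => by rw [X.e_mul_f k _ (by omega) (by omega), smul_zero]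
  rw [comb]
  simp only [add_mul, Finset.sum_mul, smul_mul_assoc]
  rw [h1, h2, X.μ₁_mul _ (T.W_le (X.f_mem_W (by omega) (by omega)))]
  simp

theorem not_letter_B_of_lt {j : ℕ} (hj : j < numFOf L s) : ¬ (L = .B ∧ j = s) := by
  rintro ⟨rfl, rfl⟩
  simp [numFOf] at hj

theorem coeff_f_eq_zero {α : K} {β : ℕ → K} {κ : ι → K} {d : ℕ → K} {j : ℕ}
    (hj : j < numFOf L s) (h : X.comb α β κ d * X.g j = 0) : d j = 0 := by
  have hN := numFOf_le L s
  rw [X.comb_mul_g _ _ _ _ (by omega), if_neg (not_letter_B_of_lt hj), if_pos hj, zero_add] at h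
  exact (X.coeff_b₀_μ₁ h).2

theorem coeff_e_eq_zero {α : K} {β : ℕ → K} {κ : ι → K} {d : ℕ → K} {k : ι}
    (h : X.comb α β κ d * X.e k = 0) : κ k = 0 := by
  rw [X.comb_mul_e] at h
  exact (X.coeff_b₀_μ₁ h).1

theorem comb_congr {α : K} {β β' : ℕ → K} {κ : ι → K} {d d' : ℕ → K}
    (hβ : ∀ j ≤ s, β j = β' j) (hd : ∀ i < numFOf L s, d i = d' i) :
    X.comb α β κ d = X.comb α β' κ d' := by
  rw [comb, comb]
  congr 1
  · congr 2
    exact Finset.sum_congr rfl fun j hj => by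
      rw [hβ j (by have := Finset.mem_range.1 hj; omega)]
  · exact Finset.sum_congr rfl fun j hj => by rw [hd j (Finset.mem_range.1 hj)]

/-- Products with the `g_j` recover the coefficients of the `f_i`, products with the `e_k` their own
coefficients, products with the `f_i` those of `g_j` for `j ≥ 1`. What remains is a relation inside
`Ker F`. -/
theorem eq_zero_of_comb {α : K} {β : ℕ → K} {κ : ι → K} {d : ℕ → K}
    (h : X.comb α β κ d = 0) :
    α = 0 ∧ (∀ j ≤ s, β j = 0) ∧ (∀ k, κ k = 0) ∧ ∀ i < numFOf L s, d i = 0 := by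
  have hd : ∀ i < numFOf L s, d i = 0 := fun i hi =>
    X.coeff_f_eq_zero (j := i) (d := d) hi (by rw [h, zero_mul])
  have hκ : ∀ k, κ k = 0 := fun k => X.coeff_e_eq_zero (κ := κ) (k := k) (by rw [h, zero_mul])
  obtain rfl : κ = 0 := funext hκ
  rw [X.comb_congr (β' := β) (d' := 0) (fun _ _ => rfl) hd] at h
  have hN := le_numFOf L s
  have hβ : ∀ j < s, β (j + 1) = 0 := fun j hj => by
    have h1 := X.comb_mul_f α β 0 (i := j) (by omega)
    rw [h, zero_mul, if_pos (by omega)] at h1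
    exact (X.coeff_b₀_μ₁ h1.symm).1
  have h0 : α • X.μ₁ + β 0 • X.g 0 = 0 := by
    rw [comb, Finset.sum_range_succ', Finset.sum_eq_zero fun j hj => by
      rw [hβ j (Finset.mem_range.1 hj), zero_smul]] at h
    simpa using h
  obtain ⟨h1, h2⟩ := LinearIndependent.pair_iff.1 X.ker_li _ _ h0
  refine ⟨h1, fun j hj => ?_, hκ, hd⟩
  rcases j with _ | j
  · exact h2
  · exact hβ j (by omega)

/-- The elements of the table that lie in `W`. -/
def family : Unit ⊕ Fin (s + 1) ⊕ ι ⊕ Fin (numFOf L s) → R :=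
  Sum.elim (fun _ => X.μ₁) (Sum.elim (fun j : Fin (s + 1) => X.g j)
    (Sum.elim X.e (fun i : Fin (numFOf L s) => X.f (i + 1))))

theorem linearIndependent_family : LinearIndependent K X.family := by
  rw [Fintype.linearIndependent_iff]
  intro c hc
  have h1 : X.comb (c (.inl ())) (fun j => if h : j < s + 1 then c (.inr (.inl ⟨j, h⟩)) else 0)
      (fun k => c (.inr (.inr (.inl k))))
      (fun i => if h : i < numFOf L s then c (.inr (.inr (.inr ⟨i, h⟩))) else 0) = 0 := by
    rw [← hc, comb, Finset.sum_range, Finset.sum_range]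
    simp only [Fintype.sum_sum_type, family, add_assoc]
    simp
    exact Finset.sum_congr rfl fun j _ => by rw [if_pos (by omega)]
  obtain ⟨h2, h3, h4, h5⟩ := X.eq_zero_of_comb h1
  rintro (⟨⟩ | j | k | i)
  · exact h2
  · have := h3 j (by omega)
    rwa [dif_pos j.2] at this
  · exact h4 k
  · have := h5 i i.2
    rwa [dif_pos i.2] at this

theorem span_family : Submodule.span K (Set.range X.family) = T.W := by
  apply le_antisymm
  · apply span_range_le
    rintro (_ | j | k | i)
    · exact X.μ₁_mem
    · exact X.g_mem_W (by omega)
    · exact X.e_mem_W k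
    · exact X.f_mem_W (by omega) (by omega)
  · apply X.W_le
    · exact Submodule.subset_span ⟨.inl (), rfl⟩
    · exact fun j hj => Submodule.subset_span ⟨.inr (.inl ⟨j, by omega⟩), rfl⟩
    · exact fun k => Submodule.subset_span ⟨.inr (.inr (.inl k)), rfl⟩
    · rintro (_ | i) h1 hi
      · omega
      · exact Submodule.subset_span ⟨.inr (.inr (.inr ⟨i, by omega⟩)), rfl⟩

theorem finrank_W (X : Table T L s h M) :
    finrank K T.W = 1 + ((s + 1) + (Fintype.card ι + numFOf L s)) := by
  have := finrank_span_eq_card X.linearIndependent_family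
  rw [X.span_family] at this
  rw [this]
  simp

end Table

end TableOperations

end AdditiveQuadric

namespace AdditiveQuadric

namespace Triple

/-! ### Isomorphisms carrying `W` to `W'` and their invariants -/

section Transport

variable {K R R' : Type*} [Field K] [IsAlgClosed K] [CharZero K]
variable [CommRing R] [IsLocalRing R] [Algebra K R] [FiniteDimensional K R]
variable [CommRing R'] [IsLocalRing R'] [Algebra K R'] [FiniteDimensional K R']
variable {T : Triple K R} {T' : Triple K R'}

/-- Modulo the ideal generated by `W` every element is a scalar, and a scalar in the maximal ideal
is 0. -/
theorem max_le_span_W : IsLocalRing.maximalIdeal R ≤ Ideal.span (T.W : Set R) := by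
  have hle : Ideal.span (T.W : Set R) ≤ IsLocalRing.maximalIdeal R :=
    Ideal.span_le.2 fun w hw => T.W_le hw
  have hall : ∀ r : R, ∃ c : K, r - algebraMap K R c ∈ Ideal.span (T.W : Set R) := by
    intro r
    have hr : r ∈ Algebra.adjoin K (T.W : Set R) := by rw [T.W_generates]; trivial
    induction hr using Algebra.adjoin_induction with
    | mem x hx => exact ⟨0, by rw [map_zero, sub_zero]; exact Ideal.subset_span hx⟩
    | algebraMap c => exact ⟨c, by rw [sub_self]; exact zero_mem _⟩
    | add x y _ _ hx hy =>
      obtain ⟨c, hc⟩ := hx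
      obtain ⟨d, hd⟩ := hy
      exact ⟨c + d, by rw [map_add, add_sub_add_comm]; exact add_mem hc hd⟩
    | mul x y _ _ hx hy =>
      obtain ⟨c, hc⟩ := hx
      obtain ⟨d, hd⟩ := hy
      refine ⟨c * d, ?_⟩
      have : x * y - algebraMap K R (c * d) =
          x * (y - algebraMap K R d) + algebraMap K R d * (x - algebraMap K R c) := by
        rw [map_mul]; ring
      rw [this]
      exact add_mem (Ideal.mul_mem_left _ _ hd) (Ideal.mul_mem_left _ _ hc)
  intro r hr
  obtain ⟨c, hc⟩ := hall r
  have h1 : algebraMap K R c ∈ maxSubspace K R := by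
    have := sub_mem hr (hle hc)
    rwa [sub_sub_cancel] at this
  rwa [algebraMap_mem_max h1, map_zero, sub_zero] at hc

/-- Invariance moves a factor from `W` onto `b`, which it kills; and `W` generates the maximal ideal
as an ideal. -/
theorem F_socle {b x : R} (hb : ∀ w ∈ maxSubspace K R, b * w = 0) (hx : x ∈ maxSubspace K R) :
    T.F x b = 0 := by
  have h : ∀ r, T.F (r * x) b = 0 := by
    have hs := T.max_le_span_W hx
    clear hx
    induction hs using Submodule.span_induction with
    | mem w hw =>
      intro r
      have := T.F_invariant w hw r b
      rwa [mul_comm w b, hb w (T.W_le hw), map_zero, add_zero, mul_comm] at this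
    | zero => simp
    | add x y _ _ hx hy =>
      intro r
      rw [mul_add, map_add, LinearMap.add_apply, hx, hy, add_zero]
    | smul a w _ hw =>
      intro r
      rw [smul_eq_mul, ← mul_assoc]
      exact hw _
  simpa using h 1

theorem F_one_sub {b x : R} {t : K} (h : x - t • b ∈ T.W) : T.F 1 x = t * T.F 1 b := by
  have := T.F_one_W h
  rw [map_sub, map_smul, sub_eq_zero] at this
  exact this

/-- The form enters the right-hand side only through the functional `F 1`, which kills `1` and `W`
and is thus determined by `W` up to a factor. -/
theorem F_decomp {b w w' : R} (hbm : b ∈ maxSubspace K R)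
    (hb : ∀ w ∈ maxSubspace K R, b * w = 0) (hw : w ∈ T.W) (hw' : w' ∈ T.W) (c t c' t' : K) :
    T.F (c • 1 + t • b + w) (c' • 1 + t' • b + w') =
      (c * t' + c' * t) * T.F 1 b - T.F 1 (w * w') := by
  have h1 := T.F_one_W hw
  have h2 := T.F_one_W hw'
  have h3 : T.F w b = 0 := T.F_socle hb (T.W_le hw)
  have h4 : T.F b w' = 0 := by rw [T.F_symm]; exact T.F_socle hb (T.W_le hw')
  have h5 : T.F b b = 0 := T.F_socle hb hbm
  have h6 : T.F w 1 = 0 := by rw [T.F_symm]; exact h1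
  have h7 : T.F b 1 = T.F 1 b := T.F_symm _ _
  simp only [map_add, LinearMap.add_apply, map_smul, LinearMap.smul_apply, smul_eq_mul, h2, h3, h4,
    h5, h6, h7, T.F_one_one, T.F_eq hw w']
  ring

theorem exists_eq_decomp {b : R} (hbm : b ∈ maxSubspace K R) (hbW : b ∉ T.W) (x : R) :
    ∃ (c t : K), ∃ w ∈ T.W, x = c • 1 + t • b + w := by
  obtain ⟨c, hc⟩ := exists_sub_smul_one_mem (K := K) x
  obtain ⟨t, ht⟩ := T.exists_sub_smul_mem hbm hbW hc
  exact ⟨c, t, _, ht, by abel⟩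

theorem map_mem_maxSubspace (Γ : R ≃ₐ[K] R') {x : R} (hx : x ∈ maxSubspace K R) :
    Γ x ∈ maxSubspace K R' := by
  rw [mem_maxSubspace, IsLocalRing.mem_maximalIdeal, mem_nonunits_iff] at hx ⊢
  rwa [MulEquiv.isUnit_map]

theorem map_mem_maxSq (Γ : R ≃ₐ[K] R') {x : R} (hx : x ∈ maxSq K R) : Γ x ∈ maxSq K R' := by
  have h1 : IsLocalRing.maximalIdeal R ^ 2 ≤
      (IsLocalRing.maximalIdeal R' ^ 2).comap (Γ : R →+* R') := by
    rw [← Ideal.map_le_iff_le_comap, Ideal.map_pow]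
    exact Ideal.pow_right_mono (Ideal.map_le_iff_le_comap.2 fun y hy => map_mem_maxSubspace Γ hy) 2
  exact h1 hx

theorem finrank_maxSq_le (Γ : R ≃ₐ[K] R') : finrank K (maxSq K R) ≤ finrank K (maxSq K R') := by
  rw [← LinearEquiv.finrank_map_eq Γ.toLinearEquiv (maxSq K R)]
  refine Submodule.finrank_mono ?_
  rintro _ ⟨x, hx, rfl⟩
  exact map_mem_maxSq Γ hx

theorem delta_eq (Γ : R ≃ₐ[K] R') : (T.delta : K) = T'.delta := by
  rw [delta, delta, le_antisymm (finrank_maxSq_le Γ) (finrank_maxSq_le Γ.symm)]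

/-- An algebra isomorphism matching two triples, up to a scaling of the forms. -/
structure Similar (T : Triple K R) (T' : Triple K R') (Γ : R ≃ₐ[K] R') (c : K) : Prop where
  ne_zero : c ≠ 0
  mem_W : ∀ x, Γ x ∈ T'.W ↔ x ∈ T.W
  F_map : ∀ x y, T'.F (Γ x) (Γ y) = c * T.F x y

theorem map_mem_W_iff {Γ : R ≃ₐ[K] R'} (hΓ : T.W.map Γ.toLinearMap = T'.W) (x : R) :
    Γ x ∈ T'.W ↔ x ∈ T.W := by
  rw [← hΓ]
  constructor
  · rintro ⟨y, hy, h⟩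
    rwa [← Γ.injective h]
  · exact fun h => ⟨x, h, rfl⟩

/-- By `F_decomp` both forms are given by one formula in terms of `F 1`, and the two functionals
correspond up to the factor read off at `b`. So preserving `W` is enough to preserve the quadric and
everything built from it. -/
theorem similar_of_map {Γ : R ≃ₐ[K] R'} (hΓ : T.W.map Γ.toLinearMap = T'.W) {b : R}
    (hbm : b ∈ maxSubspace K R) (hbW : b ∉ T.W) (hb : ∀ w ∈ maxSubspace K R, b * w = 0) :
    Similar T T' Γ (T'.F 1 (Γ b) / T.F 1 b) := by
  have hW := map_mem_W_iff hΓ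
  have hbm' := map_mem_maxSubspace Γ hbm
  have hbW' : Γ b ∉ T'.W := fun h => hbW ((hW b).1 h)
  have hb' : ∀ w ∈ maxSubspace K R', Γ b * w = 0 := fun w hw => by
    have h1 := hb _ (map_mem_maxSubspace Γ.symm hw)
    rw [← Γ.apply_symm_apply w, ← map_mul, h1, map_zero]
  have h0 := T.F_one_ne_zero hbm hbW
  refine ⟨div_ne_zero (T'.F_one_ne_zero hbm' hbW') h0, hW, fun x y => ?_⟩
  obtain ⟨c, t, w, hw, rfl⟩ := T.exists_eq_decomp hbm hbW x
  obtain ⟨c', t', w', hw', rfl⟩ := T.exists_eq_decomp hbm hbW y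
  obtain ⟨r, hr⟩ := T.exists_sub_smul_mem hbm hbW (mul_mem_maxSubspace w' (T.W_le hw))
  have hr' : Γ w * Γ w' - r • Γ b ∈ T'.W := by
    have := (hW _).2 hr
    rwa [map_sub, map_mul, map_smul] at this
  simp only [map_add, map_smul, map_one]
  have e1 := T'.F_decomp hbm' hb' ((hW w).2 hw) ((hW w').2 hw') c t c' t'
  have e2 := T.F_decomp hbm hb hw hw' c t c' t'
  rw [F_one_sub hr'] at e1
  rw [F_one_sub hr] at e2
  simp only [map_add, map_smul] at e1 e2
  rw [e1, e2]
  field_simp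

namespace Similar

variable {Γ : R ≃ₐ[K] R'} {c : K}

theorem symm (H : Similar T T' Γ c) : Similar T' T Γ.symm c⁻¹ where
  ne_zero := inv_ne_zero H.ne_zero
  mem_W x := by rw [← H.mem_W, Γ.apply_symm_apply]
  F_map x y := by
    have := H.F_map (Γ.symm x) (Γ.symm y)
    rw [Γ.apply_symm_apply, Γ.apply_symm_apply] at this
    rw [this, inv_mul_cancel_left₀ H.ne_zero]

theorem F_eq_zero (H : Similar T T' Γ c) (x y : R) : T'.F (Γ x) (Γ y) = 0 ↔ T.F x y = 0 := by
  rw [H.F_map, mul_eq_zero, or_iff_right H.ne_zero]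

theorem mem_ker (H : Similar T T' Γ c) (x : R) :
    Γ x ∈ LinearMap.ker T'.F ↔ x ∈ LinearMap.ker T.F := by
  rw [LinearMap.mem_ker, LinearMap.mem_ker, LinearMap.ext_iff, LinearMap.ext_iff,
    Γ.surjective.forall]
  exact forall_congr' fun y => H.F_eq_zero x y

theorem mem_upper_lower (H : Similar T T' Γ c) (k : ℕ) :
    (∀ x, Γ x ∈ T'.upper k ↔ x ∈ T.upper k) ∧ ∀ x, Γ x ∈ T'.lower k ↔ x ∈ T.lower k := by
  induction k with
  | zero => exact ⟨H.mem_W, H.mem_ker⟩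
  | succ k ih =>
    have h1 : ∀ x, Γ x ∈ T'.upper (k + 1) ↔ x ∈ T.upper (k + 1) := by
      intro x
      rw [mem_upper_succ, mem_upper_succ, ih.1, Γ.surjective.forall]
      refine and_congr_right fun _ => forall_congr' fun y => ?_
      rw [ih.2, ← map_mul, EmbeddingLike.map_eq_zero_iff]
    refine ⟨h1, fun x => ?_⟩
    rw [mem_lower_succ, mem_lower_succ, h1, Γ.surjective.forall]
    refine and_congr_right fun _ => forall_congr' fun y => ?_
    rw [h1, H.F_eq_zero]

theorem mem_upper (H : Similar T T' Γ c) {k : ℕ} {x : R} : Γ x ∈ T'.upper k ↔ x ∈ T.upper k :=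
  (H.mem_upper_lower k).1 x

theorem mem_lower (H : Similar T T' Γ c) {k : ℕ} {x : R} : Γ x ∈ T'.lower k ↔ x ∈ T.lower k :=
  (H.mem_upper_lower k).2 x

theorem prodZero (H : Similar T T' Γ c) (k : ℕ) : T'.ProdZero k ↔ T.ProdZero k := by
  rw [ProdZero, ProdZero, Γ.surjective.forall]
  refine forall_congr' fun x => ?_
  rw [H.mem_upper, Γ.surjective.forall]
  refine imp_congr_right fun _ => forall_congr' fun y => ?_
  rw [H.mem_lower, ← map_mul, EmbeddingLike.map_eq_zero_iff]

theorem lower_le (H : Similar T T' Γ c) (j k : ℕ) :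
    T'.lower j ≤ T'.lower k ↔ T.lower j ≤ T.lower k := by
  rw [SetLike.le_def, SetLike.le_def, Γ.surjective.forall]
  exact forall_congr' fun x => by rw [H.mem_lower, H.mem_lower]

theorem lower_eq (H : Similar T T' Γ c) (j k : ℕ) :
    T'.lower j = T'.lower k ↔ T.lower j = T.lower k := by
  rw [le_antisymm_iff, le_antisymm_iff, H.lower_le, H.lower_le]

theorem lower_eq_upper (H : Similar T T' Γ c) (j k : ℕ) :
    T'.lower j = T'.upper k ↔ T.lower j = T.upper k := by
  rw [SetLike.ext_iff, SetLike.ext_iff, Γ.surjective.forall]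
  exact forall_congr' fun x => by rw [H.mem_lower, H.mem_upper]

theorem stops (H : Similar T T' Γ c) (k : ℕ) : T'.Stops k ↔ T.Stops k := by
  rw [Stops, Stops, H.prodZero, H.lower_le, H.lower_eq]

open Classical in
theorem level (H : Similar T T' Γ c) : T'.level = T.level := by
  unfold Triple.level
  exact (Nat.find_eq_iff _).2 ⟨(H.stops _).2 (Nat.find_spec T.exists_stops),
    fun n hn h => Nat.find_min T.exists_stops hn ((H.stops n).1 h)⟩

open Classical in
theorem letter (H : Similar T T' Γ c) : T'.letter = T.letter := by
  unfold Triple.letter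
  rw [H.level]
  exact if_congr (H.prodZero _) rfl (if_congr (not_congr (H.lower_le _ _)) rfl rfl)

theorem normalType (H : Similar T T' Γ c) : T'.normalType = T.normalType := by
  unfold Triple.normalType
  rw [H.level, H.letter]
  simp only [H.lower_eq_upper]

end Similar

/-! ### Orbits -/

/-- The stabilizer is the annihilator of the representative in `W`, so orbit dimensions are ranks of
multiplication maps. -/
theorem orbitDim_eq (p : Projectivization K R) :
    T.orbitDim p = finrank K (T.W.map (LinearMap.mulRight K p.rep)) := by
  have h1 : T.stabilizer p = LinearMap.ker ((LinearMap.mulRight K p.rep).domRestrict T.W) := by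
    ext w
    exact T.act_eq_iff w p
  rw [orbitDim, h1, (LinearMap.quotKerEquivRange _).finrank_eq, LinearMap.range_domRestrict]

theorem orbitDim_mk {v : R} (hv : v ≠ 0) :
    T.orbitDim (Projectivization.mk K v hv) = finrank K (T.W.map (LinearMap.mulRight K v)) := by
  obtain ⟨a, ha⟩ := Projectivization.exists_smul_eq_mk_rep K v hv
  have h1 : LinearMap.mulRight K ((a : K) • v) = (a : K) • LinearMap.mulRight K v := by
    ext x
    simp
  rw [orbitDim_eq, ← ha, Units.smul_def, h1, Submodule.map_smul _ _ _ a.ne_zero]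

theorem mk_mem_quadric {v : R} (hv : v ≠ 0) :
    Projectivization.mk K v hv ∈ T.quadric ↔ T.F v v = 0 := by
  obtain ⟨a, ha⟩ := Projectivization.exists_smul_eq_mk_rep K v hv
  rw [quadric, Set.mem_ofPred_eq, ← ha, Units.smul_def]
  simp

theorem act_mk_one (w : T.W) : T.act w (Projectivization.mk K (1 : R) one_ne_zero) =
    Projectivization.mk K (expNil K (w : R)) (isUnit_expNil (T.W_le w.2)).ne_zero := by
  have h : ∀ (x : R) (hx : x ≠ 0), x = expNil K (w : R) → Projectivization.mk K x hx =
      Projectivization.mk K (expNil K (w : R)) (isUnit_expNil (T.W_le w.2)).ne_zero := by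
    rintro x hx rfl
    rfl
  exact h _ _ (mul_one _)

theorem mk_mem_openOrbit {v : R} (hv : v ≠ 0) :
    Projectivization.mk K v hv ∈ T.openOrbit ↔ ∃ w ∈ T.W, ∃ c : K, c • v = expNil K w := by
  constructor
  · rintro ⟨w, hw⟩
    have h1 := (T.act_mk_one w).symm.trans hw
    rw [Projectivization.mk_eq_mk_iff'] at h1
    exact ⟨w, w.2, h1⟩
  · rintro ⟨w, hw, c, hc⟩
    refine ⟨⟨w, hw⟩, (T.act_mk_one ⟨w, hw⟩).trans ?_⟩
    rw [Projectivization.mk_eq_mk_iff']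
    exact ⟨c, hc⟩

/-- The dimensions of the orbits in the boundary. -/
def boundaryDims (T : Triple K R) : Set ℕ :=
  {n | ∃ v : R, v ≠ 0 ∧ T.F v v = 0 ∧ (∀ w ∈ T.W, ∀ c : K, c • v ≠ expNil K w) ∧
    finrank K (T.W.map (LinearMap.mulRight K v)) = n}

theorem maxBoundaryDim_eq : T.maxBoundaryDim = sSup T.boundaryDims := by
  rw [maxBoundaryDim]
  congr 1
  ext n
  constructor
  · rintro ⟨p, ⟨hp, hpO⟩, rfl⟩
    induction p using Projectivization.ind with
    | h v hv =>
      refine ⟨v, hv, (mk_mem_quadric hv).1 hp, fun w hw c h => ?_, (orbitDim_mk hv).symm⟩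
      exact hpO ((mk_mem_openOrbit hv).2 ⟨w, hw, c, h⟩)
  · rintro ⟨v, hv, hF, hO, rfl⟩
    refine ⟨Projectivization.mk K v hv, ⟨(mk_mem_quadric hv).2 hF, fun h => ?_⟩, orbitDim_mk hv⟩
    obtain ⟨w, hw, c, hc⟩ := (mk_mem_openOrbit hv).1 h
    exact hO w hw c hc

theorem bddAbove_boundaryDims : BddAbove T.boundaryDims := by
  refine ⟨finrank K T.W, ?_⟩
  rintro _ ⟨v, _, _, _, rfl⟩
  exact Submodule.finrank_map_le _ _

theorem Similar.boundaryDims_le {Γ : R ≃ₐ[K] R'} {c : K} (H : Similar T T' Γ c) :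
    T.boundaryDims ⊆ T'.boundaryDims := by
  rintro _ ⟨v, hv, hF, hO, rfl⟩
  refine ⟨Γ v, by simpa using hv, (H.F_eq_zero v v).2 hF, fun w hw a ha => ?_, ?_⟩
  · apply hO (Γ.symm w) (H.symm.mem_W w |>.2 hw) a
    apply Γ.injective
    rw [map_smul, ha, expNil, expNil, map_sum, Γ.toLinearEquiv.finrank_eq]
    simp
  · rw [← LinearEquiv.finrank_map_eq Γ.toLinearEquiv (T.W.map (LinearMap.mulRight K v))]
    suffices h : T'.W.map (LinearMap.mulRight K (Γ v)) =
        (T.W.map (LinearMap.mulRight K v)).map (Γ.toLinearEquiv : R →ₗ[K] R') by rw [h]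
    ext x
    constructor
    · rintro ⟨w, hw, rfl⟩
      refine ⟨Γ.symm w * v, ⟨Γ.symm w, H.symm.mem_W w |>.2 hw, rfl⟩, ?_⟩
      simp
    · rintro ⟨_, ⟨w, hw, rfl⟩, rfl⟩
      exact ⟨Γ w, (H.mem_W w).2 hw, by simp⟩

theorem Similar.maxBoundaryDim {Γ : R ≃ₐ[K] R'} {c : K} (H : Similar T T' Γ c) :
    T'.maxBoundaryDim = T.maxBoundaryDim := by
  rw [maxBoundaryDim_eq, maxBoundaryDim_eq, H.boundaryDims_le.antisymm H.symm.boundaryDims_le]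

end Transport

end Triple

end AdditiveQuadric

namespace AdditiveQuadric

/-! ### Tables versus normalized sets, and rescaling -/

section TableChange

variable {K R : Type*} [Field K] [CommRing R] [IsLocalRing R] [Algebra K R]
variable [FiniteDimensional K R] [IsAlgClosed K] [CharZero K]
variable {T : Triple K R} {L : Triple.Letter} {s : ℕ} {h : K} {ι : Type*} {M : Matrix ι ι K}

/-- The table underlying a normalized set. -/
noncomputable def NormalizedSet.toTable {I : K} (N : NormalizedSet I T) :
    Table T T.letter T.level (T.delta : K) (N.blocks.matrix I) where
  μ₁ := N.μ₁
  b₀ := N.b₀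
  f := N.f
  g := N.g
  e := N.e
  b₀_mem := N.b₀_mem
  b₀_notMem := N.b₀_notMem
  b₀_mul := N.b₀_mul
  μ₁_mul := N.μ₁_mul
  ker_eq := by rw [N.g_zero]; exact N.ker_eq
  ker_li := by
    have h := N.linearIndependent.comp ![.inl (), .inr (.inl 0)] (by
      intro a b
      fin_cases a <;> fin_cases b <;> simp)
    convert h using 1
    ext i
    fin_cases i <;> rfl
  f_mem := T.numF_eq ▸ N.f_mem
  g_mem := N.g_mem
  e_mem k := by
    rw [← T.numF_eq, N.upper_eq]
    exact Submodule.mem_sup_right (Submodule.subset_span ⟨k, rfl⟩)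
  upper_le := by
    rw [← T.numF_eq]
    exact N.upper_eq.le
  W_le_span := by
    rw [← N.span_eq]
    apply span_range_le
    rintro (_ | j | k | i)
    · exact Submodule.mem_sup_left (Submodule.mem_sup_left (Submodule.mem_sup_left
        (Submodule.mem_span_singleton_self _)))
    · exact Submodule.mem_sup_left (Submodule.mem_sup_left (Submodule.mem_sup_right
        (Submodule.subset_span ⟨j, Nat.lt_succ_iff.1 j.2, rfl⟩)))
    · exact Submodule.mem_sup_left (Submodule.mem_sup_right (Submodule.subset_span ⟨k, rfl⟩))
    · exact Submodule.mem_sup_right (Submodule.subset_span ⟨i, T.numF_eq ▸ i.2, rfl⟩)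
  e_mul_e k l := by
    rw [N.e_mul_e]
    congr
  e_mul_f := T.numF_eq ▸ N.e_mul_f
  e_mul_g := N.e_mul_g
  g_mul_g := N.g_mul_g
  f_mul_g := T.numF_eq ▸ N.f_mul_g
  f_mul_f := T.numF_eq ▸ N.f_mul_f
  f_sq := by
    rw [N.g_zero, ← T.numF_eq]
    exact N.f_sq

namespace Table

/-- Elements of `V^(N)` kill `g_0, …, g_(N-1)`, and these detect the coefficients of the `f_i`. -/
theorem coeff_f_of_mem_upper [Fintype ι] (X : Table T L s h M) {α : K} {β : ℕ → K} {κ : ι → K}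
    {d : ℕ → K} (hx : X.comb α β κ d ∈ T.upper (numFOf L s)) {i : ℕ} (hi : i < numFOf L s) :
    d i = 0 := by
  have hN := numFOf_le L s
  exact X.coeff_f_eq_zero hi ((Triple.upper_antitone (show i + 1 ≤ _ by omega) hx).2 _
    (X.g_mem_lower (by omega)))

theorem F_one_b₀_ne (X : Table T L s h M) : T.F 1 X.b₀ ≠ 0 :=
  T.F_one_ne_zero (maxSq_le X.b₀_mem) X.b₀_notMem

theorem F_comb_e [Fintype ι] (X : Table T L s h M) (α : K) (β : ℕ → K) (κ : ι → K) (d : ℕ → K)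
    (k : ι) : T.F (X.comb α β κ d) (X.e k) = -(κ k * T.F 1 X.b₀) := by
  rw [T.F_eq (X.comb_mem _ _ _ _), X.comb_mul_e, map_add, map_smul, map_smul, T.F_one_W X.μ₁_mem,
    smul_zero, add_zero, smul_eq_mul]

theorem coeff_e_of_mem_lower [Fintype ι] (X : Table T L s h M) {α : K} {β : ℕ → K} {κ : ι → K}
    {d : ℕ → K} (hx : X.comb α β κ d ∈ T.lower (numFOf L s)) (k : ι) : κ k = 0 := by
  rw [Triple.lower_eq_radOn] at hx
  have h1 := radOn_sub_mem T.F_symm hx (X.e_mem k)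
  rw [T.F_symm, X.F_comb_e, neg_eq_zero, mul_eq_zero, or_iff_left X.F_one_b₀_ne] at h1
  exact h1

/-- `F`-orthogonality to the `e_k` removes the `e`-components. For the letter `B` this later
excludes a component along `g_s` in the images of the `e_k`. -/
theorem mul_e_of_mem_lower [Fintype ι] (X : Table T L s h M) {x : R}
    (hx : x ∈ T.lower (numFOf L s)) (k : ι) : x * X.e k = 0 := by
  obtain ⟨α, β, κ, d, rfl⟩ := X.exists_comb
    (Triple.upper_le_W _ (Triple.lower_le_upper _ hx))
  rw [X.comb_mul_e]
  simp [X.coeff_e_of_mem_lower hx]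

/-- The normalized set given by a table with a canonical matrix. -/
noncomputable def toNormalizedSet {I : K} {d : BlockData K}
    (X : Table T T.letter T.level (T.delta : K) (d.matrix I)) (hb : T.F 1 X.b₀ = -1) :
    NormalizedSet I T where
  μ₁ := X.μ₁
  μ₂ := X.g 0
  b₀ := X.b₀
  f := X.f
  g := X.g
  blocks := d
  e := X.e
  b₀_mem := X.b₀_mem
  b₀_notMem := X.b₀_notMem
  F_one_b₀ := hb
  b₀_mul := X.b₀_mul
  μ₁_mul := X.μ₁_mul
  g_zero := rfl
  ker_eq := X.ker_eq
  f_mem := T.numF_eq ▸ X.f_mem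
  g_mem := X.g_mem
  upper_eq := by
    rw [T.numF_eq]
    exact le_antisymm X.upper_le (sup_le (Triple.lower_le_upper _) (span_range_le X.e_mem))
  upper_disjoint := by
    rw [T.numF_eq, Submodule.disjoint_def]
    intro x hx hx'
    obtain ⟨κ, rfl⟩ := (Submodule.mem_span_range_iff_exists_fun K).1 hx'
    have h1 : ∑ k, κ k • X.e k = X.comb 0 0 κ 0 := by simp [comb]
    rw [h1] at hx
    exact Finset.sum_eq_zero fun k _ => by rw [X.coeff_e_of_mem_lower hx k, zero_smul]
  linearIndependent := by
    have h := X.linearIndependent_family.comp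
      (Sum.map id (Sum.map id (Sum.map id (Fin.cast T.numF_eq))))
      (Function.injective_id.sumMap (Function.injective_id.sumMap
        (Function.injective_id.sumMap (Fin.cast_injective _))))
    convert h using 1
    ext (_ | j | k | i) <;> rfl
  span_eq := by
    rw [← X.span_family]
    have h : Function.Surjective (Sum.map (id : Unit → Unit)
        (Sum.map (id : Fin (T.level + 1) → _) (Sum.map (id : d.Index → _) (Fin.cast T.numF_eq)))) :=
      Function.surjective_id.sumMap (Function.surjective_id.sumMap
        (Function.surjective_id.sumMap (finCongr T.numF_eq).surjective))
    rw [← h.range_comp]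
    congr 2
    ext (_ | j | k | i) <;> rfl
  e_mul_e k l := by
    rw [X.e_mul_e]
    congr
  e_mul_f := T.numF_eq ▸ X.e_mul_f
  e_mul_g := X.e_mul_g
  g_mul_g := X.g_mul_g
  f_mul_g := T.numF_eq ▸ X.f_mul_g
  f_mul_f := T.numF_eq ▸ X.f_mul_f
  f_sq := T.numF_eq ▸ X.f_sq

/-- Multiplication of the elements of a table by scalars. -/
noncomputable def rescale (X : Table T L s h M) {a v r q : K} (ha : a ≠ 0) (hv : v ≠ 0)
    (hq : q ≠ 0) (hr : r = a * q ^ 2) (hB : L = .B → r = v ^ 2) (hC : L = .C → v ^ 2 = a * r) :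
    Table T L s (h * r ^ 2 * (a ^ s * v)⁻¹ ^ 3) (a⁻¹ • M) := by
  -- The scalars are dictated by the table: `f_i g_(i-1)` must scale by `r` like `μ₁`, and `f_i g_i`
  -- by `r / a = q²` like `b₀`. The squares of `g_s` for the letter `B` and of `f_(s+1)` for the
  -- letter `C` impose `hB` and `hC`.
  have hr0 : r ≠ 0 := by rw [hr]; exact mul_ne_zero ha (pow_ne_zero 2 hq)
  have hg : ∀ j, a ^ (s - j) * v ≠ 0 := fun j => mul_ne_zero (pow_ne_zero _ ha) hv
  have hf : ∀ i, r * (a ^ (s + 1 - i) * v)⁻¹ ≠ 0 := fun i =>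
    mul_ne_zero hr0 (inv_ne_zero (mul_ne_zero (pow_ne_zero _ ha) hv))
  have hmem : ∀ {c : K} {x : R} {S : Submodule K R}, c ≠ 0 → c • x ∈ S → x ∈ S :=
    fun hc hx => (Submodule.smul_mem_iff _ hc).1 hx
  have hN := numFOf_le L s
  exact
  { μ₁ := r • X.μ₁
    b₀ := q ^ 2 • X.b₀
    f := fun i => (r * (a ^ (s + 1 - i) * v)⁻¹) • X.f i
    g := fun j => (a ^ (s - j) * v) • X.g j
    e := fun k => q • X.e k
    b₀_mem := Submodule.smul_mem _ _ X.b₀_mem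
    b₀_notMem := fun h => X.b₀_notMem (hmem (pow_ne_zero 2 hq) h)
    b₀_mul := fun w hw => by rw [smul_mul_assoc, X.b₀_mul w hw, smul_zero]
    μ₁_mul := fun w hw => by rw [smul_mul_assoc, X.μ₁_mul w hw, smul_zero]
    ker_eq := by
      rw [X.ker_eq, Submodule.span_insert, Submodule.span_insert,
        Submodule.span_singleton_smul_eq (IsUnit.mk0 _ hr0),
        Submodule.span_singleton_smul_eq (IsUnit.mk0 _ (hg 0))]
    ker_li := by
      rw [LinearIndependent.pair_iff]
      intro x y hxy
      rw [smul_smul, smul_smul] at hxy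
      obtain ⟨h1, h2⟩ := LinearIndependent.pair_iff.1 X.ker_li _ _ hxy
      exact ⟨(mul_eq_zero.1 h1).resolve_right hr0, (mul_eq_zero.1 h2).resolve_right (hg 0)⟩
    f_mem := fun i h1 h2 => ⟨Submodule.smul_mem _ _ (X.f_mem i h1 h2).1,
      fun h => (X.f_mem i h1 h2).2 (hmem (hf i) h)⟩
    g_mem := fun j h1 h2 => ⟨Submodule.smul_mem _ _ (X.g_mem j h1 h2).1,
      fun h => (X.g_mem j h1 h2).2 (hmem (hg j) h)⟩
    e_mem := fun k => Submodule.smul_mem _ _ (X.e_mem k)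
    upper_le := X.upper_le.trans (sup_le_sup_left (span_range_le fun k =>
      hmem hq (Submodule.subset_span (Set.mem_range_self k))) _)
    W_le_span := by
      refine X.W_le ?_ ?_ ?_ ?_
      · exact Submodule.mem_sup_left (Submodule.mem_sup_left (Submodule.mem_sup_left
          (hmem hr0 (Submodule.mem_span_singleton_self _))))
      · exact fun j hj => Submodule.mem_sup_left (Submodule.mem_sup_left (Submodule.mem_sup_right
          (hmem (hg j) (Submodule.subset_span ⟨j, hj, rfl⟩))))
      · exact fun k => Submodule.mem_sup_left (Submodule.mem_sup_right
          (hmem hq (Submodule.subset_span ⟨k, rfl⟩)))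
      · rintro (_ | i) h1 h2
        · omega
        · exact Submodule.mem_sup_right (hmem (hf (i + 1)) (Submodule.subset_span ⟨i, h2, rfl⟩))
    e_mul_e := fun k l => by
      rw [smul_mul_smul_comm, X.e_mul_e, smul_add, smul_ite, smul_zero, smul_smul, Matrix.smul_apply,
        smul_smul, smul_eq_mul, ← pow_two]
      congr 2
      rw [hr]
      field_simp
    e_mul_f := fun k i h1 h2 => by rw [smul_mul_smul_comm, X.e_mul_f k i h1 h2, smul_zero]
    e_mul_g := fun k j h1 => by rw [smul_mul_smul_comm, X.e_mul_g k j h1, smul_zero]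
    g_mul_g := fun i j hi hj => by
      rw [smul_mul_smul_comm, X.g_mul_g i j hi hj, smul_ite, smul_zero]
      split_ifs with h1
      · obtain ⟨h1, rfl, rfl⟩ := h1
        congr 1
        rw [hB h1, Nat.sub_self]
        ring
      · rfl
    f_mul_g := fun i j h1 h2 hj => by
      rw [smul_mul_smul_comm, X.f_mul_g i j h1 h2 hj]
      split_ifs with h3 h4
      · subst h3
        congr 1
        rw [hr, show s + 1 - i = (s - i) + 1 by omega]
        have := hg i
        field_simp
        ring
      · subst h4
        congr 1
        rw [show s + 1 - (j + 1) = s - j by omega, inv_mul_cancel_right₀ (hg j)]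
      · rw [smul_zero]
    f_mul_f := fun i j h1 h2 hj => by rw [smul_mul_smul_comm, X.f_mul_f i j h1 h2 hj, smul_zero]
    f_sq := fun i h1 h2 => by
      rw [smul_mul_smul_comm, X.f_sq i h1 h2, smul_add, smul_ite, smul_ite, smul_zero]
      congr 1
      · split_ifs with h3
        · subst h3
          rw [smul_smul, smul_smul, show s + 1 - 1 = s by omega, Nat.sub_zero]
          congr 1
          have := hg 0
          field_simp
        · rfl
      · split_ifs with h3
        · subst h3
          have hL : L = .C := by
            cases L
            · simp [numFOf] at h2
            · simp [numFOf] at h2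
            · rfl
          congr 1
          have h4 := hC hL
          rw [Nat.sub_self, pow_zero, one_mul]
          field_simp
          rw [h4, hr]
          ring
        · rfl }

end Table

end TableChange

end AdditiveQuadric

namespace AdditiveQuadric

/-! ### Orthogonal reduction of a symmetric matrix -/

section Orthogonal

variable {K : Type*} [Field K]

open Matrix in
/-- A symmetric matrix is orthogonally similar to a canonical one. -/
theorem exists_orthogonal_canonical (I : K) (hI : I ^ 2 = -1) [IsAlgClosed K] [CharZero K]
    {ι : Type*} [Fintype ι] [DecidableEq ι] (M : Matrix ι ι K) (hM : M.IsSymm) :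
    ∃ (d : BlockData K) (P : Matrix ι d.Index K), Pᵀ * P = 1 ∧ P * Pᵀ = 1 ∧
      Pᵀ * M * P = d.matrix I := by
  have hF : ∀ x y : ι → K, Matrix.toBilin' (1 : Matrix ι ι K) x y = x ⬝ᵥ y := fun x y => by
    rw [Matrix.toBilin'_apply', one_mulVec]
  have hG : ∀ x y : ι → K, Matrix.toBilin' M x y = x ⬝ᵥ M *ᵥ y := fun x y =>
    Matrix.toBilin'_apply' _ _ _
  obtain ⟨d, e, hsp, h1, h2⟩ := exists_canonical_basis I hI (Matrix.toBilin' (1 : Matrix ι ι K))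
    (Matrix.toBilin' M) (fun x y => by rw [hF, hF, dotProduct_comm])
    (fun x y => by rw [hG, hG, dotProduct_mulVec, dotProduct_comm, ← mulVec_transpose, hM.eq])
    _ ⊤ rfl (fun x _ hx => by
      ext i
      have := hx (Pi.single i 1) trivial
      rwa [hF, dotProduct_single, mul_one] at this)
  have hli : LinearIndependent K e := by
    rw [Fintype.linearIndependent_iff]
    intro c hc k
    have h3 := congrArg (fun x => Matrix.toBilin' (1 : Matrix ι ι K) x (e k)) hc
    simpa [map_sum, h1] using h3
  have hcard : Fintype.card d.Index = Fintype.card ι := by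
    have h3 := finrank_span_eq_card hli
    rw [hsp, finrank_top, finrank_fintype_fun_eq_card] at h3
    exact h3.symm
  let P : Matrix ι d.Index K := Matrix.of fun k j => e j k
  have hP : Pᵀ * P = 1 := by
    ext k l
    have h3 := h1 k l
    rw [hF] at h3
    rw [Matrix.mul_apply', Matrix.one_apply, ← h3]
    rfl
  refine ⟨d, P, hP, (Matrix.mul_eq_one_comm_of_equiv (Fintype.equivOfCardEq hcard)).1 hP, ?_⟩
  ext k l
  rw [← h2 k l, hG, Matrix.mul_assoc, Matrix.mul_apply']
  rfl

end Orthogonal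

/-! ### Changes of a table, and the meaning of the scalar `h` -/

section TableChange

variable {K R : Type*} [Field K] [CommRing R] [IsLocalRing R] [Algebra K R]
variable [FiniteDimensional K R] [IsAlgClosed K] [CharZero K]
variable {T : Triple K R} {L : Triple.Letter} {s : ℕ} {h : K} {ι : Type*} {M : Matrix ι ι K}

namespace Table

open Matrix in
/-- An orthogonal change of the elements `e_k`. -/
noncomputable def changeE [Fintype ι] [DecidableEq ι] {ι' : Type*} [Fintype ι'] [DecidableEq ι']
    (X : Table T L s h M) (P : Matrix ι ι' K) (hP : Pᵀ * P = 1) (hP' : P * Pᵀ = 1) :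
    Table T L s h (Pᵀ * M * P) :=
  -- Orthogonality of `P` lets the old `e_k` be recovered from the new ones, so the spans agree.
  have he : ∀ {S : Submodule K R}, (∀ j, ∑ k, P k j • X.e k ∈ S) → ∀ k, X.e k ∈ S := by
    intro S hS k
    have h1 : X.e k = ∑ j, P k j • ∑ l, P l j • X.e l := by
      simp only [Finset.smul_sum, smul_smul]
      rw [Finset.sum_comm]
      simp only [← Finset.sum_smul]
      have h2 : ∀ l, ∑ j, P k j * P l j = (1 : Matrix ι ι K) k l := fun l => by
        rw [← hP', Matrix.mul_apply]
        rfl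
      simp [h2, Matrix.one_apply]
    rw [h1]
    exact Submodule.sum_mem _ fun j _ => S.smul_mem _ (hS j)
  { X with
    e := fun j => ∑ k, P k j • X.e k
    e_mem := fun j => Submodule.sum_mem _ fun k _ => Submodule.smul_mem _ _ (X.e_mem k)
    upper_le := X.upper_le.trans (sup_le_sup_left (span_range_le (he fun j =>
      Submodule.subset_span (Set.mem_range_self j))) _)
    W_le_span := X.W_le_span.trans (sup_le_sup_right (sup_le_sup_left (span_range_le (he fun j =>
      Submodule.subset_span (Set.mem_range_self j))) _) _)
    e_mul_e := fun i j => by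
      have h1 : ∀ k l, (P k i • X.e k) * (P l j • X.e l) =
          (P k i * (1 : Matrix ι ι K) k l * P l j) • X.b₀ + (P k i * M k l * P l j) • X.μ₁ := by
        intro k l
        rw [smul_mul_smul_comm, X.e_mul_e, smul_add, smul_smul, Matrix.one_apply]
        congr 1
        · by_cases hkl : k = l
          · simp [hkl]
          · simp [hkl]
        · congr 1
          ring
      have h2 : ∀ N : Matrix ι ι K, ∑ k, ∑ l, P k i * N k l * P l j = (Pᵀ * N * P) i j := by
        intro N
        simp only [Matrix.mul_apply, Finset.sum_mul, Matrix.transpose_apply]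
        rw [Finset.sum_comm]
      simp only [Finset.sum_mul_sum, h1, Finset.sum_add_distrib, ← Finset.sum_smul, h2]
      rw [Matrix.mul_one, hP, Matrix.one_apply, ite_smul, one_smul, zero_smul]
      congr
    e_mul_f := fun j i h1 h2 => by
      rw [Finset.sum_mul]
      exact Finset.sum_eq_zero fun k _ => by rw [smul_mul_assoc, X.e_mul_f k i h1 h2, smul_zero]
    e_mul_g := fun j i h1 => by
      rw [Finset.sum_mul]
      exact Finset.sum_eq_zero fun k _ => by rw [smul_mul_assoc, X.e_mul_g k i h1, smul_zero] }

theorem isSymm (X : Table T L s h M) : M.IsSymm := by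
  ext k l
  have h1 : X.e k * X.e l - X.e l * X.e k = 0 := by ring
  rw [X.e_mul_e, X.e_mul_e] at h1
  have h2 : (M k l - M l k) • X.μ₁ = 0 := by
    rw [sub_smul, ← h1]
    by_cases hkl : k = l
    · subst hkl; simp
    · rw [if_neg hkl, if_neg (Ne.symm hkl)]; simp
  rw [smul_eq_zero, or_iff_left X.μ₁_ne, sub_eq_zero] at h2
  exact h2.symm

/-- The scalar `h` is irrelevant when there are no elements `f_i`. -/
def relabel (X : Table T L s h M) (hN : numFOf L s = 0) (h' : K) : Table T L s h' M :=
  { X with f_sq := fun i h1 h2 => by omega }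

def castMatrix (X : Table T L s h M) {M' : Matrix ι ι K} (hM : M = M') : Table T L s h M' :=
  hM ▸ X

/-! ### The square of the maximal ideal -/

/-- All products in the table are combinations of `μ₁`, `b₀` and `h • g_0`, the last occurring only
in `f_1²`. -/
theorem W_mul_W_le (X : Table T L s h M) {S : Submodule K R} (h1 : X.μ₁ ∈ S) (h2 : X.b₀ ∈ S)
    (h3 : h • X.g 0 ∈ S) {x y : R} (hx : x ∈ T.W) (hy : y ∈ T.W) : x * y ∈ S := by
  have key : ∀ x y : R, (∀ z ∈ T.W, z * x ∈ S) → ∀ z ∈ T.W, x * z ∈ S := fun x y h z hz => by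
    rw [mul_comm]; exact h z hz
  -- reduction of the right factor
  have hW : ∀ x : R, x * X.μ₁ ∈ S → (∀ j ≤ s, x * X.g j ∈ S) → (∀ k, x * X.e k ∈ S) →
      (∀ i, 1 ≤ i → i ≤ numFOf L s → x * X.f i ∈ S) → ∀ y ∈ T.W, x * y ∈ S := fun x a1 a2 a3 a4 =>
    X.W_le (S := S.comap (LinearMap.mulLeft K x)) a1 a2 a3 a4
  have hμ : ∀ y ∈ T.W, X.μ₁ * y ∈ S := fun y hy => by
    rw [X.μ₁_mul y (T.W_le hy)]; exact zero_mem S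
  have hμ' : ∀ y ∈ T.W, y * X.μ₁ ∈ S := fun y hy => by
    rw [mul_comm]; exact hμ y hy
  have hgf : ∀ i j, 1 ≤ i → i ≤ numFOf L s → j ≤ s → X.f i * X.g j ∈ S := by
    intro i j hi1 hi hj
    rw [X.f_mul_g i j hi1 hi hj]
    split_ifs
    exacts [h2, h1, zero_mem S]
  have heg : ∀ k j, j ≤ s → X.e k * X.g j ∈ S := fun k j hj => by
    rw [X.e_mul_g k j hj]; exact zero_mem S
  have hef : ∀ k i, 1 ≤ i → i ≤ numFOf L s → X.e k * X.f i ∈ S := fun k i hi1 hi => by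
    rw [X.e_mul_f k i hi1 hi]; exact zero_mem S
  have hg : ∀ j ≤ s, ∀ y ∈ T.W, X.g j * y ∈ S := by
    intro j hj
    refine hW _ (hμ' _ (X.g_mem_W hj)) (fun i hi => ?_) (fun k => ?_) (fun i hi1 hi => ?_)
    · rw [X.g_mul_g j i hj hi]
      split_ifs
      exacts [h1, zero_mem S]
    · rw [mul_comm]; exact heg k j hj
    · rw [mul_comm]; exact hgf i j hi1 hi hj
  have he : ∀ k, ∀ y ∈ T.W, X.e k * y ∈ S := by
    intro k
    refine hW _ (hμ' _ (X.e_mem_W k)) (fun i hi => heg k i hi) (fun l => ?_) (hef k)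
    rw [X.e_mul_e]
    refine S.add_mem ?_ (S.smul_mem _ h1)
    split_ifs
    exacts [h2, zero_mem S]
  have hf : ∀ i, 1 ≤ i → i ≤ numFOf L s → ∀ y ∈ T.W, X.f i * y ∈ S := by
    intro i hi1 hi
    refine hW _ (hμ' _ (X.f_mem_W hi1 hi)) (fun j hj => hgf i j hi1 hi hj) (fun k => ?_)
      (fun j hj1 hj => ?_)
    · rw [mul_comm]; exact hef k i hi1 hi
    · rcases lt_trichotomy i j with hij | rfl | hij
      · rw [X.f_mul_f i j hi1 hij hj]; exact zero_mem S
      · rw [X.f_sq i hi1 hi]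
        refine S.add_mem ?_ ?_
        · split_ifs
          exacts [h3, zero_mem S]
        · split_ifs
          exacts [h2, zero_mem S]
      · rw [mul_comm, X.f_mul_f j i hj1 hij hi]; exact zero_mem S
  rw [mul_comm]
  exact hW y (hμ' y hy) (fun j hj => by rw [mul_comm]; exact hg j hj y hy)
    (fun k => by rw [mul_comm]; exact he k y hy)
    (fun i hi1 hi => by rw [mul_comm]; exact hf i hi1 hi y hy) x hx

theorem exists_decomp (X : Table T L s h M) {x : R} (hx : x ∈ maxSubspace K R) :
    ∃ t : K, ∃ w ∈ T.W, x = t • X.b₀ + w := by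
  obtain ⟨t, ht⟩ := T.exists_sub_smul_mem (maxSq_le X.b₀_mem) X.b₀_notMem hx
  exact ⟨t, _, ht, by abel⟩

theorem mul_decomp (X : Table T L s h M) {w w' : R} (hw : w ∈ T.W) (hw' : w' ∈ T.W) (t t' : K) :
    (t • X.b₀ + w) * (t' • X.b₀ + w') = w * w' := by
  have h1 := X.b₀_mul w (T.W_le hw)
  have h2 := X.b₀_mul w' (T.W_le hw')
  have h3 := X.b₀_mul X.b₀ (maxSq_le X.b₀_mem)
  simp only [add_mul, mul_add, smul_mul_assoc, mul_smul_comm, h2, h3, mul_comm w X.b₀, h1]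
  simp

theorem maxSq_le (X : Table T L s h M) {S : Submodule K R} (h1 : X.μ₁ ∈ S) (h2 : X.b₀ ∈ S)
    (h3 : h • X.g 0 ∈ S) : maxSq K R ≤ S := by
  intro x hx
  have hx' : x ∈ IsLocalRing.maximalIdeal R ^ 2 := hx
  rw [pow_two] at hx'
  refine Submodule.mul_induction_on hx' (fun a ha b hb => ?_) fun _ _ => S.add_mem
  obtain ⟨t, w, hw, rfl⟩ := X.exists_decomp ha
  obtain ⟨t', w', hw', rfl⟩ := X.exists_decomp hb
  rw [X.mul_decomp hw hw']
  exact X.W_mul_W_le h1 h2 h3 hw hw'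

theorem linearIndependent_triple (X : Table T L s h M) :
    LinearIndependent K ![X.b₀, X.μ₁, X.g 0] := by
  refine linearIndependent_finCons.2 ⟨X.ker_li, fun hb => X.b₀_notMem (T.ker_le_W ?_)⟩
  rw [X.ker_eq]
  simpa [Set.pair_comm] using hb

theorem three_le_finrank (X : Table T L s h M) {S : Submodule K R} (h1 : X.μ₁ ∈ S) (h2 : X.b₀ ∈ S)
    (h3 : X.g 0 ∈ S) : 3 ≤ finrank K S := by
  refine (finrank_span_eq_card X.linearIndependent_triple).ge.trans ?_
  refine Submodule.finrank_mono (span_range_le fun i => ?_)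
  fin_cases i
  exacts [h2, h1, h3]

theorem finrank_le_two (x y : R) : finrank K (Submodule.span K {x, y}) ≤ 2 := by
  classical
  have h1 : ({x, y} : Set R) = (({x, y} : Finset R) : Set R) := by simp
  rw [h1]
  exact (finrank_span_finset_le_card _).trans Finset.card_le_two

theorem f_one_mul_g_zero (X : Table T L s h M) (hN : 0 < numFOf L s) : X.f 1 * X.g 0 = X.μ₁ := by
  rw [X.f_mul_g 1 0 le_rfl hN (Nat.zero_le _), if_neg one_ne_zero, if_pos rfl]

/-- The products `f_1 g_0 = μ₁` and `f_1² = h g_0`, the latter up to `b₀`, show that `𝔪²` is spanned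
by `b₀`, `μ₁` and `g_0`. -/
theorem delta_of_ne (X : Table T L s h M) (hN : 0 < numFOf L s) (hh : h ≠ 0) :
    (T.delta : K) = 1 := by
  have hf := T.W_le (X.f_mem_W le_rfl hN)
  have hg := T.W_le (X.g_mem_W (Nat.zero_le s))
  have h1 : X.μ₁ ∈ maxSq K R := by
    rw [← X.f_one_mul_g_zero hN]
    exact mul_mem_maxSq hf hg
  have h2 : X.g 0 ∈ maxSq K R := by
    have h3 := mul_mem_maxSq hf hf
    rw [X.f_sq 1 le_rfl hN, if_pos rfl] at h3
    rw [← Submodule.smul_mem_iff _ hh]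
    split_ifs at h3
    · exact (Submodule.add_mem_iff_left _ X.b₀_mem).1 h3
    · rwa [add_zero] at h3
  have h4 : 3 ≤ finrank K (maxSq K R) := X.three_le_finrank h1 X.b₀_mem h2
  have h5 : finrank K (maxSq K R) ≤ 3 := by
    have h6 : maxSq K R ≤ Submodule.span K (Set.range ![X.b₀, X.μ₁, X.g 0]) :=
      X.maxSq_le (Submodule.subset_span ⟨1, rfl⟩) (Submodule.subset_span ⟨0, rfl⟩)
        (Submodule.smul_mem _ _ (Submodule.subset_span ⟨2, rfl⟩))
    have h7 := Submodule.finrank_mono h6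
    rwa [finrank_span_eq_card X.linearIndependent_triple] at h7
  rw [Triple.delta, if_pos (le_antisymm h5 h4)]

theorem delta_of_eq_zero (X : Table T L s h M) (hh : h = 0) : (T.delta : K) = 0 := by
  subst hh
  have h6 : maxSq K R ≤ Submodule.span K {X.b₀, X.μ₁} :=
    X.maxSq_le (Submodule.subset_span (by simp)) (Submodule.subset_span (by simp))
      (by rw [zero_smul]; exact zero_mem _)
  have h7 := (Submodule.finrank_mono h6).trans (finrank_le_two _ _)
  rw [Triple.delta, if_neg (by omega)]

/-! ### The maximal dimension of the orbits in the boundary -/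

/-- Points of the open orbit have invertible representatives, so an isotropic element of `W` gives a
boundary point, with orbit of dimension `dim (W w)`. -/
theorem three_le_maxBoundaryDim_of_mem (X : Table T L s h M) {w : R} (hw : w ∈ T.W)
    (hF : T.F w w = 0) (h1 : X.μ₁ ∈ T.W.map (LinearMap.mulRight K w))
    (h2 : X.b₀ ∈ T.W.map (LinearMap.mulRight K w))
    (h3 : X.g 0 ∈ T.W.map (LinearMap.mulRight K w)) : 3 ≤ T.maxBoundaryDim := by
  rw [Triple.maxBoundaryDim_eq]
  refine (X.three_le_finrank h1 h2 h3).trans (le_csSup Triple.bddAbove_boundaryDims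
    ⟨w, ?_, hF, fun v hv c h => ?_, rfl⟩)
  · rintro rfl
    obtain ⟨x, _, hx⟩ := h1
    apply X.μ₁_ne
    rw [← hx]
    simp
  · have h4 := isUnit_expNil (T.W_le hv)
    rw [← h] at h4
    exact (IsLocalRing.mem_maximalIdeal _).1 ((maxSubspace K R).smul_mem c (T.W_le hw)) h4

/-- For `s ≥ 1` the point of `f_1` works, by its products with `g_0`, `g_1` and itself. For `s = 0`
the letter is `C`: there is no `g_1`, and `f_1` is not isotropic since `b₀` occurs in its square.
Adding `I e_k` cures both. -/
theorem three_le_maxBoundaryDim (X : Table T L s h M) {I : K} (hI : I ^ 2 = -1)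
    (hN : 0 < numFOf L s) (hι : s = 0 → Nonempty ι) (hh : h ≠ 0) : 3 ≤ T.maxBoundaryDim := by
  have hf := X.f_mem_W le_rfl hN
  have hg := X.g_mem_W (Nat.zero_le s)
  have hg0 : T.F 1 (X.g 0) = 0 := T.F_one_W hg
  have hf0 := X.f_one_mul_g_zero hN
  have hsq := X.f_sq 1 le_rfl hN
  rw [if_pos rfl] at hsq
  rcases Nat.eq_zero_or_pos s with rfl | hs
  · obtain ⟨k⟩ := hι rfl
    have he := X.e_mem_W k
    have hI0 : I ≠ 0 := by
      rintro rfl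
      norm_num at hI
    have hef := X.e_mul_f k 1 le_rfl hN
    have heg := X.e_mul_g k 0 le_rfl
    have hee := X.e_mul_e k k
    rw [if_pos rfl] at hee hsq
    have hw : X.f 1 + I • X.e k ∈ T.W := T.W.add_mem hf (T.W.smul_mem _ he)
    have e1 : X.g 0 * (X.f 1 + I • X.e k) = X.μ₁ := by
      rw [mul_add, mul_comm, hf0, mul_smul_comm, mul_comm, heg, smul_zero, add_zero]
    have e2 : X.e k * (X.f 1 + I • X.e k) = I • (X.b₀ + M k k • X.μ₁) := by
      rw [mul_add, hef, zero_add, mul_smul_comm, hee]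
    have e3 : X.f 1 * (X.f 1 + I • X.e k) = h • X.g 0 + X.b₀ := by
      rw [mul_add, mul_smul_comm, mul_comm _ (X.e k), hef, smul_zero, add_zero, hsq]
    have m1 : X.μ₁ ∈ T.W.map (LinearMap.mulRight K (X.f 1 + I • X.e k)) := ⟨_, hg, e1⟩
    have m2 : X.b₀ ∈ T.W.map (LinearMap.mulRight K (X.f 1 + I • X.e k)) := by
      have h1 : I • (X.b₀ + M k k • X.μ₁) ∈ T.W.map (LinearMap.mulRight K (X.f 1 + I • X.e k)) :=
        ⟨_, he, e2⟩
      rw [Submodule.smul_mem_iff _ hI0] at h1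
      exact (Submodule.add_mem_iff_left _ (Submodule.smul_mem _ _ m1)).1 h1
    refine X.three_le_maxBoundaryDim_of_mem hw ?_ m1 m2 ?_
    · rw [T.F_eq hw, add_mul, smul_mul_assoc, e3, e2, smul_smul, ← pow_two, hI]
      simp only [map_add, map_smul, hg0, T.F_one_W X.μ₁_mem]
      simp
    · have h1 : h • X.g 0 + X.b₀ ∈ T.W.map (LinearMap.mulRight K (X.f 1 + I • X.e k)) :=
        ⟨_, hf, e3⟩
      rwa [Submodule.add_mem_iff_left _ m2, Submodule.smul_mem_iff _ hh] at h1
  · rw [if_neg (by omega), add_zero] at hsq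
    refine X.three_le_maxBoundaryDim_of_mem hf ?_ ⟨_, hg, ?_⟩ ⟨_, X.g_mem_W hs, ?_⟩ ?_
    · rw [T.F_eq hf, hsq, map_smul, hg0, smul_zero, neg_zero]
    · rw [LinearMap.mulRight_apply, mul_comm, hf0]
    · rw [LinearMap.mulRight_apply, mul_comm, X.f_mul_g 1 1 le_rfl hN hs, if_pos rfl]
    · rw [← Submodule.smul_mem_iff _ hh, ← hsq]
      exact ⟨_, hf, rfl⟩

theorem _root_.AdditiveQuadric.expNil_of_cube {w : R} (hw : w ^ 3 = 0) (hR : 2 ≤ finrank K R) :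
    expNil K w = 1 + w + (1 / 2 : K) • w ^ 2 := by
  rw [expNil, ← Finset.sum_subset (Finset.range_mono (show 3 ≤ finrank K R + 1 by omega))
    fun k _ hk => by
      rw [pow_eq_zero_of_le (by simpa using hk) hw, smul_zero]]
  simp [Finset.sum_range_succ, Nat.factorial]

/-- With `h = 0` the space `𝔪²` is spanned by `b₀` and `μ₁`, and it contains `W v` for every nonunit
`v`. An isotropic unit is a multiple of an exponential of an element of `W`, so it is not a boundary
point. -/
theorem maxBoundaryDim_le_two (X : Table T L s h M) (hh : h = 0) : T.maxBoundaryDim ≤ 2 := by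
  subst hh
  have hb := X.b₀_notMem
  have hbm := AdditiveQuadric.maxSq_le X.b₀_mem
  have hmaxSq : maxSq K R ≤ Submodule.span K {X.b₀, X.μ₁} :=
    X.maxSq_le (Submodule.subset_span (by simp)) (Submodule.subset_span (by simp))
      (by rw [zero_smul]; exact zero_mem _)
  rw [Triple.maxBoundaryDim_eq]
  refine csSup_le' ?_
  rintro _ ⟨v, hv, hF, hO, rfl⟩
  obtain ⟨c, t, w, hw, rfl⟩ := T.exists_eq_decomp hbm hb v
  by_cases hc : c = 0
  · refine (Submodule.finrank_mono ?_).trans (finrank_le_two X.b₀ X.μ₁)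
    rintro _ ⟨x, hx, rfl⟩
    refine hmaxSq (mul_mem_maxSq (T.W_le hx) ?_)
    rw [hc, zero_smul, zero_add]
    exact Submodule.add_mem _ (Submodule.smul_mem _ _ hbm) (T.W_le hw)
  · exfalso
    obtain ⟨p, y, hpy⟩ := Submodule.mem_span_pair.1 (hmaxSq (mul_mem_maxSq (T.W_le hw) (T.W_le hw)))
    rw [T.F_decomp hbm X.b₀_mul hw hw, ← hpy] at hF
    simp only [map_add, map_smul, T.F_one_W X.μ₁_mem, smul_eq_mul, mul_zero, add_zero] at hF
    have hp : p = 2 * c * t := by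
      rw [← sub_mul, mul_eq_zero, or_iff_left X.F_one_b₀_ne] at hF
      linear_combination -hF
    have hμw := X.μ₁_mul w (T.W_le hw)
    have hμμ := X.μ₁_mul X.μ₁ (T.W_le X.μ₁_mem)
    have hbw := X.b₀_mul w (T.W_le hw)
    have hbμ := X.b₀_mul X.μ₁ (T.W_le X.μ₁_mem)
    -- This is the logarithm of `c⁻¹ v`: the correction cancels the `μ₁`-part of `u² / 2`, and
    -- isotropy makes the `b₀`-part equal to `t / c`.
    have hu : c⁻¹ • w - (y / (2 * c ^ 2)) • X.μ₁ ∈ T.W :=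
      T.W.sub_mem (T.W.smul_mem _ hw) (T.W.smul_mem _ X.μ₁_mem)
    have hu2 : (c⁻¹ • w - (y / (2 * c ^ 2)) • X.μ₁) ^ 2 = (c⁻¹ ^ 2) • (p • X.b₀ + y • X.μ₁) := by
      rw [hpy, pow_two]
      simp only [sub_mul, mul_sub, smul_mul_assoc, mul_smul_comm, hμw, mul_comm w X.μ₁, hμμ,
        smul_zero, sub_zero, smul_smul, pow_two]
    have hu3 : (c⁻¹ • w - (y / (2 * c ^ 2)) • X.μ₁) ^ 3 = 0 := by
      rw [pow_succ, hu2]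
      simp only [add_mul, mul_sub, smul_mul_assoc, mul_smul_comm, hμw, hμμ, hbw, hbμ, smul_zero,
        sub_zero, add_zero]
    have hR : 2 ≤ finrank K R := by
      have := X.three_le_finrank (S := ⊤) trivial trivial trivial
      rw [finrank_top] at this
      omega
    apply hO _ hu c⁻¹
    rw [expNil_of_cube hu3 hR, hu2, hp]
    simp only [smul_add, smul_smul, inv_mul_cancel₀ hc, one_smul]
    have e1 : 1 / 2 * (c⁻¹ ^ 2 * (2 * c * t)) = c⁻¹ * t := by field_simp
    have e2 : 1 / 2 * (c⁻¹ ^ 2 * y) = y / (2 * c ^ 2) := by field_simp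
    rw [e1, e2]
    abel

/-! ### Normalization of the scalar `h` -/

/-- The rescaling with `a = 1` keeps the matrix and changes `b₀`, which is harmless when only an
algebra isomorphism is wanted. -/
theorem exists_normalized (X : Table T L s h M) : Nonempty (Table T L s (T.delta : K) M) := by
  rcases Nat.eq_zero_or_pos (numFOf L s) with hN | hN
  · exact ⟨X.relabel hN _⟩
  by_cases hh : h = 0
  · rw [X.delta_of_eq_zero hh, ← hh]
    exact ⟨X⟩
  · rw [X.delta_of_ne hN hh]
    have hv : h⁻¹ ≠ 0 := inv_ne_zero hh
    have Y := X.rescale (a := 1) (v := h⁻¹) (r := h⁻¹ ^ 2) (q := h⁻¹) one_ne_zero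
      (inv_ne_zero hh) (inv_ne_zero hh) (by rw [one_mul]) (fun _ => rfl) (fun _ => by rw [one_mul])
    have e1 : h * (h⁻¹ ^ 2) ^ 2 * (1 ^ s * h⁻¹)⁻¹ ^ 3 = 1 := by
      rw [one_pow, one_mul]
      field_simp
    have e2 : (1 : K)⁻¹ • M = M := by rw [inv_one, one_smul]
    rw [e1, e2] at Y
    exact ⟨Y⟩

/-- A table with the same `b₀` and with `h` normalized. -/
theorem exists_normalized_b₀ (X : Table T L s h M) :
    ∃ M' : Matrix ι ι K, ∃ Y : Table T L s (T.delta : K) M', Y.b₀ = X.b₀ := by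
  rcases Nat.eq_zero_or_pos (numFOf L s) with hN | hN
  · exact ⟨M, X.relabel hN _, rfl⟩
  by_cases hh : h = 0
  · rw [X.delta_of_eq_zero hh, ← hh]
    exact ⟨M, X, rfl⟩
  · rw [X.delta_of_ne hN hh]
    have key : ∀ a v : K, a ≠ 0 → v ≠ 0 → (L = .B → a = v ^ 2) → (L = .C → v ^ 2 = a * a) →
        h * a ^ 2 * (a ^ s * v)⁻¹ ^ 3 = 1 →
        ∃ M' : Matrix ι ι K, ∃ Y : Table T L s (1 : K) M', Y.b₀ = X.b₀ := by
      intro a v ha hv hB hC h1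
      let Y := X.rescale (r := a) (q := 1) ha hv one_ne_zero (by simp) hB hC
      have hY : Y.b₀ = X.b₀ := by
        change (1 : K) ^ 2 • X.b₀ = X.b₀
        rw [one_pow, one_smul]
      have hcast : ∀ h₁ : K, h₁ = 1 → ∀ Z : Table T L s h₁ (a⁻¹ • M), Z.b₀ = X.b₀ →
          ∃ M' : Matrix ι ι K, ∃ Y : Table T L s (1 : K) M', Y.b₀ = X.b₀ := by
        rintro _ rfl Z hZ
        exact ⟨_, Z, hZ⟩
      exact hcast _ h1 Y hY
    -- With `q = 1` and `r = a` the equation is `h a² = (a^s v)³`. For the letter `B` the constraint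
    -- `a = v²` turns it into `v^(6s-1) = h`; otherwise `a = v` gives `v^(3s+1) = h`.
    by_cases hL : L = .B
    · have hs : 0 < s := by rw [hL] at hN; exact hN
      obtain ⟨v, hv⟩ := IsAlgClosed.exists_pow_nat_eq h (n := 6 * s - 1) (by omega)
      have hv0 : v ≠ 0 := by
        rintro rfl
        rw [zero_pow (by omega)] at hv
        exact hh hv.symm
      refine key (v ^ 2) v (pow_ne_zero 2 hv0) hv0 (fun _ => rfl) (fun h => ?_) ?_
      · rw [hL] at h; cases h
      · obtain ⟨s, rfl⟩ : ∃ s', s = s' + 1 := ⟨s - 1, by omega⟩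
        rw [← hv, show 6 * (s + 1) - 1 = 6 * s + 5 by omega]
        field_simp
        ring
    · obtain ⟨v, hv⟩ := IsAlgClosed.exists_pow_nat_eq h (n := 3 * s + 1) (by omega)
      have hv0 : v ≠ 0 := by
        rintro rfl
        rw [zero_pow (by omega)] at hv
        exact hh hv.symm
      refine key v v hv0 hv0 (fun h => (hL h).elim) (fun _ => pow_two v) ?_
      rw [← hv]
      field_simp
      ring

end Table

end TableChange

end AdditiveQuadric

namespace AdditiveQuadric

/-! ### Comparing two tables -/

section Comparison

variable {K R R' : Type*} [Field K] [IsAlgClosed K] [CharZero K]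
variable [CommRing R] [IsLocalRing R] [Algebra K R] [FiniteDimensional K R]
variable [CommRing R'] [IsLocalRing R'] [Algebra K R'] [FiniteDimensional K R']
variable {T : Triple K R} {T' : Triple K R'} {L : Triple.Letter} {s : ℕ} {h h' : K}
variable {ι ι' : Type*} {M : Matrix ι ι K} {M' : Matrix ι' ι' K}

namespace Table

theorem mul_of_socle {A : Type*} [CommRing A] [Algebra K A] (c t c' t' : K) {b w w' : A}
    (h1 : b * b = 0) (h2 : b * w = 0) (h3 : b * w' = 0) :
    (c • 1 + t • b + w) * (c' • 1 + t' • b + w') =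
      (c * c') • 1 + (c * t' + c' * t) • b + c • w' + c' • w + w * w' := by
  simp only [Algebra.smul_def, map_mul, map_add]
  linear_combination (algebraMap K A t * algebraMap K A t') * h1 +
    algebraMap K A t' * h2 + algebraMap K A t * h3

/-- All the elements of the table together with `1`. -/
def fullFamily (X : Table T L s h M) :
    Unit ⊕ Unit ⊕ (Unit ⊕ Fin (s + 1) ⊕ ι ⊕ Fin (numFOf L s)) → R :=
  Sum.elim (fun _ => 1) (Sum.elim (fun _ => X.b₀) X.family)

theorem linearIndependent_fullFamily [Fintype ι] (X : Table T L s h M) :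
    LinearIndependent K X.fullFamily := by
  rw [Fintype.linearIndependent_iff]
  intro c hc
  rw [Fintype.sum_sum_type, Fintype.sum_unique, Fintype.sum_sum_type, Fintype.sum_unique] at hc
  change c (.inl ()) • (1 : R) + (c (.inr (.inl ())) • X.b₀ +
    ∑ i, c (.inr (.inr i)) • X.family i) = 0 at hc
  have hfam : ∀ i, X.family i ∈ T.W := fun i => by
    rw [← X.span_family]; exact Submodule.subset_span ⟨i, rfl⟩
  have hw : ∑ i, c (.inr (.inr i)) • X.family i ∈ T.W :=
    Submodule.sum_mem _ fun i _ => T.W.smul_mem _ (hfam i)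
  have h1 : c (.inl ()) = 0 := by
    refine Triple.algebraMap_mem_max (R := R) ?_
    rw [Algebra.algebraMap_eq_smul_one, eq_neg_of_add_eq_zero_left hc]
    exact Submodule.neg_mem _ (Submodule.add_mem _
      (Submodule.smul_mem _ _ (AdditiveQuadric.maxSq_le X.b₀_mem)) (T.W_le hw))
  rw [h1, zero_smul, zero_add] at hc
  have h2 := X.coeff_b₀ hw hc
  rw [h2, zero_smul, zero_add] at hc
  have h3 := Fintype.linearIndependent_iff.1 X.linearIndependent_family _ hc
  rintro (_ | _ | i)
  exacts [h1, h2, h3 i]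

theorem span_fullFamily [Fintype ι] (X : Table T L s h M) :
    ⊤ ≤ Submodule.span K (Set.range X.fullFamily) := by
  intro x _
  obtain ⟨c, t, w, hw, rfl⟩ := T.exists_eq_decomp (AdditiveQuadric.maxSq_le X.b₀_mem) X.b₀_notMem x
  refine add_mem (add_mem (Submodule.smul_mem _ _ (Submodule.subset_span ⟨.inl (), rfl⟩))
    (Submodule.smul_mem _ _ (Submodule.subset_span ⟨.inr (.inl ()), rfl⟩))) ?_
  rw [← X.span_family] at hw
  refine Submodule.span_mono ?_ hw
  rintro _ ⟨i, rfl⟩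
  exact ⟨.inr (.inr i), rfl⟩

/-- Tables with the same parameters define the same multiplication. -/
theorem exists_algEquiv [Fintype ι] (X : Table T L s h M) (X' : Table T' L s h M) :
    ∃ Γ : R ≃ₐ[K] R', Γ X.μ₁ = X'.μ₁ ∧ Γ X.b₀ = X'.b₀ ∧ (∀ j ≤ s, Γ (X.g j) = X'.g j) ∧
      (∀ k, Γ (X.e k) = X'.e k) ∧ (∀ i, 1 ≤ i → i ≤ numFOf L s → Γ (X.f i) = X'.f i) ∧
      T.W.map Γ.toLinearMap = T'.W := by
  let B := Basis.mk X.linearIndependent_fullFamily X.span_fullFamily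
  let B' := Basis.mk X'.linearIndependent_fullFamily X'.span_fullFamily
  let Λ : R ≃ₗ[K] R' := B.equiv B' (Equiv.refl _)
  have hΛ : ∀ i, Λ (X.fullFamily i) = X'.fullFamily i := by
    intro i
    have h1 : B i = X.fullFamily i := Basis.mk_apply _ _ i
    have h2 : B' i = X'.fullFamily i := Basis.mk_apply _ _ i
    rw [← h1, ← h2]
    exact B.equiv_apply i B' (Equiv.refl _)
  have h1 : Λ 1 = 1 := hΛ (.inl ())
  have hb : Λ X.b₀ = X'.b₀ := hΛ (.inr (.inl ()))
  have hμ : Λ X.μ₁ = X'.μ₁ := hΛ (.inr (.inr (.inl ())))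
  have hg : ∀ j ≤ s, Λ (X.g j) = X'.g j := fun j hj =>
    hΛ (.inr (.inr (.inr (.inl ⟨j, by omega⟩))))
  have he : ∀ k, Λ (X.e k) = X'.e k := fun k => hΛ (.inr (.inr (.inr (.inr (.inl k)))))
  have hf : ∀ i, 1 ≤ i → i ≤ numFOf L s → Λ (X.f i) = X'.f i := by
    rintro (_ | i) h1 h2
    · omega
    · exact hΛ (.inr (.inr (.inr (.inr (.inr ⟨i, by omega⟩)))))
  have hWmap : T.W.map (Λ : R →ₗ[K] R') = T'.W := by
    rw [← X.span_family, ← X'.span_family, Submodule.map_span, ← Set.range_comp]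
    congr 2
    ext i
    exact hΛ (.inr (.inr i))
  have hWmem : ∀ x ∈ T.W, Λ x ∈ T'.W := fun x hx => hWmap ▸ ⟨x, hx, rfl⟩
  have hsymm : ∀ {x y : R}, Λ (x * y) = Λ x * Λ y → Λ (y * x) = Λ y * Λ x := fun h => by
    rw [mul_comm, h, mul_comm]
  have hW : ∀ x : R, Λ (x * X.μ₁) = Λ x * Λ X.μ₁ →
      (∀ j ≤ s, Λ (x * X.g j) = Λ x * Λ (X.g j)) → (∀ k, Λ (x * X.e k) = Λ x * Λ (X.e k)) →
      (∀ i, 1 ≤ i → i ≤ numFOf L s → Λ (x * X.f i) = Λ x * Λ (X.f i)) →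
      ∀ y ∈ T.W, Λ (x * y) = Λ x * Λ y := fun x a1 a2 a3 a4 =>
    X.W_le (S := LinearMap.eqLocus ((Λ : R →ₗ[K] R') ∘ₗ LinearMap.mulLeft K x)
      (LinearMap.mulLeft K (Λ x) ∘ₗ (Λ : R →ₗ[K] R'))) a1 a2 a3 a4
  have mμ : ∀ y ∈ T.W, Λ (X.μ₁ * y) = Λ X.μ₁ * Λ y := fun y hy => by
    rw [X.μ₁_mul y (T.W_le hy), hμ, X'.μ₁_mul _ (T'.W_le (hWmem y hy)), map_zero]
  have mfg : ∀ i j, 1 ≤ i → i ≤ numFOf L s → j ≤ s →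
      Λ (X.f i * X.g j) = Λ (X.f i) * Λ (X.g j) := by
    intro i j hi1 hi hj
    rw [X.f_mul_g i j hi1 hi hj, hf i hi1 hi, hg j hj, X'.f_mul_g i j hi1 hi hj]
    split_ifs
    exacts [hb, hμ, map_zero _]
  have meg : ∀ k j, j ≤ s → Λ (X.e k * X.g j) = Λ (X.e k) * Λ (X.g j) := fun k j hj => by
    rw [X.e_mul_g k j hj, he k, hg j hj, X'.e_mul_g k j hj, map_zero]
  have mef : ∀ k i, 1 ≤ i → i ≤ numFOf L s → Λ (X.e k * X.f i) = Λ (X.e k) * Λ (X.f i) :=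
    fun k i hi1 hi => by
      rw [X.e_mul_f k i hi1 hi, he k, hf i hi1 hi, X'.e_mul_f k i hi1 hi, map_zero]
  have mg : ∀ j ≤ s, ∀ y ∈ T.W, Λ (X.g j * y) = Λ (X.g j) * Λ y := by
    intro j hj
    refine hW _ (hsymm (mμ _ (X.g_mem_W hj))) (fun i hi => ?_) (fun k => hsymm (meg k j hj))
      (fun i hi1 hi => hsymm (mfg i j hi1 hi hj))
    rw [X.g_mul_g j i hj hi, hg j hj, hg i hi, X'.g_mul_g j i hj hi]
    split_ifs
    exacts [hμ, map_zero _]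
  have me : ∀ k, ∀ y ∈ T.W, Λ (X.e k * y) = Λ (X.e k) * Λ y := by
    intro k
    refine hW _ (hsymm (mμ _ (X.e_mem_W k))) (fun j hj => meg k j hj) (fun l => ?_) (mef k)
    rw [X.e_mul_e, he k, he l, X'.e_mul_e, map_add, map_smul, hμ]
    split_ifs
    · rw [hb]
    · rw [map_zero]
  have mf : ∀ i, 1 ≤ i → i ≤ numFOf L s → ∀ y ∈ T.W, Λ (X.f i * y) = Λ (X.f i) * Λ y := by
    intro i hi1 hi
    refine hW _ (hsymm (mμ _ (X.f_mem_W hi1 hi))) (fun j hj => mfg i j hi1 hi hj)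
      (fun k => hsymm (mef k i hi1 hi)) (fun j hj1 hj => ?_)
    rw [hf i hi1 hi, hf j hj1 hj]
    rcases lt_trichotomy i j with hij | rfl | hij
    · rw [X.f_mul_f i j hi1 hij hj, X'.f_mul_f i j hi1 hij hj, map_zero]
    · rw [X.f_sq i hi1 hi, X'.f_sq i hi1 hi, map_add]
      congr 1
      · split_ifs
        · rw [map_smul, hg 0 (Nat.zero_le _)]
        · rw [map_zero]
      · split_ifs
        · rw [hb]
        · rw [map_zero]
    · rw [mul_comm, X.f_mul_f j i hj1 hij hi, mul_comm, X'.f_mul_f j i hj1 hij hi, map_zero]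
  have mW : ∀ x ∈ T.W, ∀ y ∈ T.W, Λ (x * y) = Λ x * Λ y := fun x hx y hy =>
    hsymm (hW y (hsymm (mμ y hy)) (fun j hj => hsymm (mg j hj y hy)) (fun k => hsymm (me k y hy))
      (fun i hi1 hi => hsymm (mf i hi1 hi y hy)) x hx)
  have hmul : ∀ x y, Λ (x * y) = Λ x * Λ y := by
    intro x y
    have hbm := AdditiveQuadric.maxSq_le X.b₀_mem
    obtain ⟨c, t, w, hw, rfl⟩ := T.exists_eq_decomp hbm X.b₀_notMem x
    obtain ⟨c', t', w', hw', rfl⟩ := T.exists_eq_decomp hbm X.b₀_notMem y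
    have hbm' := AdditiveQuadric.maxSq_le X'.b₀_mem
    rw [mul_of_socle c t c' t' (X.b₀_mul _ hbm) (X.b₀_mul _ (T.W_le hw)) (X.b₀_mul _ (T.W_le hw'))]
    simp only [map_add, map_smul, h1, hb, mW w hw w' hw']
    rw [mul_of_socle c t c' t' (X'.b₀_mul _ hbm') (X'.b₀_mul _ (T'.W_le (hWmem _ hw)))
      (X'.b₀_mul _ (T'.W_le (hWmem _ hw')))]
  exact ⟨AlgEquiv.ofLinearEquiv Λ h1 hmul, hμ, hb, hg, he, hf, hWmap⟩

/-- Without `f`-components the only product of `g`'s that could contribute is `g_s²` for the letter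
`B`, and it suffices that one factor lacks `g_s`. Only the `e`-parts are left. -/
theorem comb_mul_comb [Fintype ι] (X : Table T L s h M) {α α' : K} {β β' : ℕ → K} {κ κ' : ι → K}
    {d d' : ℕ → K} (hd : ∀ i < numFOf L s, d i = 0) (hd' : ∀ i < numFOf L s, d' i = 0)
    (hβ : L = .B → β s = 0) :
    X.comb α β κ d * X.comb α' β' κ' d' =
      (∑ k, κ k * κ' k) • X.b₀ + (∑ k, ∑ l, κ l * M l k * κ' k) • X.μ₁ := by
  have h1 : ∀ j ∈ Finset.range (s + 1), β' j • (X.comb α β κ d * X.g j) = 0 := by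
    intro j hj
    have hj' : j ≤ s := Nat.lt_succ_iff.1 (Finset.mem_range.1 hj)
    have hN := le_numFOf L s
    have e1 : (if 1 ≤ j then d (j - 1) else 0) = 0 := by
      split_ifs
      · exact hd _ (by omega)
      · rfl
    have e2 : (if j < numFOf L s then d j else 0) = 0 := by
      split_ifs with h
      · exact hd _ h
      · rfl
    classical
    have e3 : (if L = .B ∧ j = s then β s else 0) = 0 := by
      split_ifs with h
      · exact hβ h.1
      · rfl
    rw [X.comb_mul_g _ _ _ _ hj', e1, e2, add_zero, zero_smul, zero_add]
    convert smul_zero (β' j) using 2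
    convert zero_smul K X.μ₁ using 2
  have h2 : X.comb α β κ d * X.μ₁ = 0 := by
    rw [mul_comm, X.μ₁_mul _ (T.W_le (X.comb_mem _ _ _ _))]
  have h3 : ∀ i ∈ Finset.range (numFOf L s), d' i • (X.comb α β κ d * X.f (i + 1)) = 0 :=
    fun i hi => by rw [hd' i (Finset.mem_range.1 hi), zero_smul]
  rw [show X.comb α' β' κ' d' = α' • X.μ₁ + ∑ j ∈ Finset.range (s + 1), β' j • X.g j +
    ∑ k, κ' k • X.e k + ∑ i ∈ Finset.range (numFOf L s), d' i • X.f (i + 1) from rfl]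
  simp only [mul_add, Finset.mul_sum, mul_smul_comm]
  rw [Finset.sum_eq_zero h1, Finset.sum_eq_zero h3, h2, smul_zero, add_zero, zero_add, zero_add]
  simp only [X.comb_mul_e, smul_add, smul_smul, Finset.sum_add_distrib, ← Finset.sum_smul]
  congr 2
  · exact Finset.sum_congr rfl fun k _ => mul_comm _ _
  · exact Finset.sum_congr rfl fun k _ => by rw [mul_comm, Finset.sum_mul]

/-- Inside `Ker F` only the line of `μ₁` is killed by the maximal ideal: `g_0` is sent to `μ₁` by
`f_1`, or by itself when there is no `f_1` and the letter is `B`. -/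
theorem map_μ₁ (X : Table T L s h M) (X' : Table T' L s h' M') (hN : L = .B ∨ 0 < numFOf L s)
    {Γ : R ≃ₐ[K] R'} {c : K} (H : Triple.Similar T T' Γ c) :
    ∃ γ : K, γ ≠ 0 ∧ Γ X.μ₁ = γ • X'.μ₁ := by
  have h1 := (H.mem_ker X.μ₁).2 X.μ₁_mem_ker
  rw [X'.ker_eq, Submodule.mem_span_pair] at h1
  obtain ⟨γ, z, hz⟩ := h1
  have h2 : ∀ w ∈ maxSubspace K R', Γ X.μ₁ * w = 0 := fun w hw => by
    rw [← Γ.apply_symm_apply w, ← map_mul,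
      X.μ₁_mul _ (Triple.map_mem_maxSubspace Γ.symm hw), map_zero]
  have h3 : ∀ w ∈ maxSubspace K R', X'.g 0 * w = X'.μ₁ → z = 0 := by
    intro w hw hg
    have h4 := h2 w hw
    rw [← hz, add_mul, smul_mul_assoc, smul_mul_assoc, X'.μ₁_mul w hw, hg, smul_zero, zero_add,
      smul_eq_zero] at h4
    exact h4.resolve_right X'.μ₁_ne
  have hz0 : z = 0 := by
    rcases Nat.eq_zero_or_pos (numFOf L s) with h0 | h0
    · have hB : L = .B := hN.resolve_right (by omega)
      subst hB
      have hs : s = 0 := h0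
      subst hs
      refine h3 _ (T'.W_le (X'.g_mem_W le_rfl)) ?_
      rw [X'.g_mul_g 0 0 le_rfl le_rfl, if_pos ⟨rfl, rfl, rfl⟩]
    · refine h3 _ (T'.W_le (X'.f_mem_W le_rfl h0)) ?_
      rw [mul_comm, X'.f_one_mul_g_zero h0]
  rw [hz0, zero_smul, add_zero] at hz
  refine ⟨γ, ?_, hz.symm⟩
  rintro rfl
  rw [zero_smul, eq_comm, EmbeddingLike.map_eq_zero_iff] at hz
  exact X.μ₁_ne hz

open Matrix in
/-- Comparison of the matrices of two tables related by an isomorphism. -/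
theorem exists_comparison [Fintype ι] [Fintype ι'] [DecidableEq ι] [DecidableEq ι']
    (X : Table T L s h M) (X' : Table T' L s h' M') (hN : L = .B ∨ 0 < numFOf L s)
    {Γ : R ≃ₐ[K] R'} (hΓ : T.W.map Γ.toLinearMap = T'.W) :
    ∃ (P : Matrix ι' ι K) (β γ y : K), β ≠ 0 ∧ γ ≠ 0 ∧ Pᵀ * P = β • 1 ∧ P * Pᵀ = β • 1 ∧
      Pᵀ * M' * P = y • 1 + γ • M ∧
      (Nonempty ι → Γ X.b₀ = β • X'.b₀ + y • X'.μ₁ ∧ Γ X.μ₁ = γ • X'.μ₁) := by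
  have H := Triple.similar_of_map hΓ (AdditiveQuadric.maxSq_le X.b₀_mem) X.b₀_notMem X.b₀_mul
  have hcard : Fintype.card ι' = Fintype.card ι := by
    have h1 := LinearEquiv.finrank_map_eq Γ.toLinearEquiv T.W
    have h2 : T.W.map (Γ.toLinearEquiv : R →ₗ[K] R') = T'.W := hΓ
    rw [h2, X.finrank_W, X'.finrank_W] at h1
    omega
  obtain ⟨γ, hγ, hμ⟩ := X.map_μ₁ X' hN H
  have heN : ∀ k, Γ (X.e k) ∈ T'.upper (numFOf L s) := fun k => H.mem_upper.2 (X.e_mem k)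
  choose α β κ d hcomb using fun k => X'.exists_comb (Triple.upper_le_W _ (heN k))
  have hd : ∀ k, ∀ i < numFOf L s, d k i = 0 := fun k i hi =>
    X'.coeff_f_of_mem_upper (hcomb k ▸ heN k) hi
  -- The preimage of `g_s` lies in `V_(s)` and so kills `e_k`; hence the image of `e_k` kills `g_s`,
  -- whose square `μ₁` detects the coefficient.
  have hβ : ∀ k, L = .B → β k s = 0 := by
    rintro k rfl
    have h1 : X'.g s ∈ T'.lower (numFOf .B s) := X'.g_mem_lower le_rfl
    have h2 := X.mul_e_of_mem_lower (H.symm.mem_lower.2 h1) k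
    have h3 : X'.comb (α k) (β k) (κ k) (d k) * X'.g s = 0 := by
      rw [← hcomb, ← Γ.apply_symm_apply (X'.g s), ← map_mul, mul_comm, h2, map_zero]
    rw [X'.comb_mul_g _ _ _ _ le_rfl] at h3
    have h4 := (X'.coeff_b₀_μ₁ h3).2
    rwa [if_pos ⟨rfl, rfl⟩, if_neg (show ¬ s < numFOf .B s from lt_irrefl s), add_zero] at h4
  let P : Matrix ι' ι K := Matrix.of fun j k => κ k j
  have hprod : ∀ k l, Γ (X.e k) * Γ (X.e l) =
      (Pᵀ * P) k l • X'.b₀ + (Pᵀ * M' * P) k l • X'.μ₁ := by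
    intro k l
    rw [hcomb k, hcomb l, X'.comb_mul_comb (hd k) (hd l) (hβ k)]
    simp only [Matrix.mul_apply, Finset.sum_mul, Matrix.transpose_apply]
    rfl
  have hprod' : ∀ k l, Γ (X.e k) * Γ (X.e l) = (1 : Matrix ι ι K) k l • Γ X.b₀ +
      (M k l * γ) • X'.μ₁ := by
    intro k l
    rw [← map_mul, X.e_mul_e, map_add, map_smul, hμ, smul_smul, Matrix.one_apply]
    congr 1
    by_cases hkl : k = l
    · rw [if_pos hkl, if_pos hkl, one_smul]
    · rw [if_neg hkl, if_neg hkl, zero_smul, map_zero]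
  -- With no `e_k` the matrices are empty, and `β = 1`, `y = 0` are arbitrary choices.
  rcases isEmpty_or_nonempty ι with hι | ⟨⟨k₀⟩⟩
  · have hι' : IsEmpty ι' := by
      rw [← Fintype.card_eq_zero_iff] at hι ⊢
      omega
    exact ⟨P, 1, γ, 0, one_ne_zero, hγ, Subsingleton.elim _ _, Subsingleton.elim _ _,
      Subsingleton.elim _ _, fun ⟨k⟩ => hι.elim k⟩
  · obtain ⟨b, y, hb⟩ : ∃ b y : K, Γ X.b₀ = b • X'.b₀ + y • X'.μ₁ := by
      refine ⟨(Pᵀ * P) k₀ k₀, (Pᵀ * M' * P) k₀ k₀ - M k₀ k₀ * γ, ?_⟩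
      have h1 := (hprod k₀ k₀).symm.trans (hprod' k₀ k₀)
      rw [Matrix.one_apply_eq, one_smul] at h1
      rw [sub_smul, ← add_sub_assoc, h1, add_sub_cancel_right]
    have hb0 : b ≠ 0 := by
      rintro rfl
      apply X.b₀_notMem
      rw [← H.mem_W, hb, zero_smul, zero_add]
      exact T'.W.smul_mem _ X'.μ₁_mem
    have key : ∀ k l, (Pᵀ * P) k l = (b • (1 : Matrix ι ι K)) k l ∧
        (Pᵀ * M' * P) k l = (y • (1 : Matrix ι ι K) + γ • M) k l := by
      intro k l
      have h1 := (hprod k l).symm.trans (hprod' k l)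
      rw [hb] at h1
      have h2 : ((Pᵀ * P) k l - b * (1 : Matrix ι ι K) k l) • X'.b₀ +
          ((Pᵀ * M' * P) k l - (y * (1 : Matrix ι ι K) k l + γ * M k l)) • X'.μ₁ = 0 := by
        have h3 := sub_eq_zero.2 h1
        rw [← h3]
        module
      obtain ⟨h3, h4⟩ := X'.coeff_b₀_μ₁ h2
      exact ⟨sub_eq_zero.1 h3, sub_eq_zero.1 h4⟩
    have hPP : Pᵀ * P = b • 1 := by
      ext k l
      exact (key k l).1
    refine ⟨P, b, γ, y, hb0, hγ, hPP, ?_, ?_, fun _ => ⟨hb, hμ⟩⟩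
    · have h1 : (b⁻¹ • Pᵀ) * P = 1 := by
        rw [Matrix.smul_mul, hPP, smul_smul, inv_mul_cancel₀ hb0, one_smul]
      have h2 := (Matrix.mul_eq_one_comm_of_equiv (Fintype.equivOfCardEq hcard.symm)).1 h1
      rw [Matrix.mul_smul] at h2
      rw [← h2, smul_smul, mul_inv_cancel₀ hb0, one_smul]
    · ext k l
      exact (key k l).2

end Table

end Comparison

end AdditiveQuadric

namespace AdditiveQuadric

/-! ### Affine changes of the matrix and existence of normalized sets -/

section Classification

variable {K R R' : Type*} [Field K] [IsAlgClosed K] [CharZero K]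
variable [CommRing R] [IsLocalRing R] [Algebra K R] [FiniteDimensional K R]
variable [CommRing R'] [IsLocalRing R'] [Algebra K R'] [FiniteDimensional K R']
variable {T : Triple K R} {T' : Triple K R'} {L : Triple.Letter} {s : ℕ} {h h' : K}
variable {ι ι' : Type*} {M : Matrix ι ι K} {M' : Matrix ι' ι' K}

/-- Replacing `b₀` by `b₀ + c μ₁`. -/
def Triple.Frame.shift (P : T.Frame) (c : K) : T.Frame :=
  have h1 : P.μ₁ ∈ LinearMap.ker T.F := P.ker_eq ▸ Submodule.subset_span (by simp)
  have h2 : P.μ₂ ∈ LinearMap.ker T.F := P.ker_eq ▸ Submodule.subset_span (by simp)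
  { P with
    b₀ := P.b₀ + c • P.μ₁
    b₀_mem := by
      refine add_mem P.b₀_mem (Submodule.smul_mem _ _ ?_)
      rw [← P.w_mul]
      exact mul_mem_maxSq (T.W_le P.w_mem) (T.W_le (T.ker_le_W h2))
    F_one_b₀ := by
      rw [map_add, map_smul, T.F_one_of_mem_ker h1, P.F_one_b₀, smul_zero, add_zero]
    b₀_mul := fun x hx => by
      rw [add_mul, smul_mul_assoc, P.b₀_mul x hx, P.μ₁_mul x hx, smul_zero, add_zero]
    W_mul_W := fun a ha b hb => by
      rw [smul_add, ← sub_sub]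
      exact sub_mem (P.W_mul_W a ha b hb) (Submodule.smul_mem _ _ (Submodule.smul_mem _ _ h1)) }

/-- The excluded case is the letter `A` at level 0, where `W` annihilates `Ker F` and the singular
locus is fixed pointwise. -/
theorem Triple.letter_eq_B_or (h : ¬ T.sing ⊆ T.fix) :
    T.letter = .B ∨ 0 < numFOf T.letter T.level := by
  classical
  by_contra! hcon
  obtain ⟨hB, hN⟩ := hcon
  obtain ⟨w, hw, z, hz, hwz⟩ := T.exists_mul_ne_zero h
  have hN' := le_numFOf T.letter T.level
  have hs : T.level = 0 := by omega
  have hA : T.letter = .A := by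
    cases hL : T.letter
    · rfl
    · exact (hB hL).elim
    · rw [hL] at hN
      simp [numFOf] at hN
  have hP : T.ProdZero T.level := by
    unfold Triple.letter at hA
    by_contra h1
    rw [if_neg h1] at hA
    split_ifs at hA
  rw [hs] at hP
  exact hwz (hP w hw z hz)

namespace Table

/-- For the letter `C` the rescaling keeps `b₀`; for the other letters it keeps `μ₁`. -/
theorem exists_smul_matrix (X : Table T L s h M) {a : K} (ha : a ≠ 0) :
    ∃ h', Nonempty (Table T L s h' (a⁻¹ • M)) := by
  by_cases hL : L = .C
  · exact ⟨_, ⟨X.rescale (a := a) (v := a) (r := a) (q := 1) ha ha one_ne_zero (by simp)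
      (fun h => by rw [hL] at h; cases h) (fun _ => pow_two a)⟩⟩
  · obtain ⟨q, hq⟩ := IsAlgClosed.exists_pow_nat_eq a⁻¹ (n := 2) two_pos
    have hq0 : q ≠ 0 := by
      rintro rfl
      rw [zero_pow two_ne_zero, eq_comm, inv_eq_zero] at hq
      exact ha hq
    exact ⟨_, ⟨X.rescale (a := a) (v := 1) (r := 1) (q := q) ha one_ne_zero hq0
      (by rw [hq, mul_inv_cancel₀ ha]) (fun _ => (one_pow 2).symm) (fun h => (hL h).elim)⟩⟩

/-- The matrix of a table can be changed by any affine substitution. -/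
theorem exists_affine [Fintype ι] [DecidableEq ι] (X : Table T T.letter T.level h M)
    (hcorank : T.corank = 2) (hdim : 5 ≤ T.dim) (hunfixed : ¬ T.sing ⊆ T.fix)
    {u : K} (hu : u ≠ 0) (t : K) :
    ∃ h', Nonempty (Table T T.letter T.level h' (u • M + t • (1 : Matrix ι ι K))) := by
  rcases isEmpty_or_nonempty ι with hι | hι
  · rw [Subsingleton.elim (u • M + t • (1 : Matrix ι ι K)) M]
    exact ⟨h, ⟨X⟩⟩
  obtain ⟨P⟩ := T.exists_frame hcorank hdim hunfixed
  have hN := T.letter_eq_B_or hunfixed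
  have hid : T.W.map (AlgEquiv.refl : R ≃ₐ[K] R).toLinearMap = T.W := by
    ext x
    simp
  -- Replacing `b₀` by `b₀ + c μ₁` inside `X` would destroy `f_i g_i = b₀`, so the table is rebuilt
  -- from a shifted frame. `X₀` only serves to express `X.b₀` and `X.μ₁` through the original frame.
  obtain ⟨h₀, p₀, M₀, X₀, hb₀, hμ₀⟩ := P.exists_table
  obtain ⟨-, β, γ, y, hβ, hγ, -, -, -, h1⟩ := X.exists_comparison X₀ hN hid
  obtain ⟨h2, h3⟩ := h1 hι
  -- The shift is chosen so that the comparison with `X₁` has scalar part `y' = t γ / u`.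
  obtain ⟨h₁, p₁, M₁, X₁, hb₁, hμ₁⟩ := (P.shift ((y - t * γ / u) / β)).exists_table
  obtain ⟨Q, β', γ', y', hβ', hγ', e1, e2, e3, h4⟩ := X.exists_comparison X₁ hN hid
  obtain ⟨h5, h6⟩ := h4 hι
  have hbs : X₁.b₀ = X₀.b₀ + ((y - t * γ / u) / β) • X₀.μ₁ := by
    rw [hb₁, hb₀, hμ₀]
    rfl
  have hμs : X₁.μ₁ = X₀.μ₁ := by
    rw [hμ₁, hμ₀]
    rfl
  rw [hbs, hμs] at h5
  rw [hμs] at h6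
  have hγe : γ' = γ := by
    have h7 := h6.symm.trans h3
    rw [← sub_eq_zero, ← sub_smul, smul_eq_zero, or_iff_left X₀.μ₁_ne, sub_eq_zero] at h7
    exact h7
  have h7 : (β' - β) • X₀.b₀ + (β' * ((y - t * γ / u) / β) + y' - y) • X₀.μ₁ = 0 := by
    rw [← sub_eq_zero.2 (h5.symm.trans h2)]
    module
  obtain ⟨h8, h9⟩ := X₀.coeff_b₀_μ₁ h7
  rw [sub_eq_zero] at h8
  subst h8 hγe
  have hy : y' = t * γ' / u := by
    rw [mul_div_cancel₀ _ hβ'] at h9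
    linear_combination h9
  obtain ⟨q, hq⟩ := IsAlgClosed.exists_pow_nat_eq β' (n := 2) two_pos
  have hq0 : q ≠ 0 := by
    rintro rfl
    rw [zero_pow two_ne_zero] at hq
    exact hβ' hq.symm
  have hqq : q⁻¹ * (q⁻¹ * β') = 1 := by
    rw [← hq]
    field_simp
  -- Since `q² = β'`, the matrix `q⁻¹ • Q` is orthogonal and turns `M₁` into `(y' + γ' M) / β'`;
  -- scaling by `β' u / γ'` then gives `u M + t`.
  have Y := X₁.changeE (q⁻¹ • Q)
    (by rw [Matrix.transpose_smul, Matrix.smul_mul, Matrix.mul_smul, e1, smul_smul, smul_smul,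
      mul_assoc, hqq, one_smul])
    (by rw [Matrix.transpose_smul, Matrix.smul_mul, Matrix.mul_smul, e2, smul_smul, smul_smul,
      mul_assoc, hqq, one_smul])
  obtain ⟨h', ⟨Z⟩⟩ := Y.exists_smul_matrix (a := γ' / (β' * u))
    (div_ne_zero hγ' (mul_ne_zero hβ' hu))
  refine ⟨h', ⟨Z.castMatrix ?_⟩⟩
  rw [Matrix.transpose_smul, Matrix.smul_mul, Matrix.smul_mul, Matrix.mul_smul, e3, hy]
  simp only [smul_add, smul_smul]
  rw [add_comm]
  congr 2
  · rw [← hq]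
    field_simp
  · rw [← hq]
    field_simp

/-- Renaming of the elements `e_k`. -/
def reindex (X : Table T L s h M) (ε : ι' ≃ ι) : Table T L s h (M.submatrix ε ε) :=
  have hε : Set.range (X.e ∘ ε) = Set.range X.e := ε.surjective.range_comp X.e
  { X with
    e := X.e ∘ ε
    e_mem := fun k => X.e_mem (ε k)
    upper_le := by rw [hε]; exact X.upper_le
    W_le_span := by rw [hε]; exact X.W_le_span
    e_mul_e := fun k l => by
      rw [Function.comp_apply, Function.comp_apply, X.e_mul_e]
      congr 1
      by_cases hkl : k = l
      · rw [if_pos hkl, if_pos (congrArg ε hkl)]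
      · rw [if_neg hkl, if_neg fun h => hkl (ε.injective h)]
    e_mul_f := fun k => X.e_mul_f (ε k)
    e_mul_g := fun k => X.e_mul_g (ε k) }

/-- Transport along equalities of parameters that keeps track of the elements. -/
theorem exists_cast (X : Table T L s h M) {L' : Triple.Letter} {s' : ℕ} {M₁ : Matrix ι ι K}
    (hL : L = L') (hs : s = s') (hh : h = h') (hM : M = M₁) :
    ∃ Y : Table T L' s' h' M₁, Y.μ₁ = X.μ₁ ∧ Y.b₀ = X.b₀ ∧ Y.g = X.g ∧ Y.f = X.f := by
  subst hL hs hh hM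
  exact ⟨X, rfl, rfl, rfl, rfl⟩

end Table

/-- Canonical matrices with the same blocks, up to a permutation, coincide up to a renaming. -/
theorem BlockData.exists_equiv_of_perm (I : K) {d d' : BlockData K}
    (σ : Fin d.num ≃ Fin d'.num)
    (hσ : ∀ k, d'.size (σ k) = d.size k ∧ d'.eig (σ k) = d.eig k) :
    ∃ ε : d.Index ≃ d'.Index, (d'.matrix I).submatrix ε ε = d.matrix I := by
  have hblock : ∀ {m n : ℕ} (h : m = n) (a : K) (x y : Fin m),
      canonicalBlock I a n (Fin.cast h x) (Fin.cast h y) = canonicalBlock I a m x y := by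
    rintro m _ rfl a x y
    rfl
  refine ⟨Equiv.sigmaCongr σ fun k => finCongr (hσ k).1.symm, ?_⟩
  ext ⟨k, i⟩ ⟨l, j⟩
  change Matrix.blockDiagonal' (fun k => canonicalBlock I (d'.eig k) (d'.size k))
      ⟨σ k, Fin.cast (hσ k).1.symm i⟩ ⟨σ l, Fin.cast (hσ l).1.symm j⟩ =
    Matrix.blockDiagonal' (fun k => canonicalBlock I (d.eig k) (d.size k)) ⟨k, i⟩ ⟨l, j⟩
  by_cases hkl : k = l
  · subst hkl
    rw [Matrix.blockDiagonal'_apply_eq, Matrix.blockDiagonal'_apply_eq]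
    exact (hblock (hσ k).1.symm _ i j).trans (by rw [(hσ k).2])
  · rw [Matrix.blockDiagonal'_apply_ne _ _ _ hkl,
      Matrix.blockDiagonal'_apply_ne _ _ _ fun h => hkl (σ.injective h)]

/-- The scalar `h` is normalized first, because with `b₀` kept fixed this may change the matrix; the
orthogonal reduction afterwards affects neither `b₀` nor `h`. -/
theorem exists_normalizedSet {I : K} (hI : I ^ 2 = -1) (hcorank : T.corank = 2)
    (hdim : 5 ≤ T.dim) (hunfixed : ¬ T.sing ⊆ T.fix) : Nonempty (NormalizedSet I T) := by
  obtain ⟨P⟩ := T.exists_frame hcorank hdim hunfixed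
  obtain ⟨h, p, M, X, hb, -⟩ := P.exists_table
  obtain ⟨M', Y, hY⟩ := X.exists_normalized_b₀
  obtain ⟨d, P', h1, h2, h3⟩ := exists_orthogonal_canonical I hI M' Y.isSymm
  have key : ∀ (N : Matrix d.Index d.Index K), N = d.matrix I →
      ∀ Z : Table T T.letter T.level (T.delta : K) N, Z.b₀ = P.b₀ →
        Nonempty (NormalizedSet I T) := by
    rintro _ rfl Z hZ
    exact ⟨Z.toNormalizedSet (by rw [hZ, P.F_one_b₀])⟩
  exact key _ h3 (Y.changeE P' h1 h2) (hY.trans hb)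

end Classification

end AdditiveQuadric

namespace AdditiveQuadric

/-! ### The two directions of the classification -/

section Classification

variable {K R R' : Type*} [Field K] [IsAlgClosed K] [CharZero K]
variable [CommRing R] [IsLocalRing R] [Algebra K R] [FiniteDimensional K R]
variable [CommRing R'] [IsLocalRing R'] [Algebra K R'] [FiniteDimensional K R']
variable {T : Triple K R} {T' : Triple K R'}

theorem Triple.lower_eq_upper_of_isOne (h : T.normalType.IsOne) :
    T.lower T.numF = T.upper T.numF := by
  unfold Triple.normalType at h
  unfold Triple.numF
  cases hL : T.letter <;> rw [hL] at h <;> simp only at h ⊢ <;> split_ifs at h <;>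
    first
      | assumption
      | (rcases h with h | h | h <;> cases h)

/-- The `e_k` span a complement of `V_(N)` in `V^(N)`, which is zero for these types. -/
theorem NormalizedSet.isEmpty_index {I : K} (N : NormalizedSet I T) (h : T.normalType.IsOne) :
    IsEmpty N.blocks.Index := by
  refine ⟨fun k => ?_⟩
  have h1 := N.upper_disjoint
  rw [T.lower_eq_upper_of_isOne h] at h1
  have h2 : N.e k ∈ Submodule.span K (Set.range N.e) := Submodule.subset_span ⟨k, rfl⟩
  have h3 : N.e k ∈ T.upper T.numF := by
    rw [N.upper_eq]
    exact Submodule.mem_sup_right h2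
  have h4 := Submodule.disjoint_def.1 h1 _ h3 h2
  have h5 := N.linearIndependent.ne_zero (Sum.inr (Sum.inr (Sum.inl k)))
  exact h5 h4

theorem Triple.letter_eq_of_normalType (h : T.normalType = T'.normalType) :
    T.letter = T'.letter := by
  unfold Triple.normalType at h
  cases hL : T.letter <;> cases hL' : T'.letter <;> rw [hL, hL'] at h <;> simp only at h <;>
    first
      | rfl
      | (split_ifs at h)

/-- Both sides detect whether the scalar `h` of a table vanishes; this is how `l` replaces `dim 𝔪²`
as an invariant. -/
theorem Triple.delta_eq_of_maxBoundaryDim {I : K} (hI : I ^ 2 = -1) (hcorank : T.corank = 2)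
    (hdim : 5 ≤ T.dim) (hunfixed : ¬ T.sing ⊆ T.fix) (hN : 0 < numFOf T.letter T.level) :
    (T.delta : K) = if 3 ≤ T.maxBoundaryDim then 1 else 0 := by
  obtain ⟨P⟩ := T.exists_frame hcorank hdim hunfixed
  obtain ⟨h, p, M, X, -, -⟩ := P.exists_table
  by_cases hh : h = 0
  · have := X.maxBoundaryDim_le_two hh
    rw [X.delta_of_eq_zero hh, if_neg (by omega)]
  · rw [X.delta_of_ne hN hh, if_pos (X.three_le_maxBoundaryDim hI hN (fun hs => ?_) hh)]
    -- For `s = 0` there is at most one `f_i`, so dimension at least 5 leaves room for some `e_k`.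
    have h1 := X.finrank_W
    have h2 := numFOf_le T.letter T.level
    rw [Triple.dim] at hdim
    rw [← Fintype.card_pos_iff]
    omega

/-- The given isomorphism only shows that the parameters agree; the matching isomorphism is built
from the two tables. The forms then correspond with factor 1, because `b₀` goes to `b₀` and `F 1 b₀
= -1` on both sides. -/
theorem NormalizedSet.sameStructure {I : K} {Γ : R ≃ₐ[K] R'}
    (hΓ : T.W.map Γ.toLinearMap = T'.W) (h : T.normalType.IsOne) (N : NormalizedSet I T)
    (N' : NormalizedSet I T') : N.SameStructure N' := by
  have H := Triple.similar_of_map hΓ (AdditiveQuadric.maxSq_le N.b₀_mem) N.b₀_notMem N.b₀_mul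
  have hι := N.isEmpty_index h
  have hι' := N'.isEmpty_index (H.normalType ▸ h)
  have hlev := H.level
  have hlet := H.letter
  obtain ⟨Y, hY1, hY2, hY3, hY4⟩ :=
    (N'.toTable.reindex (Equiv.equivOfIsEmpty N.blocks.Index _)).exists_cast
      (M₁ := N.blocks.matrix I) hlet hlev (Triple.delta_eq (T := T) (T' := T') Γ).symm
      (Subsingleton.elim _ _)
  obtain ⟨Δ, hμ, hb, hg, -, hf, hW⟩ := N.toTable.exists_algEquiv Y
  have hnum := T.numF_eq
  have hb' : Δ N.b₀ = N'.b₀ := hb.trans hY2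
  refine ⟨hι, hι', hlev.symm, ?_, Δ, hμ.trans hY1, ?_, hb', fun j _ hj => ?_,
    fun i hi1 hi => ?_, fun a b => ?_⟩
  · rw [hnum, T'.numF_eq, hlet, hlev]
  · rw [← N.g_zero, ← N'.g_zero]
    exact (hg 0 (Nat.zero_le _)).trans (congrFun hY3 0)
  · exact (hg j hj).trans (congrFun hY3 j)
  · exact (hf i hi1 (hnum ▸ hi)).trans (congrFun hY4 i)
  · have H' := Triple.similar_of_map hW (AdditiveQuadric.maxSq_le N.b₀_mem) N.b₀_notMem N.b₀_mul
    rw [H'.F_map, hb', N.F_one_b₀, N'.F_one_b₀, div_self (by norm_num), one_mul]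

-- From `Pᵀ Λ' P = y + γ Λ` and `Pᵀ P = β` one gets `P⁻¹ = β⁻¹ Pᵀ`, so `Λ'` is similar to `(γ / β) Λ
-- + y / β`, and the blocks are similarity invariants.
open Matrix in
theorem NormalizedSet.elementary {I : K} (hI : I ^ 2 = -1) (hunfixed : ¬ T.sing ⊆ T.fix)
    {Γ : R ≃ₐ[K] R'} (hΓ : T.W.map Γ.toLinearMap = T'.W) (N : NormalizedSet I T)
    (N' : NormalizedSet I T') : N.blocks.Elementary N'.blocks := by
  have H := Triple.similar_of_map hΓ (AdditiveQuadric.maxSq_le N.b₀_mem) N.b₀_notMem N.b₀_mul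
  obtain ⟨Y, -⟩ := N'.toTable.exists_cast H.letter H.level rfl rfl
  obtain ⟨P, β, γ, y, hβ, hγ, h1, h2, h3, -⟩ :=
    N.toTable.exists_comparison Y (T.letter_eq_B_or hunfixed) hΓ
  have h4 : P * (β⁻¹ • Pᵀ) = 1 := by
    rw [Matrix.mul_smul, h2, smul_smul, inv_mul_cancel₀ hβ, one_smul]
  have h5 : (β⁻¹ • Pᵀ) * P = 1 := by
    rw [Matrix.smul_mul, h1, smul_smul, inv_mul_cancel₀ hβ, one_smul]
  have h6 : N'.blocks.matrix I * P =
      P * ((γ / β) • N.blocks.matrix I + (y / β) • (1 : Matrix _ _ K)) := by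
    have h7 : N'.blocks.matrix I * P = P * (β⁻¹ • (Pᵀ * N'.blocks.matrix I * P)) := by
      rw [Matrix.mul_assoc, ← Matrix.smul_mul, ← Matrix.mul_assoc, h4, Matrix.one_mul]
    rw [h7, h3, smul_add, smul_smul, smul_smul, add_comm, div_eq_inv_mul, div_eq_inv_mul]
  obtain ⟨σ, hσ⟩ := exists_perm_of_similar hI (div_ne_zero hγ hβ) h4 h5 h6
  exact ⟨γ / β, y / β, div_ne_zero hγ hβ, σ, hσ⟩

/-- Without any `f_i`, that is for the type `B₀`, no product involves `δ`, and it need not be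
recovered from `l`. -/
theorem Triple.delta_eq_or {I : K} (hI : I ^ 2 = -1)
    (hcorank : T.corank = 2) (hcorank' : T'.corank = 2) (hdim : 5 ≤ T.dim) (hdim' : 5 ≤ T'.dim)
    (hunfixed : ¬ T.sing ⊆ T.fix) (hunfixed' : ¬ T'.sing ⊆ T'.fix)
    (hlet : T'.letter = T.letter) (hlev : T'.level = T.level)
    (hl : T.maxBoundaryDim = T'.maxBoundaryDim) :
    numFOf T.letter T.level = 0 ∨ (T'.delta : K) = T.delta := by
  rcases Nat.eq_zero_or_pos (numFOf T.letter T.level) with h | h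
  · exact Or.inl h
  · right
    rw [T.delta_eq_of_maxBoundaryDim hI hcorank hdim hunfixed h,
      T'.delta_eq_of_maxBoundaryDim hI hcorank' hdim' hunfixed' (by rwa [hlet, hlev]), hl]

/-- Triples with tables that have the same parameters are equivalent. -/
theorem Table.equivalent {L : Triple.Letter} {s : ℕ} {h h' : K} {ι : Type*} [Fintype ι]
    {M : Matrix ι ι K} (X : Table T L s h M) (X' : Table T' L s h' M)
    (hh : numFOf L s = 0 ∨ h' = h) : T.Equivalent T' := by
  obtain ⟨Y⟩ : Nonempty (Table T' L s h M) := by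
    rcases hh with hN | rfl
    · exact ⟨X'.relabel hN h⟩
    · exact ⟨X'⟩
  obtain ⟨Γ, -, -, -, -, -, hΓ⟩ := X.exists_algEquiv Y
  exact ⟨Γ, hΓ⟩

-- The elementary transformation is realized by another table of `T` itself. Its matrix, once made
-- canonical, has the blocks of the second matrix by uniqueness; a renaming of the `e_k` absorbs the
-- permutation, and the tables then agree.
open Matrix in
theorem NormalizedSet.equivalent {I : K} (hI : I ^ 2 = -1) (hcorank : T.corank = 2)
    (hdim : 5 ≤ T.dim) (hunfixed : ¬ T.sing ⊆ T.fix)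
    (hlet : T'.letter = T.letter) (hlev : T'.level = T.level)
    (hδ : numFOf T.letter T.level = 0 ∨ (T'.delta : K) = T.delta)
    (N : NormalizedSet I T) (N' : NormalizedSet I T')
    (hNN : N.blocks.Elementary N'.blocks) : T.Equivalent T' := by
  obtain ⟨a, t, ha, σ, hσ⟩ := hNN
  obtain ⟨h, ⟨X⟩⟩ := N.toTable.exists_affine hcorank hdim hunfixed ha t
  obtain ⟨d, P, h1, h2, h3⟩ := exists_orthogonal_canonical I hI _ X.isSymm
  have h4 : d.matrix I * Pᵀ = Pᵀ * (a • N.blocks.matrix I + t • (1 : Matrix _ _ K)) := by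
    rw [← h3, Matrix.mul_assoc, h2, Matrix.mul_one]
  obtain ⟨τ, hτ⟩ := exists_perm_of_similar hI ha h1 h2 h4
  obtain ⟨ε, hε⟩ := BlockData.exists_equiv_of_perm I (d := d) (d' := N'.blocks)
    (τ.symm.trans σ) (fun k => by
      have e1 := hσ (τ.symm k)
      have e2 := hτ (τ.symm k)
      rw [τ.apply_symm_apply] at e2
      rw [Equiv.trans_apply, e1.1, e1.2, e2.1, e2.2]
      exact ⟨rfl, rfl⟩)
  obtain ⟨Y⟩ := ((X.changeE P h1 h2).castMatrix (h3.trans hε.symm)).exists_normalized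
  obtain ⟨Y', -⟩ := (N'.toTable.reindex ε).exists_cast hlet hlev rfl rfl
  exact Y.equivalent Y' hδ

end Classification

end AdditiveQuadric

/-! ### The classification theorem -/

open AdditiveQuadric in
theorem theorem4p9 {K : Type*} [Field K] [IsAlgClosed K] [CharZero K]
    (I : K) (hI : I ^ 2 = -1)
    {R : Type*} [CommRing R] [IsLocalRing R] [Algebra K R] [FiniteDimensional K R]
    {R' : Type*} [CommRing R'] [IsLocalRing R'] [Algebra K R'] [FiniteDimensional K R']
    (T : Triple K R) (T' : Triple K R')
    (hcorank : T.corank = 2) (hcorank' : T'.corank = 2)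
    (hdim : 5 ≤ T.dim) (hdim' : 5 ≤ T'.dim)
    (hunfixed : ¬ T.sing ⊆ T.fix) (hunfixed' : ¬ T'.sing ⊆ T'.fix) :
    -- normalized structures exist
    (Nonempty (NormalizedSet I T) ∧ Nonempty (NormalizedSet I T')) ∧
    -- invariants of equivalent actions
    (T.Equivalent T' →
      (T.normalType = T'.normalType ∧ T.level = T'.level ∧
        T.maxBoundaryDim = T'.maxBoundaryDim) ∧
      (T.normalType.IsOne →
        ∀ (N : NormalizedSet I T) (N' : NormalizedSet I T'), N.SameStructure N') ∧
      (¬ T.normalType.IsOne →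
        ∀ (N : NormalizedSet I T) (N' : NormalizedSet I T'), N.blocks.Elementary N'.blocks)) ∧
    -- the converse
    (T.normalType = T'.normalType → T.maxBoundaryDim = T'.maxBoundaryDim → T.level = T'.level →
      (¬ T.normalType.IsOne →
        ∃ (N : NormalizedSet I T) (N' : NormalizedSet I T'), N.blocks.Elementary N'.blocks) →
      T.Equivalent T') := by
  refine ⟨⟨exists_normalizedSet hI hcorank hdim hunfixed,
    exists_normalizedSet hI hcorank' hdim' hunfixed'⟩, ?_, ?_⟩
  · rintro ⟨Γ, hΓ⟩
    obtain ⟨N⟩ := exists_normalizedSet hI hcorank hdim hunfixed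
    have H := Triple.similar_of_map hΓ (maxSq_le N.b₀_mem) N.b₀_notMem N.b₀_mul
    exact ⟨⟨H.normalType.symm, H.level.symm, H.maxBoundaryDim.symm⟩,
      fun h N N' => N.sameStructure hΓ h N', fun _ N N' => N.elementary hI hunfixed hΓ N'⟩
  · intro htype hl hlev hM
    have hlet := Triple.letter_eq_of_normalType htype
    have hδ := Triple.delta_eq_or hI hcorank hcorank' hdim hdim' hunfixed hunfixed' hlet.symm
      hlev.symm hl
    -- For these types the matrices are empty, so the letter, the level and, where it matters, `δ`
    -- are the only parameters of a table.
    by_cases hone : T.normalType.IsOne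
    · obtain ⟨N⟩ := exists_normalizedSet hI hcorank hdim hunfixed
      obtain ⟨N'⟩ := exists_normalizedSet hI hcorank' hdim' hunfixed'
      have hι := N.isEmpty_index hone
      have hι' := N'.isEmpty_index (htype ▸ hone)
      obtain ⟨Y, -⟩ :=
        (N'.toTable.reindex (Equiv.equivOfIsEmpty N.blocks.Index _)).exists_cast
          (M₁ := N.blocks.matrix I) hlet.symm hlev.symm rfl (Subsingleton.elim _ _)
      exact N.toTable.equivalent Y hδ
    · obtain ⟨N, N', hNN⟩ := hM hone
      exact N.equivalent hI hcorank hdim hunfixed hlet.symm hlev.symm hδ N' hNN
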